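/- Let $d\ge 2$, let $D\subset\mathbb R^d$ be a bounded domain, $T>0$, $Q_T=D\times(0,T)$, and let $\rho_0>0$, $\mu>0$, $\eta\ge 0$ be constants. Write $(\cdot,\cdot)$ for the scalar products of $L^2(D)$ and $L^2(D)^d$. Let $H_0^1(D)^d$ be the closure of $C_0^\infty(D)^d$ in $H^1(D)^d$, with the scalar product $((u,v))=\int_D \partial_i u_k\,\partial_i v_k\,dx$ and the corresponding norm, let $H^{-1}(D)^d$ be its dual space with the dual norm and the pairing $\langle\cdot,\cdot\rangle$, and let $\widehat L^2(D)=\{r\in L^2(D):\int_D r\,dx=0\}$. For $\alpha>0$, $\sigma\in L^2(0,T;L^2(D))$, $s\in L^2(0,T;H^{-1}(D)^d)$, $f\in L^\infty(Q_T)^d$, $u_0\in L^2(D)^d$, $p_0\in L^2(D)$ consider the problem $$\rho_t+\rho_0\operatorname{div}u=\sigma,\qquad \rho=\alpha p,\qquad \rho_0u_t+\nabla p=\mu\Delta u+\eta\nabla\operatorname{div}u+\rho f+s,$$ $$u|_{\partial D}=0,\qquad u|_{t=0}=u_0,\qquad p|_{t=0}=p_0.$$ A weak solution is a pair $(u,p)\in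 L^2(0,T;H_0^1(D)^d)\times L^2(0,T;L^2(D))$ such that, with $\rho=\alpha p$, for all $\varphi\in C_0^\infty([0,T))$, $v\in H_0^1(D)^d$ and $r\in L^2(D)$, $$-\int_0^T(\rho,r)\varphi_t\,dt-(\alpha p_0,r)\varphi(0)+\int_0^T(\rho_0\operatorname{div}u,r)\varphi\,dt=\int_0^T(\sigma,r)\varphi\,dt,$$ $$-\int_0^T\rho_0(u,v)\varphi_t\,dt-\rho_0(u_0,v)\varphi(0)-\int_0^T(p,\operatorname{div}v)\varphi\,dt=-\mu\int_0^T((u,v))\varphi\,dt-\eta\int_0^T(\operatorname{div}u,\operatorname{div}v)\varphi\,dt+\int_0^T(\rho f,v)\varphi\,dt+\int_0^T\langle s,v\rangle\varphi\,dt.$$ Theorem. There are functions $C,\tilde C:\mathbb R\times\mathbb R\to\mathbb R$, determined by $d,D,T,\rho_0,\mu,\eta$ only, such that for every fixed $M\ge0$ the quantities $C(M,\alpha)$ and $\tilde C(M,\alpha)$ stay bounded as $\alpha\to0^+$, and such that for all $\alpha>0$ and all data $f,\sigma,s,u_0,p_0$ as above the problem has a unique weak solution $(u,p)$, and this solution satisfies,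 with $$M=\|f\|_{L^\infty(Q_T)^d},\qquad E=\|u_0\|_{L^2(D)^d}+\sqrt\alpha\,\|p_0\|_{L^2(D)}+\frac1{\sqrt\alpha}\|\sigma\|_{L^2(0,T;L^2(D))}+\|s\|_{L^2(0,T;H^{-1}(D)^d)},$$ the following. (1) $\|u\|_{L^2(0,T;H_0^1(D)^d)}+\|u\|_{L^\infty(0,T;L^2(D)^d)}+\sqrt\alpha\,\|p\|_{L^\infty(0,T;L^2(D))}\le C(M,\alpha)\,E$. (2) $u$, viewed as a function with values in $H^{-1}(D)^d$ through $u\mapsto(u,\cdot)$, has a weak time derivative $u_t\in L^2(0,T;H^{-1}(D)^d)$, and $$\|u\|_{L^2(0,T;H_0^1(D)^d)}+\|u_t\|_{L^2(0,T;H^{-1}(D)^d)}\le\frac1{\sqrt\alpha}\,\tilde C(M,\alpha)\,E.$$ (3) If $p_0\in\widehat L^2(D)$ and $\sigma\in L^2(0,T;\widehat L^2(D))$, then $p\in W^{1,2}(0,T;\widehat L^2(D))$, i.e. $p(t)\in\widehat L^2(D)$ for almost every $t$ and $p$ has a weak time derivative in $L^2(0,T;\widehat L^2(D))$. -/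

import Mathlib

open MeasureTheory Set Filter Topology
open scoped ContDiff ENNReal

noncomputable section

namespace LinearizedFluid

/-- The space `ℝᵈ` with its Euclidean norm. -/
abbrev Space (d : ℕ) : Type := EuclideanSpace ℝ (Fin d)

/-- The space of real `d × d` matrices with the Frobenius norm. -/
abbrev Mat (d : ℕ) : Type := EuclideanSpace ℝ (Fin d × Fin d)

/-- A bounded domain in `ℝᵈ`: a nonempty, open, connected, bounded set. -/
structure BoundedDomain (d : ℕ) where
  carrier : Set (Space d)
  isOpen : IsOpen carrier
  isConnected : IsConnected carrier
  isBounded : Bornology.IsBounded carrier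

/-- Lebesgue measure on the domain `D`. -/
abbrev BoundedDomain.measure {d : ℕ} (D : BoundedDomain d) : Measure (Space d) :=
  volume.restrict D.carrier

/-- The Lebesgue space `L²(D; F)`; in particular `L²(D)` for `F = ℝ` and `L²(D)ᵈ` for `F = ℝᵈ`. -/
abbrev L2 {d : ℕ} (D : BoundedDomain d) (F : Type) [NormedAddCommGroup F] : Type :=
  Lp F 2 D.measure

/-- The matrix with `(i, k)` entry `∂ᵢ φₖ (x)`. -/
def jacobian {d : ℕ} (φ : Space d → Space d) (x : Space d) : Mat d :=
  WithLp.toLp 2 fun ik => (fderiv ℝ φ x (EuclideanSpace.single ik.1 1)) ik.2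

/-- `φ` belongs to `C₀^∞(D)ᵈ`. -/
def IsTestField {d : ℕ} (D : BoundedDomain d) (φ : Space d → Space d) : Prop :=
  ContDiff ℝ ∞ φ ∧ HasCompactSupport φ ∧ tsupport φ ⊆ D.carrier

theorem jacobian_add {d : ℕ} {φ ψ : Space d → Space d} (hφ : ContDiff ℝ ∞ φ)
    (hψ : ContDiff ℝ ∞ ψ) (x : Space d) :
    jacobian (φ + ψ) x = jacobian φ x + jacobian ψ x := by
  ext ik
  simp [jacobian, fderiv_add (hφ.differentiable (by simp) x) (hψ.differentiable (by simp) x)]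

theorem jacobian_smul {d : ℕ} {φ : Space d → Space d} (hφ : ContDiff ℝ ∞ φ)
    (c : ℝ) (x : Space d) : jacobian (c • φ) x = c • jacobian φ x := by
  ext ik
  simp [jacobian, fderiv_const_smul (hφ.differentiable (by simp) x)]

/-- The pairs `(φ, ∇φ)` with `φ ∈ C₀^∞(D)ᵈ`, as a subspace of `L²(D)ᵈ × L²(D)^{d × d}`; on such
pairs the norm of the product is (equivalent to) the norm of `H¹(D)ᵈ`. -/
def testGraph {d : ℕ} (D : BoundedDomain d) :
    Submodule ℝ (L2 D (Space d) × L2 D (Mat d)) where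
  carrier := {w | ∃ φ : Space d → Space d, IsTestField D φ ∧
    (w.1 : Space d → Space d) =ᵐ[D.measure] φ ∧
    (w.2 : Space d → Mat d) =ᵐ[D.measure] jacobian φ}
  zero_mem' := by
    refine ⟨0, ⟨contDiff_const, HasCompactSupport.zero, by simp⟩, Lp.coeFn_zero _ _ _, ?_⟩
    filter_upwards [Lp.coeFn_zero (Mat d) 2 D.measure] with x hx
    refine hx.trans ?_
    ext ik
    simp [jacobian]
  add_mem' := by
    rintro a b ⟨φ, ⟨h1, h2, h3⟩, h4, h5⟩ ⟨ψ, ⟨k1, k2, k3⟩, k4, k5⟩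
    refine ⟨φ + ψ, ⟨h1.add k1, h2.add k2, (tsupport_add φ ψ).trans (union_subset h3 k3)⟩, ?_, ?_⟩
    · filter_upwards [Lp.coeFn_add a.1 b.1, h4, k4] with x hx h k
      exact hx.trans (congrArg₂ (· + ·) h k)
    · filter_upwards [Lp.coeFn_add a.2 b.2, h5, k5] with x hx h k
      exact hx.trans ((congrArg₂ (· + ·) h k).trans (jacobian_add h1 k1 x).symm)
  smul_mem' := by
    rintro c a ⟨φ, ⟨h1, h2, h3⟩, h4, h5⟩
    refine ⟨c • φ, ⟨contDiff_const.smul h1, h2.smul_left (f := fun _ => c),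
      (tsupport_smul_subset_right (fun _ => c) φ).trans h3⟩, ?_, ?_⟩
    · filter_upwards [Lp.coeFn_smul c a.1, h4] with x hx h
      exact hx.trans (congrArg (c • ·) h)
    · filter_upwards [Lp.coeFn_smul c a.2, h5] with x hx h
      exact hx.trans ((congrArg (c • ·) h).trans (jacobian_smul h1 c x).symm)

theorem norm_partial_le {d : ℕ} (φ : Space d → Space d) (x : Space d) (i : Fin d) :
    ‖fderiv ℝ φ x (EuclideanSpace.single i 1)‖ ≤ ‖jacobian φ x‖ := by
  rw [EuclideanSpace.norm_eq, EuclideanSpace.norm_eq]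
  refine Real.sqrt_le_sqrt ?_
  rw [Fintype.sum_prod_type]
  exact Finset.single_le_sum (f := fun j => ∑ k, ‖jacobian φ x (j, k)‖ ^ 2)
    (fun j _ => Finset.sum_nonneg fun k _ => by positivity) (Finset.mem_univ i)

theorem continuous_jacobian {d : ℕ} {φ : Space d → Space d} (hφ : ContDiff ℝ ∞ φ) :
    Continuous (jacobian φ) := by
  have h := hφ.continuous_fderiv (by simp)
  unfold jacobian
  fun_prop

theorem jacobian_eq_zero {d : ℕ} {φ : Space d → Space d} {x : Space d} (hx : x ∉ tsupport φ) :
    jacobian φ x = 0 := by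
  have h : fderiv ℝ φ x = 0 := by
    by_contra h
    exact hx (support_fderiv_subset ℝ h)
  ext ik
  simp [jacobian, h]

theorem norm_sq_eq_integral {d : ℕ} (D : BoundedDomain d) {F : Type} [NormedAddCommGroup F]
    [InnerProductSpace ℝ F] (w : L2 D F) (g : Space d → F)
    (hw : (w : Space d → F) =ᵐ[D.measure] g) (hg : ∀ x ∉ D.carrier, g x = 0) :
    ‖w‖ ^ 2 = ∫ x, ‖g x‖ ^ 2 := by
  rw [← real_inner_self_eq_norm_sq, L2.inner_def]
  rw [← setIntegral_eq_integral_of_forall_compl_eq_zero (s := D.carrier)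
    (f := fun x => ‖g x‖ ^ 2) (fun x hx => by simp [hg x hx])]
  refine integral_congr_ae ?_
  filter_upwards [hw] with x hx
  rw [hx, real_inner_self_eq_norm_sq]

theorem poincare_field {d : ℕ} (φ : Space d → Space d) (hφ : ContDiff ℝ ∞ φ)
    (hc : HasCompactSupport φ) (i : Fin d) (R : ℝ) (hR : ∀ x ∈ tsupport φ, ‖x‖ ≤ R) :
    ∫ x, ‖φ x‖ ^ 2 ≤ 4 * R ^ 2 * ∫ x, ‖jacobian φ x‖ ^ 2 := by
  set e : Space d := EuclideanSpace.single i 1 with he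
  have hd : Differentiable ℝ φ := hφ.differentiable (by simp)
  have hφ' : Continuous fun x => fderiv ℝ φ x e :=
    (hφ.continuous_fderiv (by simp)).clm_apply continuous_const
  have hg : ∀ x, fderiv ℝ (fun x => inner ℝ (φ x) (φ x)) x e
      = 2 * inner ℝ (φ x) (fderiv ℝ φ x e) := by
    intro x
    rw [fderiv_inner_apply ℝ (hd x) (hd x), real_inner_comm (φ x)]
    ring
  have hf : ∀ x : Space d, fderiv ℝ (fun x : Space d => x i) x e = 1 := by
    intro x
    have h : HasFDerivAt (fun x : Space d => x i) (EuclideanSpace.proj (𝕜 := ℝ) i) x :=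
      (EuclideanSpace.proj (𝕜 := ℝ) i : Space d →L[ℝ] ℝ).hasFDerivAt
    rw [h.fderiv]
    simp [he]
  have hz : ∀ x, x ∉ tsupport φ → φ x = 0 := fun x hx => image_eq_zero_of_notMem_tsupport hx
  have hcs : ∀ h : Space d → ℝ, (∀ x, x ∉ tsupport φ → h x = 0) → Continuous h →
      Integrable h := fun h h0 hcont =>
    hcont.integrable_of_hasCompactSupport (HasCompactSupport.intro hc h0)
  have key := integral_mul_fderiv_eq_neg_fderiv_mul_of_integrable (μ := (volume : Measure (Space d)))
    (f := fun x : Space d => x i) (g := fun x => inner ℝ (φ x) (φ x)) (v := e)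
    (hcs _ (fun x hx => by simp [hz x hx]) (by simp only [hf]; fun_prop))
    (hcs _ (fun x hx => by rw [hg, hz x hx, inner_zero_left, mul_zero, mul_zero])
      (by simp only [hg]; fun_prop))
    (hcs _ (fun x hx => by simp [hz x hx]) (by fun_prop))
    (fun x _ => by fun_prop) (fun x _ => (hd x).inner ℝ (hd x))
  simp only [hf, hg, one_mul] at key
  simp only [real_inner_self_eq_norm_sq] at key
  have hI1 : Integrable fun x => ‖φ x‖ ^ 2 :=
    hcs _ (fun x hx => by simp [hz x hx]) (by fun_prop)
  have hI2 : Integrable fun x => ‖jacobian φ x‖ ^ 2 :=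
    hcs _ (fun x hx => by simp [jacobian_eq_zero hx]) ((continuous_jacobian hφ).norm.pow 2)
  have hle : -∫ x, x i * (2 * inner ℝ (φ x) (fderiv ℝ φ x e))
      ≤ ∫ x, (1 / 2 * ‖φ x‖ ^ 2 + 2 * R ^ 2 * ‖jacobian φ x‖ ^ 2) := by
    rw [← integral_neg]
    refine integral_mono ?_ ((hI1.const_mul _).add (hI2.const_mul _)) fun x => ?_
    · exact hcs _ (fun x hx => by simp [hz x hx]) (by fun_prop)
    · by_cases hx : x ∈ tsupport φ
      · have h1 : |x i| ≤ R := (PiLp.norm_apply_le x i).trans (hR x hx)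
        have h2 := abs_real_inner_le_norm (φ x) (fderiv ℝ φ x e)
        have h3 := norm_partial_le φ x i
        have h4 : |x i * (2 * inner ℝ (φ x) (fderiv ℝ φ x e))|
            ≤ R * (2 * (‖φ x‖ * ‖jacobian φ x‖)) := by
          rw [abs_mul, abs_mul, abs_two]
          have hR0 := (abs_nonneg _).trans h1
          gcongr
          exact h2.trans (by gcongr)
        have h5 := (neg_le_abs _).trans h4
        change -(x i * (2 * inner ℝ (φ x) (fderiv ℝ φ x e))) ≤ _
        nlinarith [sq_nonneg (‖φ x‖ - 2 * (R * ‖jacobian φ x‖))]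
      · simp only [hz x hx, inner_zero_left, mul_zero, neg_zero, norm_zero]
        positivity
  rw [integral_add (hI1.const_mul _) (hI2.const_mul _), integral_const_mul,
    integral_const_mul] at hle
  linarith

theorem poincare_test {d : ℕ} (D : BoundedDomain d) :
    ∃ K : ℝ, 0 ≤ K ∧ ∀ w ∈ testGraph D, ‖w.1‖ ≤ K * ‖w.2‖ := by
  obtain ⟨R, hR⟩ := D.isBounded.exists_norm_le
  refine ⟨2 * |R|, by positivity, ?_⟩
  rintro w ⟨φ, ⟨h1, h2, h3⟩, h4, h5⟩
  have e1 := norm_sq_eq_integral D w.1 φ h4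
    fun x hx => image_eq_zero_of_notMem_tsupport fun h => hx (h3 h)
  have e2 := norm_sq_eq_integral D w.2 (jacobian φ) h5
    fun x hx => jacobian_eq_zero fun h => hx (h3 h)
  refine (sq_le_sq₀ (norm_nonneg _) (by positivity)).1 ?_
  rw [e1, mul_pow, e2, mul_pow, sq_abs]
  rcases Nat.eq_zero_or_pos d with rfl | hd
  · have : ∀ x, φ x = 0 := fun x => Subsingleton.elim _ _
    simp only [this, norm_zero]
    simp only [ne_eq, OfNat.ofNat_ne_zero, not_false_eq_true, zero_pow, integral_zero]
    positivity
  · have := poincare_field φ h1 h2 ⟨0, hd⟩ R fun x hx => hR x (h3 hx)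
    linarith

theorem poincare_closure {d : ℕ} (D : BoundedDomain d) :
    ∃ K : ℝ, 0 ≤ K ∧ ∀ w ∈ (testGraph D).topologicalClosure, ‖w.1‖ ≤ K * ‖w.2‖ := by
  obtain ⟨K, hK, h⟩ := poincare_test D
  refine ⟨K, hK, fun w hw => ?_⟩
  have hcl : IsClosed {w : L2 D (Space d) × L2 D (Mat d) | ‖w.1‖ ≤ K * ‖w.2‖} :=
    isClosed_le (by fun_prop) (by fun_prop)
  exact closure_minimal (s := (testGraph D : Set (L2 D (Space d) × L2 D (Mat d)))) h hcl hw

/-- The space `H₀¹(D)ᵈ`, the closure of `C₀^∞(D)ᵈ` in the norm of `H¹(D)ᵈ`. An element is a pair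
`(u, ∇u)` of a function and its weak gradient. -/
def H01 {d : ℕ} (D : BoundedDomain d) : Type := (testGraph D).topologicalClosure

instance {d : ℕ} (D : BoundedDomain d) : AddCommGroup (H01 D) :=
  inferInstanceAs (AddCommGroup (testGraph D).topologicalClosure)

instance {d : ℕ} (D : BoundedDomain d) : Module ℝ (H01 D) :=
  inferInstanceAs (Module ℝ (testGraph D).topologicalClosure)

/-- The gradient of an element of `H₀¹(D)ᵈ`, as a linear map. -/
def H01.gradₗ {d : ℕ} (D : BoundedDomain d) : H01 D →ₗ[ℝ] L2 D (Mat d) :=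
  (LinearMap.snd ℝ (L2 D (Space d)) (L2 D (Mat d))).comp (testGraph D).topologicalClosure.subtype

/-- The underlying function of an element of `H₀¹(D)ᵈ`, as a linear map. -/
def H01.valₗ {d : ℕ} (D : BoundedDomain d) : H01 D →ₗ[ℝ] L2 D (Space d) :=
  (LinearMap.fst ℝ (L2 D (Space d)) (L2 D (Mat d))).comp (testGraph D).topologicalClosure.subtype

theorem H01.poincare {d : ℕ} (D : BoundedDomain d) :
    ∃ K : ℝ, 0 ≤ K ∧ ∀ u : H01 D, ‖H01.valₗ D u‖ ≤ K * ‖H01.gradₗ D u‖ := by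
  obtain ⟨K, hK, h⟩ := poincare_closure D
  exact ⟨K, hK, fun u => h u.1 u.2⟩

theorem H01.gradₗ_injective {d : ℕ} (D : BoundedDomain d) :
    Function.Injective (H01.gradₗ D) := by
  obtain ⟨K, hK, h⟩ := H01.poincare D
  refine (injective_iff_map_eq_zero _).2 fun u hu => ?_
  have hv : H01.valₗ D u = 0 := by
    have := h u
    rw [hu, norm_zero, mul_zero] at this
    exact norm_le_zero_iff.1 this
  exact Subtype.ext (Prod.ext hv hu)

/-- The norm on `H₀¹(D)ᵈ` is `‖u‖ = ‖∇u‖_{L²}`. -/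
instance {d : ℕ} (D : BoundedDomain d) : NormedAddCommGroup (H01 D) :=
  NormedAddCommGroup.induced (H01 D) (L2 D (Mat d)) (H01.gradₗ D) (H01.gradₗ_injective D)

/-- The scalar product on `H₀¹(D)ᵈ` is `((u, v)) = ∫_D ∂ᵢuₖ ∂ᵢvₖ dx`. -/
instance {d : ℕ} (D : BoundedDomain d) : InnerProductSpace ℝ (H01 D) :=
  InnerProductSpace.induced (H01.gradₗ D)

/-- The (weak) gradient `H₀¹(D)ᵈ → L²(D)^{d × d}`. -/
def H01.grad {d : ℕ} (D : BoundedDomain d) : H01 D →L[ℝ] L2 D (Mat d) :=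
  (H01.gradₗ D).mkContinuous 1 fun u => by rw [one_mul]; exact le_rfl

/-- The natural embedding `H₀¹(D)ᵈ → L²(D)ᵈ`. -/
def H01.val {d : ℕ} (D : BoundedDomain d) : H01 D →L[ℝ] L2 D (Space d) :=
  (H01.valₗ D).mkContinuousOfExistsBound
    ((H01.poincare D).imp fun _ h => h.2)

/-- The trace `∑ᵢ Aᵢᵢ` of a matrix. -/
def traceCLM (d : ℕ) : Mat d →L[ℝ] ℝ :=
  ∑ i : Fin d, EuclideanSpace.proj (𝕜 := ℝ) (i, i)

/-- The divergence `H₀¹(D)ᵈ → L²(D)`, `div u = ∂ᵢuᵢ`. -/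
def H01.div {d : ℕ} (D : BoundedDomain d) : H01 D →L[ℝ] L2 D ℝ :=
  ((traceCLM d).compLpL 2 D.measure).comp (H01.grad D)

/-- The space `H⁻¹(D)ᵈ`, the dual of `H₀¹(D)ᵈ`, with the dual norm. -/
abbrev HNeg1 {d : ℕ} (D : BoundedDomain d) : Type := StrongDual ℝ (H01 D)

/-- The embedding `H₀¹(D)ᵈ → H⁻¹(D)ᵈ`, `u ↦ (u, ·)_{L²}`. -/
def H01.toHNeg1 {d : ℕ} (D : BoundedDomain d) (u : H01 D) : HNeg1 D :=
  (innerSL ℝ (H01.val D u)).comp (H01.val D)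

instance {d : ℕ} (D : BoundedDomain d) : IsFiniteMeasure D.measure :=
  ⟨by rw [Measure.restrict_apply_univ]; exact D.isBounded.measure_lt_top⟩

/-- The space `L̂²(D)` of functions in `L²(D)` with zero mean. -/
def L2Hat {d : ℕ} (D : BoundedDomain d) : Submodule ℝ (L2 D ℝ) where
  carrier := {r | ∫ x, r x ∂D.measure = 0}
  zero_mem' := by
    change ∫ x, (0 : L2 D ℝ) x ∂D.measure = 0
    rw [integral_congr_ae (Lp.coeFn_zero ℝ 2 D.measure)]
    simp
  add_mem' := by
    intro a b ha hb
    change ∫ x, (a + b : L2 D ℝ) x ∂D.measure = 0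
    rw [integral_congr_ae (Lp.coeFn_add a b)]
    have h := integral_add ((Lp.memLp a).integrable (by norm_num))
      ((Lp.memLp b).integrable (by norm_num))
    exact h.trans (by rw [ha, hb, add_zero])
  smul_mem' := by
    intro c a ha
    change ∫ x, (c • a : L2 D ℝ) x ∂D.measure = 0
    rw [integral_congr_ae (Lp.coeFn_smul c a)]
    exact (integral_smul c (a : Space d → ℝ)).trans (by rw [ha, smul_zero])

/-- Lebesgue measure on the time interval `(0, T)`. -/
abbrev timeMeasure (T : ℝ) : Measure ℝ := volume.restrict (Ioo 0 T)

/-- The Lebesgue–Bochner space `L²(0, T; X)`. -/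
abbrev L2Time (T : ℝ) (X : Type) [NormedAddCommGroup X] : Type := Lp X 2 (timeMeasure T)

/-- The space `L^∞(Q_T)ᵈ`, where `Q_T = D × (0, T)`. -/
abbrev LInfQT {d : ℕ} (D : BoundedDomain d) (T : ℝ) : Type :=
  Lp (Space d) ∞ ((volume : Measure (Space d × ℝ)).restrict (D.carrier ×ˢ Ioo 0 T))

/-- `g` is the weak derivative of `f` on `(0, T)` (for functions in `L²(0, T; X)`,
`X` a Banach space). -/
def HasWeakTimeDeriv {X : Type} [NormedAddCommGroup X] [NormedSpace ℝ X] (T : ℝ)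
    (f g : ℝ → X) : Prop :=
  ∀ φ : ℝ → ℝ, ContDiff ℝ ∞ φ → HasCompactSupport φ → tsupport φ ⊆ Ioo 0 T →
    ∫ t, deriv φ t • f t ∂timeMeasure T = -∫ t, φ t • g t ∂timeMeasure T

/-- `f ∈ L²(0, T; X)` belongs to the Sobolev–Bochner space `W^{1,2}(0, T; X)`. -/
def MemW12 {X : Type} [NormedAddCommGroup X] [NormedSpace ℝ X] (T : ℝ) (f : L2Time T X) : Prop :=
  ∃ g : L2Time T X, HasWeakTimeDeriv T f g

/-- The restriction of `φ` to `[0, T)` belongs to `C₀^∞([0, T))`. -/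
def IsTimeTest (T : ℝ) (φ : ℝ → ℝ) : Prop :=
  ContDiff ℝ ∞ φ ∧ HasCompactSupport φ ∧ tsupport φ ⊆ Iio T

/-- The pair `(u, p)` is a weak solution of
`ρ_t + ρ₀ div u = σ`, `ρ = α p`, `ρ₀ u_t + ∇p = μ Δu + η ∇ div u + ρ f + s` in `D × (0, T)` with
`u = 0` on `∂D`, `u = u₀` and `p = p₀` at `t = 0`. -/
structure IsWeakSolution {d : ℕ} (D : BoundedDomain d) (T ρ₀ μ η α : ℝ)
    (f : LInfQT D T) (σ : L2Time T (L2 D ℝ)) (s : L2Time T (HNeg1 D))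
    (u₀ : L2 D (Space d)) (p₀ : L2 D ℝ)
    (u : L2Time T (H01 D)) (p : L2Time T (L2 D ℝ)) : Prop where
  continuity : ∀ φ : ℝ → ℝ, IsTimeTest T φ → ∀ r : L2 D ℝ,
    -(∫ t, inner ℝ (α • p t) r * deriv φ t ∂timeMeasure T) - inner ℝ (α • p₀) r * φ 0
      + ∫ t, inner ℝ (ρ₀ • H01.div D (u t)) r * φ t ∂timeMeasure T
    = ∫ t, inner ℝ (σ t) r * φ t ∂timeMeasure T
  momentum : ∀ φ : ℝ → ℝ, IsTimeTest T φ → ∀ v : H01 D,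
    -(∫ t, ρ₀ * inner ℝ (H01.val D (u t)) (H01.val D v) * deriv φ t ∂timeMeasure T)
      - ρ₀ * inner ℝ u₀ (H01.val D v) * φ 0
      - ∫ t, inner ℝ (p t) (H01.div D v) * φ t ∂timeMeasure T
    = -(μ * ∫ t, inner ℝ (u t) v * φ t ∂timeMeasure T)
      - η * ∫ t, inner ℝ (H01.div D (u t)) (H01.div D v) * φ t ∂timeMeasure T
      + ∫ t, (∫ x, inner ℝ ((α * p t x) • f (x, t)) (H01.val D v x) ∂D.measure) * φ t
          ∂timeMeasure T
      + ∫ t, s t v * φ t ∂timeMeasure T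

/-- The quantity `E` built from the norms of the data. -/
def dataSize {d : ℕ} (D : BoundedDomain d) (T α : ℝ) (σ : L2Time T (L2 D ℝ))
    (s : L2Time T (HNeg1 D)) (u₀ : L2 D (Space d)) (p₀ : L2 D ℝ) : ℝ :=
  ‖u₀‖ + √α * ‖p₀‖ + 1 / √α * ‖σ‖ + ‖s‖

end LinearizedFluid

end

open LinearizedFluid

/-! The unknowns are treated as one function `U = (u, p)` with values in the Hilbert sum of `H01 D`
and `L2 D ℝ`. With `j (u, p) = (√ρ₀ u, √(α/ρ₀) p)` and the continuity equation divided by `ρ₀`, the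
problem becomes `j* j U' + 𝒜 U = F`, `j U(0) = U₀`. The weights make the two coupling terms `-(p,
div v)` and `(div u, r)` antisymmetric, so they cancel in `⟨𝒜 U, U⟩`. What remains is the
dissipation `μ‖∇u‖² + η‖div u‖²` and the force term `α (p f, u)`, which `force_young` bounds by the
energy `‖j U‖²` with a factor `√α ‖f‖ / 2`. Hence `𝒜` is coercive up to a multiple of the energy,
and all growth rates stay bounded as `α → 0⁺`.

Existence (`exists_evolution_solution`) is Lions' projection argument: the formal adjoint is bounded
below on `C¹` test functions vanishing at `T`, so the data functional is represented through it.

Uniqueness and the estimates require an energy inequality for an arbitrary weak solution, which need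
not be differentiable as a `W`-valued function. In `ae_energy_le` it comes from time differences:
the integrated equation at `t` and at `t + h` is tested with `U(t) + U(t + h)`, the result is
averaged over `t`, and `h → 0` uses Lebesgue differentiation on one side and continuity of
translations in `L²` on the other. `energy_gronwall` turns the inequality into bounds; with zero
data these give uniqueness.

The momentum equation then exhibits `u_t` as a functional in `L²(0, T; H⁻¹)`. The pressure enters it
without a small factor, while only `√α p` is controlled, whence the factor `1/√α`. For the pressure,
`meanL_div` says that divergences have zero mean, so testing the continuity equation with `1` shows
that the mean of `p` keeps its initial value when the data have zero mean. -/

noncomputable section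
namespace LinearizedFluid

/-! ### Weak equations in time and primitives -/

/-- A test function on `(0, T)` has a primitive vanishing near `T` which is a test function on
`[0, T)`. -/
theorem exists_isTimeTest_primitive {T : ℝ} (hT : 0 < T) {χ : ℝ → ℝ} (hχ : ContDiff ℝ ∞ χ)
    (hc : HasCompactSupport χ) (hs : tsupport χ ⊆ Ioo 0 T) :
    ∃ φ : ℝ → ℝ, IsTimeTest T φ ∧ (∀ t ∈ Ioo 0 T, deriv φ t = χ t) ∧
      ∀ t ∈ Ico 0 T, φ t = -∫ r in t..T, χ r := by
  -- Adjoining `0` keeps the compact set nonempty when `χ = 0`. Its maximum is still below `T` and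
  -- bounds the support of `χ` from above.
  obtain ⟨b, hb, hbmax⟩ := (hc.isCompact.union (isCompact_singleton (x := (0 : ℝ)))).exists_isGreatest
    ⟨0, by simp⟩
  have hbT : b < T := by
    rcases hb with hb | hb
    · exact (hs hb).2
    · simpa [mem_singleton_iff.1 hb] using hT
  have hχb : ∀ t, b < t → χ t = 0 := fun t ht => image_eq_zero_of_notMem_tsupport fun h =>
    absurd (hbmax (Or.inl h)) (not_le.2 ht)
  set Φ : ℝ → ℝ := fun t => ∫ r in T..t, χ r with hΦ
  have hd : ∀ t, HasDerivAt Φ (χ t) t := fun t =>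
    intervalIntegral.integral_hasDerivAt_right (hχ.continuous.intervalIntegrable _ _)
      hχ.continuous.stronglyMeasurable.stronglyMeasurableAtFilter hχ.continuous.continuousAt
  have hΦs : ContDiff ℝ ∞ Φ := by
    rw [contDiff_infty_iff_deriv]
    refine ⟨fun t => (hd t).differentiableAt, ?_⟩
    rwa [show deriv Φ = χ from funext fun t => (hd t).deriv]
  have hΦ0 : ∀ t, b ≤ t → Φ t = 0 := by
    intro t ht
    refine (intervalIntegral.integral_congr_ae (g := fun _ => (0 : ℝ)) ?_).trans (by simp)
    refine Eventually.of_forall fun r hr => hχb r ?_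
    rcases le_total T t with h | h
    · rw [uIoc_of_le h] at hr
      exact hbT.trans hr.1
    · rw [uIoc_of_ge h] at hr
      exact ht.trans_lt hr.1
  -- The primitive is constant, not zero, far to the left. The factor is `0` for `t ≤ -1` and `1`
  -- for `t ≥ 0`, so it gives compact support without altering anything on `[0, T)`.
  set φ : ℝ → ℝ := fun t => Real.smoothTransition (t + 1) * Φ t with hφ
  have hφs : ContDiff ℝ ∞ φ :=
    (Real.smoothTransition.contDiff.comp (contDiff_id.add contDiff_const)).mul hΦs
  have hsupp : ∀ t, t ∉ Icc (-1) b → φ t = 0 := by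
    intro t ht
    rcases lt_or_ge t (-1) with h | h
    · simp [hφ, Real.smoothTransition.zero_of_nonpos (x := t + 1) (by linarith)]
    · have : b ≤ t := by
        by_contra h'
        exact ht ⟨h, by linarith⟩
      simp [hφ, hΦ0 t this]
  have heq : ∀ t, 0 ≤ t → φ t = Φ t := fun t ht => by
    simp [hφ, Real.smoothTransition.one_of_one_le (x := t + 1) (by linarith)]
  refine ⟨φ, ⟨hφs, HasCompactSupport.intro isCompact_Icc hsupp, ?_⟩, ?_, ?_⟩
  · refine (closure_minimal (fun t ht => ?_) isClosed_Icc).trans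
      (fun t (ht : t ∈ Icc (-1) b) => ht.2.trans_lt hbT)
    by_contra h
    exact ht (hsupp t h)
  · intro t ht
    have : φ =ᶠ[𝓝 t] Φ := by
      filter_upwards [Ioi_mem_nhds ht.1] with r hr using heq r (le_of_lt hr)
    rw [this.deriv_eq, (hd t).deriv]
  · intro t ht
    rw [heq t ht.1, intervalIntegral.integral_symm T t, neg_neg]

section Primitive

variable {X : Type*} [NormedAddCommGroup X] [NormedSpace ℝ X] [CompleteSpace X]

/-- Fubini on the triangle `r < t` in `(0, T)²`. -/
theorem integral_smul_primitive {T : ℝ} {χ : ℝ → ℝ} {g : ℝ → X} (hχ : Continuous χ)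
    (hg : Integrable g (timeMeasure T)) :
    ∫ t, χ t • (∫ r in (0 : ℝ)..t, g r) ∂timeMeasure T
      = ∫ r, (∫ t in r..T, χ t) • g r ∂timeMeasure T := by
  have hχi : Integrable χ (timeMeasure T) :=
    (hχ.integrableOn_Icc (a := 0) (b := T)).mono_set Ioo_subset_Icc_self
  have h1 : ∀ t ∈ Ioo 0 T, χ t • (∫ r in (0 : ℝ)..t, g r)
      = ∫ r, {q : ℝ × ℝ | q.2 < q.1}.indicator (fun q => χ q.1 • g q.2) (t, r)
          ∂timeMeasure T := by
    intro t ht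
    rw [intervalIntegral.integral_of_le ht.1.le, ← integral_smul, integral_Ioc_eq_integral_Ioo]
    have : ∀ r, {q : ℝ × ℝ | q.2 < q.1}.indicator (fun q => χ q.1 • g q.2) (t, r)
        = (Iio t).indicator (fun r => χ t • g r) r := fun r => rfl
    simp only [this]
    rw [integral_indicator measurableSet_Iio, Measure.restrict_restrict measurableSet_Iio]
    congr 2
    ext r
    exact ⟨fun h => ⟨h.2, h.1, h.2.trans ht.2⟩, fun h => ⟨h.2.1, h.1⟩⟩
  have h2 : ∀ r ∈ Ioo 0 T, (∫ t in r..T, χ t) • g r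
      = ∫ t, {q : ℝ × ℝ | q.2 < q.1}.indicator (fun q => χ q.1 • g q.2) (t, r)
          ∂timeMeasure T := by
    intro r hr
    rw [intervalIntegral.integral_of_le hr.2.le, ← integral_smul_const,
      integral_Ioc_eq_integral_Ioo]
    have : ∀ t, {q : ℝ × ℝ | q.2 < q.1}.indicator (fun q => χ q.1 • g q.2) (t, r)
        = (Ioi r).indicator (fun t => χ t • g r) t := fun t => rfl
    simp only [this]
    rw [integral_indicator measurableSet_Ioi, Measure.restrict_restrict measurableSet_Ioi]
    congr 2
    ext t
    exact ⟨fun h => ⟨h.1, hr.1.trans h.1, h.2⟩, fun h => ⟨h.1, h.2.2⟩⟩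
  rw [setIntegral_congr_fun measurableSet_Ioo h1, setIntegral_congr_fun measurableSet_Ioo h2]
  refine integral_integral_swap ?_
  exact (hχi.smul_prod hg).indicator (measurableSet_lt measurable_snd measurable_fst)

/-- The weak form of `a' = g`, `a(0) = x₀` determines `a` as a primitive of `g`. -/
theorem ae_eq_add_integral_of_weak {T : ℝ} (hT : 0 < T) {a g : ℝ → X} {x₀ : X}
    (ha : Integrable a (timeMeasure T)) (hg : Integrable g (timeMeasure T))
    (h : ∀ φ : ℝ → ℝ, IsTimeTest T φ →
      -(∫ t, deriv φ t • a t ∂timeMeasure T) - φ 0 • x₀ = ∫ t, φ t • g t ∂timeMeasure T) :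
    ∀ᵐ t ∂timeMeasure T, a t = x₀ + ∫ r in (0 : ℝ)..t, g r := by
  have hgI : IntegrableOn g (Ioc 0 T) := by
    rwa [integrableOn_Ioc_iff_integrableOn_Ioo]
  have hP : ContinuousOn (fun t => ∫ r in (0 : ℝ)..t, g r) (Icc 0 T) :=
    intervalIntegral.continuousOn_primitive_interval (by
      rw [uIcc_of_le hT.le]
      exact (integrableOn_Icc_iff_integrableOn_Ioc).2 hgI)
      |>.mono (by rw [uIcc_of_le hT.le])
  have hPi : IntegrableOn (fun t => ∫ r in (0 : ℝ)..t, g r) (Ioo 0 T) :=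
    (hP.integrableOn_compact isCompact_Icc).mono_set Ioo_subset_Icc_self
  have hci : IntegrableOn (fun _ : ℝ => x₀) (Ioo 0 T) := integrableOn_const (by simp)
  have key : ∀ᵐ t : ℝ, t ∈ Ioo 0 T → a t - x₀ - ∫ r in (0 : ℝ)..t, g r = 0 := by
    refine isOpen_Ioo.ae_eq_zero_of_integral_contDiff_smul_eq_zero
      (IntegrableOn.locallyIntegrableOn ((ha.sub hci).sub hPi)) fun χ hχ hc hs => ?_
    -- The equation is tested with the primitive of `χ` that vanishes near `T`. Since `φ 0 = -∫ χ`,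
    -- the initial term becomes the integral of `χ` against the constant `x₀`, and Fubini turns the
    -- right side into `χ` against the primitive of `g`.
    obtain ⟨φ, hφ, hφ1, hφ2⟩ := exists_isTimeTest_primitive hT hχ hc hs
    have e := h φ hφ
    have b1 : ∀ {b : ℝ → X}, IntegrableOn b (Ioo 0 T) →
        IntegrableOn (fun t => χ t • b t) (Ioo 0 T) := by
      intro b hb
      obtain ⟨C, hC⟩ := hc.exists_bound_of_continuous hχ.continuous
      exact hb.bdd_smul C hχ.continuous.aestronglyMeasurable (Eventually.of_forall hC)
    have e0 : ∫ t, χ t • (a t - x₀ - ∫ r in (0 : ℝ)..t, g r)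
        = ∫ t in Ioo 0 T, χ t • (a t - x₀ - ∫ r in (0 : ℝ)..t, g r) := by
      refine (setIntegral_eq_integral_of_forall_compl_eq_zero fun t ht => ?_).symm
      rw [image_eq_zero_of_notMem_tsupport fun h => ht (hs h), zero_smul]
    have e1 : ∫ t, deriv φ t • a t ∂timeMeasure T = ∫ t, χ t • a t ∂timeMeasure T :=
      setIntegral_congr_fun measurableSet_Ioo fun t ht => by simp only [hφ1 t ht]
    have e2 : φ 0 = -∫ t in Ioo 0 T, χ t := by
      rw [hφ2 0 ⟨le_rfl, hT⟩, intervalIntegral.integral_of_le hT.le, integral_Ioc_eq_integral_Ioo]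
    have e3 : ∫ t, φ t • g t ∂timeMeasure T
        = -∫ t, χ t • (∫ r in (0 : ℝ)..t, g r) ∂timeMeasure T := by
      rw [integral_smul_primitive hχ.continuous hg, ← integral_neg]
      exact setIntegral_congr_fun measurableSet_Ioo fun t ht => by
        simp only [hφ2 t ⟨ht.1.le, ht.2⟩, neg_smul]
    rw [e0]
    simp only [smul_sub]
    refine (integral_sub ((b1 ha).sub (b1 hci)) (b1 hPi)).trans ?_
    refine (congrArg (· - _) (integral_sub (b1 ha) (b1 hci))).trans ?_
    rw [integral_smul_const]
    rw [e1, e2, e3] at e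
    rw [neg_smul, sub_neg_eq_add, neg_add_eq_sub] at e
    exact sub_eq_zero.2 ((neg_sub _ _).symm.trans ((congrArg Neg.neg e).trans (neg_neg _)))
  rw [ae_restrict_iff' measurableSet_Ioo]
  filter_upwards [key] with t ht h
  have := ht h
  rw [sub_sub, sub_eq_zero] at this
  exact this

end Primitive

/-! ### The energy inequality by time differences -/

section Energy

variable {W H : Type*} [NormedAddCommGroup W] [InnerProductSpace ℝ W]
  [NormedAddCommGroup H] [InnerProductSpace ℝ H]

theorem tendsto_translate_Lp {X : Type*} [NormedAddCommGroup X] (f : Lp X 2 (volume : Measure ℝ)) :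
    Tendsto (fun r : ℝ => DomAddAct.mk r +ᵥ f) (𝓝 0) (𝓝 f) := by
  have : Fact ((2 : ℝ≥0∞) ≠ (⊤ : ℝ≥0∞)) := ⟨by simp⟩
  have h : Continuous fun r : ℝ => DomAddAct.mk r +ᵥ f :=
    (DomAddAct.continuous_mk (M := ℝ)).vadd continuous_const
  have h0 := h.tendsto 0
  rwa [show DomAddAct.mk (0 : ℝ) +ᵥ f = f from zero_vadd _ f] at h0

/-- Continuity of translations in `L²`, in the form of convergence of correlations. -/
theorem tendsto_correlation {U G : ℝ → W} (hU : MemLp U 2) (hG : MemLp G 2) (s : Set ℝ) :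
    Tendsto (fun q : ℝ × ℝ => ∫ t in s, inner ℝ (G (q.1 + t)) (U t + U (q.2 + t)))
      (𝓝 (0, 0)) (𝓝 (2 * ∫ t in s, inner ℝ (G t) (U t))) := by
  set g := hG.toLp G
  set u := hU.toLp U
  set ρ : Lp W 2 (volume : Measure ℝ) →L[ℝ] Lp W 2 (volume.restrict s) :=
    LpToLpRestrictCLM ℝ W ℝ volume 2 s
  -- The shifts of `G` and `U` are independent parameters: in the application the first ranges over
  -- `(0, h]` and the second equals `h`. The limit is continuity of the inner product composed with
  -- translations.
  have h1 : Tendsto (fun q : ℝ × ℝ => inner ℝ (ρ (DomAddAct.mk q.1 +ᵥ g))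
      (ρ (u + (DomAddAct.mk q.2 +ᵥ u)))) (𝓝 (0, 0)) (𝓝 (inner ℝ (ρ g) (ρ (u + u)))) := by
    have hg : Tendsto (fun q : ℝ × ℝ => DomAddAct.mk q.1 +ᵥ g) (𝓝 (0, 0)) (𝓝 g) :=
      (tendsto_translate_Lp g).comp (continuous_fst.tendsto _)
    have hu : Tendsto (fun q : ℝ × ℝ => DomAddAct.mk q.2 +ᵥ u) (𝓝 (0, 0)) (𝓝 u) :=
      (tendsto_translate_Lp u).comp (continuous_snd.tendsto _)
    exact ((ρ.continuous.tendsto _).comp hg).inner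
      ((ρ.continuous.tendsto _).comp (tendsto_const_nhds.add hu))
  have hv : ∀ {X : ℝ → W} (hX : MemLp X 2 volume) (r : ℝ),
      ρ (DomAddAct.mk r +ᵥ hX.toLp X) =ᵐ[volume.restrict s] fun t => X (r + t) := by
    intro X hX r
    refine (LpToLpRestrictCLM_coeFn ℝ s _).trans (ae_restrict_of_ae ?_)
    refine (DomAddAct.vadd_Lp_ae_eq _ _).trans ?_
    exact (measurePreserving_add_left volume r).quasiMeasurePreserving.ae hX.coeFn_toLp
  have hv0 : ∀ {X : ℝ → W} (hX : MemLp X 2 volume), ρ (hX.toLp X) =ᵐ[volume.restrict s] X :=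
    fun hX => (LpToLpRestrictCLM_coeFn ℝ s _).trans (ae_restrict_of_ae hX.coeFn_toLp)
  have e1 : ∀ q : ℝ × ℝ, inner ℝ (ρ (DomAddAct.mk q.1 +ᵥ g)) (ρ (u + (DomAddAct.mk q.2 +ᵥ u)))
      = ∫ t in s, inner ℝ (G (q.1 + t)) (U t + U (q.2 + t)) := by
    intro q
    rw [L2.inner_def, map_add]
    refine integral_congr_ae ?_
    filter_upwards [hv hG q.1, hv hU q.2, hv0 hU,
      Lp.coeFn_add (ρ u) (ρ (DomAddAct.mk q.2 +ᵥ u))] with t a b c d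
    rw [a, d, Pi.add_apply, b, c]
  have e2 : inner ℝ (ρ g) (ρ (u + u)) = 2 * ∫ t in s, inner ℝ (G t) (U t) := by
    rw [← two_smul ℝ u, map_smul, inner_smul_right, L2.inner_def]
    congr 1
    refine integral_congr_ae ?_
    filter_upwards [hv0 hG, hv0 hU] with t a b
    rw [a, b]
  rw [e2] at h1
  exact h1.congr e1

/-- Licenses the exchange of the averages over the shift and over time. The shear `(r, t) ↦ (r, r +
t)` preserves the product measure, so `‖G (r + t)‖²` is integrable over `(0, h] × ℝ`, and the
product is dominated by the sum of squares. -/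
theorem integrable_correlation {U G : ℝ → W} (hUm : StronglyMeasurable U)
    (hGm : StronglyMeasurable G) (hU : MemLp U 2) (hG : MemLp G 2) (h τ : ℝ) :
    Integrable (fun z : ℝ × ℝ => inner ℝ (G (z.1 + z.2)) (U z.2 + U (h + z.2)))
      ((volume.restrict (Ioc 0 h)).prod (volume.restrict (Ioc 0 τ))) := by
  have hV : MemLp (fun t => U t + U (h + t)) 2 :=
    hU.add (hU.comp_measurePreserving (measurePreserving_add_left volume h))
  have hVm : StronglyMeasurable fun t => U t + U (h + t) :=
    hUm.add (hUm.comp_measurable (measurable_const_add h))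
  have i1 : Integrable (fun z : ℝ × ℝ => ‖U z.2 + U (h + z.2)‖ ^ 2)
      ((volume.restrict (Ioc 0 h)).prod volume) :=
    ((memLp_two_iff_integrable_sq_norm hV.1).1 hV).comp_snd (volume.restrict (Ioc 0 h))
  have i2 : Integrable (fun z : ℝ × ℝ => ‖G (z.1 + z.2)‖ ^ 2)
      ((volume.restrict (Ioc 0 h)).prod volume) :=
    (measurePreserving_prod_add (volume.restrict (Ioc 0 h)) volume).integrable_comp_of_integrable
      (((memLp_two_iff_integrable_sq_norm hG.1).1 hG).comp_snd (volume.restrict (Ioc 0 h)))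
  have i3 : Integrable (fun z : ℝ × ℝ => inner ℝ (G (z.1 + z.2)) (U z.2 + U (h + z.2)))
      ((volume.restrict (Ioc 0 h)).prod volume) := by
    refine (i2.add i1).mono ?_ (Eventually.of_forall fun z => ?_)
    · exact ((hGm.comp_measurable (measurable_fst.add measurable_snd)).inner
        (hVm.comp_measurable measurable_snd)).aestronglyMeasurable
    · have h1 := norm_inner_le_norm (𝕜 := ℝ) (G (z.1 + z.2)) (U z.2 + U (h + z.2))
      refine h1.trans ((?_ : _ ≤ ‖G (z.1 + z.2)‖ ^ 2 + ‖U z.2 + U (h + z.2)‖ ^ 2).trans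
        (Real.le_norm_self _))
      nlinarith [sq_nonneg (‖G (z.1 + z.2)‖ - ‖U z.2 + U (h + z.2)‖),
        norm_nonneg (G (z.1 + z.2)), norm_nonneg (U z.2 + U (h + z.2))]
  rw [← Measure.restrict_univ (μ := volume.restrict (Ioc 0 h)), Measure.prod_restrict]
  exact i3.mono_measure Measure.restrict_le_self

variable [CompleteSpace W] {T : ℝ} {j : W →L[ℝ] H} {U₀ : H} {U G : ℝ → W}

/-- The identity `‖j U(t+h)‖² - ‖j U(t)‖² = ⟪∫ₜᵗ⁺ʰ G, U(t) + U(t+h)⟫`. -/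
theorem ae_energy_increment (hG : MemLp G 2)
    (hY : ∀ᵐ t ∂timeMeasure T, ∀ w, inner ℝ (j (U t)) (j w)
      = inner ℝ U₀ (j w) + inner ℝ (∫ r in (0 : ℝ)..t, G r) w) {τ h : ℝ} (hh : 0 < h)
    (hτ : τ + h < T) :
    ∀ᵐ t ∂volume.restrict (Ioc 0 τ), ‖j (U (t + h))‖ ^ 2 - ‖j (U t)‖ ^ 2
      = ∫ r in Ioc 0 h, inner ℝ (G (r + t)) (U t + U (h + t)) := by
  have hGi : ∀ a b, IntervalIntegrable G volume a b := fun a b =>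
    ⟨(hG.restrict _).integrable (by norm_num), (hG.restrict _).integrable (by norm_num)⟩
  rw [ae_restrict_iff' measurableSet_Ioo] at hY
  rw [ae_restrict_iff' measurableSet_Ioc]
  filter_upwards [hY, (measurePreserving_add_right volume h).quasiMeasurePreserving.ae hY]
    with t h1 h2 ht
  -- Both identities are tested with the same vector, which depends on `t`; this is why the
  -- hypothesis has `∀ w` inside the almost-everywhere statement. In the difference the mixed
  -- products cancel by symmetry.
  have k1 := h1 ⟨ht.1, by linarith [ht.2]⟩ (U t + U (h + t))
  have k2 := h2 ⟨by linarith [ht.1], by linarith [ht.2]⟩ (U t + U (h + t))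
  have k3 : ∫ r in Ioc 0 h, inner ℝ (G (r + t)) (U t + U (h + t))
      = inner ℝ (∫ r in (0 : ℝ)..h, G (r + t)) (U t + U (h + t)) := by
    rw [intervalIntegral.integral_of_le hh.le, real_inner_comm, ← integral_inner]
    · simp only [real_inner_comm]
    · exact ((hG.comp_measurePreserving (measurePreserving_add_right volume t)).restrict
        _).integrable (by norm_num)
  rw [k3, intervalIntegral.integral_comp_add_right, zero_add, add_comm h t,
    ← intervalIntegral.integral_interval_sub_left (hGi 0 (t + h)) (hGi 0 t), inner_sub_left]
  rw [add_comm h t] at k1 k2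
  simp only [map_add, inner_add_right] at k1 k2
  simp only [inner_add_right]
  rw [← real_inner_self_eq_norm_sq, ← real_inner_self_eq_norm_sq]
  have k4 := real_inner_comm (j (U t)) (j (U (t + h)))
  linarith

/-- Replaces continuity of `j U` at `0`: the mean energy over `(0, h)` exceeds `‖U₀‖²` by at most a
quantity tending to `0`. The integrated identity is tested with `U(t)`, and the energy produced by
Young's inequality on `⟨U₀, j U⟩` is absorbed on the left. -/
theorem ae_energy_initial (hU : MemLp U 2) (hG : MemLp G 2)
    (hY : ∀ᵐ t ∂timeMeasure T, ∀ w, inner ℝ (j (U t)) (j w)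
      = inner ℝ U₀ (j w) + inner ℝ (∫ r in (0 : ℝ)..t, G r) w) {h : ℝ} (hh : 0 < h) (hT : h < T) :
    ∫ t in (0 : ℝ)..h, ‖j (U t)‖ ^ 2
      ≤ h * (‖U₀‖ ^ 2 + (∫ t in (0 : ℝ)..h, ‖G t‖ ^ 2) + ∫ t in (0 : ℝ)..h, ‖U t‖ ^ 2) := by
  have hjU : MemLp (fun t => j (U t)) 2 := j.comp_memLp' hU
  have hGs := (memLp_two_iff_integrable_sq_norm hG.1).1 hG
  have hUs := (memLp_two_iff_integrable_sq_norm hU.1).1 hU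
  have hjs := (memLp_two_iff_integrable_sq_norm hjU.1).1 hjU
  have hb : ∀ᵐ t ∂volume.restrict (Ioc 0 h), ‖j (U t)‖ ^ 2
      ≤ ‖U₀‖ ^ 2 + (∫ t in (0 : ℝ)..h, ‖G t‖ ^ 2) + h * ‖U t‖ ^ 2 := by
    rw [ae_restrict_iff' measurableSet_Ioo] at hY
    rw [ae_restrict_iff' measurableSet_Ioc]
    filter_upwards [hY] with t h1 ht
    have k1 := h1 ⟨ht.1, ht.2.trans_lt hT⟩ (U t)
    have k2 := real_inner_le_norm U₀ (j (U t))
    rw [real_inner_self_eq_norm_sq] at k1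
    have k3 : 2 * inner ℝ (∫ r in (0 : ℝ)..t, G r) (U t)
        ≤ (∫ t in (0 : ℝ)..h, ‖G t‖ ^ 2) + h * ‖U t‖ ^ 2 := by
      have hGi : IntegrableOn G (Ioc 0 t) := (hG.restrict _).integrable (by norm_num)
      calc 2 * inner ℝ (∫ r in (0 : ℝ)..t, G r) (U t)
          = ∫ r in Ioc 0 t, 2 * inner ℝ (U t) (G r) := by
            rw [intervalIntegral.integral_of_le ht.1.le, real_inner_comm, ← integral_inner hGi,
              integral_const_mul]
        _ ≤ ∫ r in Ioc 0 t, (‖G r‖ ^ 2 + ‖U t‖ ^ 2) := by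
            refine integral_mono ((hGi.const_inner (U t)).const_mul 2)
              (hGs.integrableOn.add (integrableOn_const (by simp))) fun r => ?_
            have := real_inner_le_norm (U t) (G r)
            simp only
            nlinarith [sq_nonneg (‖U t‖ - ‖G r‖)]
        _ ≤ ∫ r in Ioc 0 h, (‖G r‖ ^ 2 + ‖U t‖ ^ 2) :=
            setIntegral_mono_set (hGs.integrableOn.add (integrableOn_const (by simp)))
              (Eventually.of_forall fun r => by positivity)
              (Eventually.of_forall (Ioc_subset_Ioc_right ht.2))
        _ = _ := by
            refine (integral_add hGs.integrableOn (integrableOn_const (by simp))).trans ?_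
            rw [intervalIntegral.integral_of_le hh.le]
            simp [hh.le]
    nlinarith [sq_nonneg (‖U₀‖ - ‖j (U t)‖)]
  rw [intervalIntegral.integral_of_le hh.le]
  refine (integral_mono_ae hjs.integrableOn
    ((integrableOn_const (by simp)).add (hUs.integrableOn.const_mul h)) hb).trans (le_of_eq ?_)
  refine (integral_add (integrable_const _) (hUs.integrableOn.const_mul h)).trans ?_
  rw [integral_const_mul, ← intervalIntegral.integral_of_le hh.le (f := fun t => ‖U t‖ ^ 2)]
  simp [hh.le]
  ring

/-- The energy inequality for the weak form of `j* j U' = G`, `j U(0) = U₀`. -/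
theorem ae_energy_le (hUm : StronglyMeasurable U) (hGm : StronglyMeasurable G)
    (hU : MemLp U 2) (hG : MemLp G 2)
    (hY : ∀ᵐ t ∂timeMeasure T, ∀ w, inner ℝ (j (U t)) (j w)
      = inner ℝ U₀ (j w) + inner ℝ (∫ r in (0 : ℝ)..t, G r) w) :
    ∀ᵐ τ ∂timeMeasure T, ‖j (U τ)‖ ^ 2
      ≤ ‖U₀‖ ^ 2 + 2 * ∫ t in Ioc 0 τ, inner ℝ (G t) (U t) := by
  have hjU : MemLp (fun t => j (U t)) 2 := j.comp_memLp' hU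
  have hGs := (memLp_two_iff_integrable_sq_norm hG.1).1 hG
  have hUs := (memLp_two_iff_integrable_sq_norm hU.1).1 hU
  have hjs := (memLp_two_iff_integrable_sq_norm hjU.1).1 hjU
  have hL := LocallyIntegrable.ae_hasDerivAt_integral hjs.locallyIntegrable
  rw [ae_restrict_iff' measurableSet_Ioo]
  -- Only Lebesgue points of `‖j U‖²` are used, where the averages over `(τ, τ + h)` converge to the
  -- value at `τ`.
  filter_upwards [hL] with τ hd hτ
  have hlim : Tendsto (fun h => h⁻¹ * ∫ t in τ..(τ + h), ‖j (U t)‖ ^ 2) (𝓝[>] 0)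
      (𝓝 (‖j (U τ)‖ ^ 2)) := by
    have := (hd τ).tendsto_slope_zero_right
    simpa using this
  have hz : ∀ {f : ℝ → ℝ}, Integrable f →
      Tendsto (fun h => ∫ t in (0 : ℝ)..h, f t) (𝓝[>] 0) (𝓝 0) := by
    intro f hf
    have := (intervalIntegral.continuous_primitive (fun a b => hf.intervalIntegrable) 0).tendsto 0
    rw [intervalIntegral.integral_same] at this
    exact this.mono_left nhdsWithin_le_nhds
  refine le_of_forall_pos_le_add fun ε hε => ?_
  set c₀ := 2 * ∫ t in Ioc 0 τ, inner ℝ (G t) (U t) with hc₀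
  have hr : Tendsto (fun h => ‖U₀‖ ^ 2 + (∫ t in (0 : ℝ)..h, ‖G t‖ ^ 2)
      + (∫ t in (0 : ℝ)..h, ‖U t‖ ^ 2) + (c₀ + ε)) (𝓝[>] 0) (𝓝 (‖U₀‖ ^ 2 + 0 + 0 + (c₀ + ε))) :=
    ((tendsto_const_nhds.add (hz hGs)).add (hz hUs)).add tendsto_const_nhds
  have hcl : ∀ᶠ q : ℝ × ℝ in 𝓝 (0, 0),
      ∫ t in Ioc 0 τ, inner ℝ (G (q.1 + t)) (U t + U (q.2 + t)) ≤ c₀ + ε :=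
    (tendsto_correlation hU hG (Ioc 0 τ)).eventually (ge_mem_nhds (by linarith))
  obtain ⟨δ, hδ, hball⟩ := Metric.eventually_nhds_iff.1 hcl
  have hev : ∀ᶠ h in 𝓝[>] (0 : ℝ), h⁻¹ * ∫ t in τ..(τ + h), ‖j (U t)‖ ^ 2
      ≤ ‖U₀‖ ^ 2 + (∫ t in (0 : ℝ)..h, ‖G t‖ ^ 2) + (∫ t in (0 : ℝ)..h, ‖U t‖ ^ 2) + (c₀ + ε) := by
    filter_upwards [Ioo_mem_nhdsGT (show (0 : ℝ) < min δ (T - τ) from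
      lt_min hδ (by linarith [hτ.2]))] with h hh
    have hhδ := (lt_min_iff.1 hh.2).1
    have hhT := (lt_min_iff.1 hh.2).2
    have h0 := hh.1
    have hinit := ae_energy_initial hU hG hY h0 (by linarith [hτ.1])
    have hint := integrable_correlation hUm hGm hU hG h τ
    have hinc : ∫ t in Ioc 0 τ, (‖j (U (t + h))‖ ^ 2 - ‖j (U t)‖ ^ 2)
        = ∫ r in Ioc 0 h, ∫ t in Ioc 0 τ, inner ℝ (G (r + t)) (U t + U (h + t)) := by
      rw [integral_congr_ae (ae_energy_increment hG hY h0 (by linarith)),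
        integral_integral_swap (f := fun t r => inner ℝ (G (r + t)) (U t + U (h + t))) hint.swap]
    have hi : Integrable fun t => ‖j (U (t + h))‖ ^ 2 := hjs.comp_add_right h
    have hle : ∫ r in Ioc 0 h, ∫ t in Ioc 0 τ, inner ℝ (G (r + t)) (U t + U (h + t))
        ≤ h * (c₀ + ε) := by
      refine (setIntegral_mono_on hint.integral_prod_left (integrableOn_const (C := c₀ + ε)
        (by simp)) measurableSet_Ioc fun r hr => ?_).trans (le_of_eq ?_)
      · refine hball (y := (r, h)) ?_
        rw [Prod.dist_eq, max_lt_iff]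
        simp only [dist_zero_right, Real.norm_eq_abs]
        rw [abs_of_pos hr.1, abs_of_pos h0]
        exact ⟨hr.2.trans_lt hhδ, hhδ⟩
      · simp [h0.le]
    -- The integrated increments telescope to the energy over `(τ, τ + h)` minus that over `(0, h)`.
    -- The latter is controlled by `ae_energy_initial`.
    rw [integral_sub hi.integrableOn hjs.integrableOn,
      ← intervalIntegral.integral_of_le hτ.1.le, ← intervalIntegral.integral_of_le hτ.1.le,
      intervalIntegral.integral_comp_add_right (fun t => ‖j (U t)‖ ^ 2),
      intervalIntegral.integral_interval_sub_interval_comm' hjs.intervalIntegrable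
        hjs.intervalIntegrable hjs.intervalIntegrable, zero_add] at hinc
    rw [inv_mul_le_iff₀ h0]
    linarith
  have := le_of_tendsto_of_tendsto hlim hr hev
  linarith

end Energy

/-! ### Existence by Lions' projection method -/

/-- Lions' projection lemma: a functional `L` dominated by `‖K ·‖` is represented through `K`. -/
theorem exists_inner_eq_of_abs_le {Φ F : Type*} [AddCommGroup Φ] [Module ℝ Φ]
    [NormedAddCommGroup F] [InnerProductSpace ℝ F] [CompleteSpace F] (K : Φ →ₗ[ℝ] F)
    (L : Φ →ₗ[ℝ] ℝ) (C : ℝ) (h : ∀ ψ, |L ψ| ≤ C * ‖K ψ‖) :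
    ∃ U : F, ∀ ψ, inner ℝ U (K ψ) = L ψ := by
  -- The domination makes `L` descend to a bounded functional on the range of `K`.
  have hker : LinearMap.ker K ≤ LinearMap.ker L := by
    intro ψ hψ
    have := h ψ
    rw [LinearMap.mem_ker.1 hψ, norm_zero, mul_zero] at this
    exact LinearMap.mem_ker.2 (abs_nonpos_iff.1 this)
  set ℓ : LinearMap.range K →ₗ[ℝ] ℝ :=
    ((LinearMap.ker K).liftQ L hker).comp K.quotKerEquivRange.symm.toLinearMap with hℓ
  have hℓK : ∀ ψ, ℓ ⟨K ψ, LinearMap.mem_range_self K ψ⟩ = L ψ := by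
    intro ψ
    have : K.quotKerEquivRange.symm ⟨K ψ, LinearMap.mem_range_self K ψ⟩
        = (LinearMap.ker K).mkQ ψ := K.quotKerEquivRange_symm_apply_image ψ _
    simp [hℓ, this]
  have hb : ∀ y : LinearMap.range K, ‖ℓ y‖ ≤ C * ‖y‖ := by
    rintro ⟨_, ψ, rfl⟩
    rw [hℓK]
    exact h ψ
  -- The range of `K` need not be closed, so Hahn–Banach precedes the Riesz representation. This
  -- loses uniqueness, which is recovered later from the energy estimate.
  obtain ⟨g, hg, -⟩ := exists_extension_norm_eq (LinearMap.range K) (ℓ.mkContinuous C hb)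
  refine ⟨(InnerProductSpace.toDual ℝ F).symm g, fun ψ => ?_⟩
  rw [InnerProductSpace.toDual_symm_apply, ← hℓK]
  exact hg ⟨K ψ, LinearMap.mem_range_self K ψ⟩

section Existence

theorem integrable_inner_of_memLp {Ω X : Type*} [MeasurableSpace Ω] {μ : Measure Ω}
    [NormedAddCommGroup X] [InnerProductSpace ℝ X] {f g : Ω → X} (hf : MemLp f 2 μ)
    (hg : MemLp g 2 μ) : Integrable (fun t => inner ℝ (f t) (g t)) μ :=
  memLp_one_iff_integrable.1 ((innerSL ℝ).memLp_of_bilin 1 hf hg)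

theorem memLp_timeMeasure_of_continuous {X : Type*} [NormedAddCommGroup X] {T : ℝ} {f : ℝ → X}
    (hf : Continuous f) : MemLp f 2 (timeMeasure T) := by
  obtain ⟨C, hC⟩ := isCompact_Icc.exists_bound_of_continuousOn (hf.continuousOn (s := Icc 0 T))
  refine MemLp.of_bound hf.aestronglyMeasurable C ?_
  rw [ae_restrict_iff' measurableSet_Ioo]
  exact Eventually.of_forall fun t ht => hC t (Ioo_subset_Icc_self ht)

variable {W H : Type} [NormedAddCommGroup W] [InnerProductSpace ℝ W]
  [NormedAddCommGroup H] [InnerProductSpace ℝ H]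

/-- Continuous functions of time, as elements of `L²(0, T; W)`. -/
def contToL2 (T : ℝ) (W : Type) [NormedAddCommGroup W] [InnerProductSpace ℝ W] :
    C(ℝ, W) →ₗ[ℝ] L2Time T W where
  toFun f := (memLp_timeMeasure_of_continuous f.continuous).toLp f
  map_add' _ _ := rfl
  map_smul' _ _ := rfl

theorem coeFn_contToL2 (T : ℝ) (f : C(ℝ, W)) : contToL2 T W f =ᵐ[timeMeasure T] f :=
  MemLp.coeFn_toLp (memLp_timeMeasure_of_continuous f.continuous)

/-- The `C¹` functions `ψ : ℝ → W` with `ψ(T) = 0`. -/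
def evolutionTest (T : ℝ) (W : Type) [NormedAddCommGroup W] [InnerProductSpace ℝ W] :
    Submodule ℝ (ℝ → W) where
  carrier := {ψ | ContDiff ℝ 1 ψ ∧ ψ T = 0}
  zero_mem' := ⟨contDiff_const, rfl⟩
  add_mem' := fun ha hb => ⟨ha.1.add hb.1, by simp [ha.2, hb.2]⟩
  smul_mem' := fun c a ha => ⟨contDiff_const.smul ha.1, by simp [ha.2]⟩

namespace evolutionTest

variable {T : ℝ}

/-- The underlying continuous function. -/
def toCont (T : ℝ) (W : Type) [NormedAddCommGroup W] [InnerProductSpace ℝ W] :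
    evolutionTest T W →ₗ[ℝ] C(ℝ, W) where
  toFun ψ := ⟨ψ.1, ψ.2.1.continuous⟩
  map_add' _ _ := rfl
  map_smul' _ _ := rfl

theorem hasDerivAt (ψ : evolutionTest T W) (t : ℝ) : HasDerivAt ψ.1 (deriv ψ.1 t) t :=
  (ψ.2.1.differentiable (by simp) t).hasDerivAt

/-- The derivative. -/
def derivCont (T : ℝ) (W : Type) [NormedAddCommGroup W] [InnerProductSpace ℝ W] :
    evolutionTest T W →ₗ[ℝ] C(ℝ, W) where
  toFun ψ := ⟨deriv ψ.1, ψ.2.1.continuous_deriv (by simp)⟩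
  map_add' ψ χ := by
    ext t
    exact ((hasDerivAt ψ t).add (hasDerivAt χ t)).deriv
  map_smul' c ψ := by
    ext t
    exact ((hasDerivAt ψ t).const_smul c).deriv

end evolutionTest

/-- The fundamental theorem of calculus for `½ e^{2lt} ‖j χ‖²`, whose value at `T` is zero. The
derivative of the weight supplies the term with factor `l`. -/
theorem integral_weight_inner_deriv {T : ℝ} (hT : 0 < T) (j : W →L[ℝ] H) (l : ℝ)
    (χ : evolutionTest T W) :
    ∫ t, inner ℝ (j (Real.exp (2 * l * t) • χ.1 t)) (j (deriv χ.1 t)) ∂timeMeasure T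
      = -(1 / 2 * ‖j (χ.1 0)‖ ^ 2)
        - ∫ t, l * Real.exp (2 * l * t) * ‖j (χ.1 t)‖ ^ 2 ∂timeMeasure T := by
  have hχ := χ.2.1.continuous
  have hχ' := χ.2.1.continuous_deriv (le_refl 1)
  have hd : ∀ t, HasDerivAt (fun t => 1 / 2 * (Real.exp (2 * l * t) * ‖j (χ.1 t)‖ ^ 2))
      (l * Real.exp (2 * l * t) * ‖j (χ.1 t)‖ ^ 2
        + inner ℝ (j (Real.exp (2 * l * t) • χ.1 t)) (j (deriv χ.1 t))) t := by
    intro t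
    have h1 : HasDerivAt (fun t => Real.exp (2 * l * t)) (Real.exp (2 * l * t) * (2 * l)) t := by
      simpa using ((hasDerivAt_id t).const_mul (2 * l)).exp
    have h2 : HasDerivAt (fun t => ‖j (χ.1 t)‖ ^ 2)
        (2 * inner ℝ (j (χ.1 t)) (j (deriv χ.1 t))) t :=
      (j.hasFDerivAt.comp_hasDerivAt t (evolutionTest.hasDerivAt χ t)).norm_sq
    refine ((h1.mul h2).const_mul (1 / 2)).congr_deriv ?_
    rw [map_smul, real_inner_smul_left]
    ring
  have c1 : Continuous fun t => l * Real.exp (2 * l * t) * ‖j (χ.1 t)‖ ^ 2 := by fun_prop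
  have c2 : Continuous fun t => inner ℝ (j (Real.exp (2 * l * t) • χ.1 t)) (j (deriv χ.1 t)) := by
    fun_prop
  have key := intervalIntegral.integral_eq_sub_of_hasDerivAt (a := 0) (b := T) (fun t _ => hd t)
    ((c1.add c2).intervalIntegrable _ _)
  rw [intervalIntegral.integral_add (c1.intervalIntegrable _ _) (c2.intervalIntegrable _ _),
    χ.2.2] at key
  simp only [intervalIntegral.integral_of_le hT.le, integral_Ioc_eq_integral_Ioo, map_zero,
    norm_zero, mul_zero, Real.exp_zero, one_mul] at key
  simp only [timeMeasure]
  linarith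

variable [CompleteSpace W] [CompleteSpace H]

/-- The formal adjoint of `U ↦ j* j U' + 𝒜 U`. -/
def adjointEvolution {T : ℝ} (j : W →L[ℝ] H) (𝒜 : L2Time T W →L[ℝ] L2Time T W) :
    evolutionTest T W →ₗ[ℝ] L2Time T W :=
  𝒜.adjoint.toLinearMap ∘ₗ contToL2 T W ∘ₗ evolutionTest.toCont T W
    - ((j.adjoint ∘L j).compLpL 2 (timeMeasure T)).toLinearMap ∘ₗ contToL2 T W
      ∘ₗ evolutionTest.derivCont T W

theorem inner_adjointEvolution {T : ℝ} (j : W →L[ℝ] H) (𝒜 : L2Time T W →L[ℝ] L2Time T W)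
    (U : L2Time T W) (ψ : evolutionTest T W) :
    inner ℝ U (adjointEvolution j 𝒜 ψ) = ∫ t, inner ℝ (𝒜 U t) (ψ.1 t) ∂timeMeasure T
      - ∫ t, inner ℝ (j (U t)) (j (deriv ψ.1 t)) ∂timeMeasure T := by
  have : adjointEvolution j 𝒜 ψ = 𝒜.adjoint (contToL2 T W (evolutionTest.toCont T W ψ))
      - (j.adjoint ∘L j).compLpL 2 (timeMeasure T)
        (contToL2 T W (evolutionTest.derivCont T W ψ)) := rfl
  rw [this, inner_sub_right, ContinuousLinearMap.adjoint_inner_right, L2.inner_def, L2.inner_def]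
  congr 1
  · refine integral_congr_ae ?_
    filter_upwards [coeFn_contToL2 T (evolutionTest.toCont T W ψ)] with t ht
    rw [ht]
    rfl
  · refine integral_congr_ae ?_
    filter_upwards [coeFn_contToL2 T (evolutionTest.derivCont T W ψ),
      (j.adjoint ∘L j).coeFn_compLpL (p := 2) (μ := timeMeasure T)
        (contToL2 T W (evolutionTest.derivCont T W ψ))] with t h1 h2
    rw [h2, h1, ContinuousLinearMap.comp_apply, ContinuousLinearMap.adjoint_inner_right]
    rfl

/-- The adjoint applied to `χ` is paired with `e^{2lt} χ`. Differentiating the weight produces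
exactly `l e^{2lt} ‖j χ‖²`, which pays for the defect of coercivity, and the boundary term at `0` is
kept for use with the initial datum. -/
theorem adjointEvolution_lower_bound {T : ℝ} (hT : 0 < T) (j : W →L[ℝ] H)
    (𝒜 : L2Time T W →L[ℝ] L2Time T W) {l c : ℝ} (hl : 0 ≤ l) (hc : 0 < c)
    (hcoer : ∀ U : L2Time T W, ∀ᵐ t ∂timeMeasure T,
      c * ‖U t‖ ^ 2 ≤ inner ℝ (𝒜 U t) (U t) + l * ‖j (U t)‖ ^ 2) (χ : evolutionTest T W) :
    1 / 2 * ‖j (χ.1 0)‖ ^ 2 + c * ‖contToL2 T W (evolutionTest.toCont T W χ)‖ ^ 2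
      ≤ Real.exp (2 * l * T) * ‖contToL2 T W (evolutionTest.toCont T W χ)‖
        * ‖adjointEvolution j 𝒜 χ‖ := by
  have hχ := χ.2.1.continuous
  set x := contToL2 T W (evolutionTest.toCont T W χ) with hx
  have hxχ : x =ᵐ[timeMeasure T] χ.1 := coeFn_contToL2 T (evolutionTest.toCont T W χ)
  set ψ : C(ℝ, W) := ⟨fun t => Real.exp (2 * l * t) • χ.1 t, by fun_prop⟩
  set y := contToL2 T W ψ
  have hy : y =ᵐ[timeMeasure T] ψ := coeFn_contToL2 T ψ
  have hyn : ‖y‖ ≤ Real.exp (2 * l * T) * ‖x‖ := by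
    refine Lp.norm_le_mul_norm_of_ae_le_mul ?_
    filter_upwards [hy, hxχ, ae_restrict_mem measurableSet_Ioo] with t h1 h2 ht
    rw [h1, h2]
    change ‖Real.exp (2 * l * t) • χ.1 t‖ ≤ _
    rw [norm_smul, Real.norm_of_nonneg (Real.exp_pos _).le]
    gcongr
    exact ht.2.le
  have h1 := inner_adjointEvolution j 𝒜 y χ
  have h2 : ∫ t, inner ℝ (j (y t)) (j (deriv χ.1 t)) ∂timeMeasure T
      = ∫ t, inner ℝ (j (Real.exp (2 * l * t) • χ.1 t)) (j (deriv χ.1 t)) ∂timeMeasure T := by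
    refine integral_congr_ae ?_
    filter_upwards [hy] with t ht
    rw [ht]
    rfl
  rw [h2, integral_weight_inner_deriv hT] at h1
  have i1 : Integrable (fun t => inner ℝ (𝒜 y t) (χ.1 t)) (timeMeasure T) :=
    integrable_inner_of_memLp (Lp.memLp (𝒜 y)) (memLp_timeMeasure_of_continuous hχ)
  have ci : ∀ {f : ℝ → ℝ}, Continuous f → Integrable f (timeMeasure T) := fun hf =>
    (memLp_timeMeasure_of_continuous hf).integrable (by norm_num)
  have i2 : Integrable (fun t => l * Real.exp (2 * l * t) * ‖j (χ.1 t)‖ ^ 2) (timeMeasure T) :=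
    ci (by fun_prop)
  have h3 : c * ‖x‖ ^ 2 ≤ ∫ t, inner ℝ (𝒜 y t) (χ.1 t) ∂timeMeasure T
      + ∫ t, l * Real.exp (2 * l * t) * ‖j (χ.1 t)‖ ^ 2 ∂timeMeasure T := by
    rw [← integral_add i1 i2, ← real_inner_self_eq_norm_sq, L2.inner_def, ← integral_const_mul]
    refine integral_mono_ae ((L2.integrable_inner x x).const_mul c) (i1.add i2) ?_
    filter_upwards [hxχ, hy, hcoer y, ae_restrict_mem measurableSet_Ioo] with t k1 k2 k3 ht
    have hψ : ψ t = Real.exp (2 * l * t) • χ.1 t := rfl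
    rw [k2, hψ, real_inner_smul_right, map_smul, norm_smul, norm_smul,
      Real.norm_of_nonneg (Real.exp_pos _).le] at k3
    simp only [k1]
    rw [real_inner_self_eq_norm_sq]
    have he : 1 ≤ Real.exp (2 * l * t) := Real.one_le_exp (by have := ht.1; positivity)
    set e := Real.exp (2 * l * t)
    -- Coercivity at `e χ` carries a factor `e²`. One `e` divides out and the other is bounded below
    -- by `1`.
    have k4 : e * (c * (e * ‖χ.1 t‖ ^ 2))
        ≤ e * (inner ℝ (𝒜 y t) (χ.1 t) + l * e * ‖j (χ.1 t)‖ ^ 2) := by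
      refine le_trans (le_of_eq ?_) (k3.trans (le_of_eq ?_)) <;> ring
    have k5 := le_of_mul_le_mul_left k4 (by positivity)
    refine le_trans ?_ k5
    gcongr
    exact le_mul_of_one_le_left (by positivity) he
  have h4 := real_inner_le_norm y (adjointEvolution j 𝒜 χ)
  have h5 : ‖y‖ * ‖adjointEvolution j 𝒜 χ‖ ≤ Real.exp (2 * l * T) * ‖x‖
      * ‖adjointEvolution j 𝒜 χ‖ := by gcongr
  linarith

/-- Existence of weak solutions of `j* j U' + 𝒜 U = F`, `j U(0) = U₀`, for `𝒜` weakly coercive. -/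
theorem exists_evolution_solution {T : ℝ} (hT : 0 < T) (j : W →L[ℝ] H)
    (𝒜 : L2Time T W →L[ℝ] L2Time T W) {l c : ℝ} (hl : 0 ≤ l) (hc : 0 < c)
    (hcoer : ∀ U : L2Time T W, ∀ᵐ t ∂timeMeasure T,
      c * ‖U t‖ ^ 2 ≤ inner ℝ (𝒜 U t) (U t) + l * ‖j (U t)‖ ^ 2)
    (F : L2Time T W) (U₀ : H) :
    ∃ U : L2Time T W, ∀ φ : ℝ → ℝ, IsTimeTest T φ → ∀ w : W,
      -(∫ t, inner ℝ (j (U t)) (j w) * deriv φ t ∂timeMeasure T) - inner ℝ U₀ (j w) * φ 0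
        = ∫ t, inner ℝ ((F - 𝒜 U) t) w * φ t ∂timeMeasure T := by
  set L : evolutionTest T W →ₗ[ℝ] ℝ :=
    (innerSL ℝ F).toLinearMap ∘ₗ contToL2 T W ∘ₗ evolutionTest.toCont T W
      + ((innerSL ℝ U₀).comp j).toLinearMap ∘ₗ (LinearMap.proj (0 : ℝ)) ∘ₗ
        (evolutionTest T W).subtype
  have hL : ∀ χ : evolutionTest T W, L χ
      = inner ℝ F (contToL2 T W (evolutionTest.toCont T W χ)) + inner ℝ U₀ (j (χ.1 0)) :=
    fun χ => rfl
  set Λ := Real.exp (2 * l * T)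
  -- Both coefficients come from the lower bound: first `c ‖χ‖ ≤ Λ ‖Kχ‖`, where `K` is the adjoint
  -- operator, then `½ ‖j χ(0)‖² ≤ Λ ‖χ‖ ‖Kχ‖ ≤ Λ² ‖Kχ‖² / c`.
  obtain ⟨U, hU⟩ := exists_inner_eq_of_abs_le (adjointEvolution j 𝒜) L
    (‖F‖ * (Λ / c) + ‖U₀‖ * (Λ * √(2 / c))) (by
      intro χ
      have h1 := adjointEvolution_lower_bound hT j 𝒜 hl hc hcoer χ
      rw [hL]
      set x := contToL2 T W (evolutionTest.toCont T W χ)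
      set k := ‖adjointEvolution j 𝒜 χ‖
      have hk : 0 ≤ k := norm_nonneg _
      have hΛ : 0 < Λ := Real.exp_pos _
      have hx : ‖x‖ ≤ Λ / c * k := by
        rcases (norm_nonneg x).eq_or_lt with h0 | h0
        · rw [← h0]
          positivity
        · rw [div_mul_eq_mul_div, le_div_iff₀ hc]
          have : ‖x‖ * (‖x‖ * c) ≤ ‖x‖ * (Λ * k) := by nlinarith [sq_nonneg ‖j (χ.1 0)‖]
          exact le_of_mul_le_mul_left this h0
      have hy : ‖j (χ.1 0)‖ ≤ Λ * √(2 / c) * k := by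
        refine (sq_le_sq₀ (norm_nonneg _) (by positivity)).1 ?_
        rw [mul_pow, mul_pow, Real.sq_sqrt (by positivity)]
        have h2 : Λ * ‖x‖ * k ≤ Λ * (Λ / c * k) * k := by gcongr
        have h3 : Λ * (Λ / c * k) * k = 1 / 2 * (Λ ^ 2 * (2 / c) * k ^ 2) := by ring
        have h4 : 0 ≤ c * ‖x‖ ^ 2 := by positivity
        linarith
      have h2 := abs_real_inner_le_norm F x
      have h3 := abs_real_inner_le_norm U₀ (j (χ.1 0))
      calc |inner ℝ F x + inner ℝ U₀ (j (χ.1 0))|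
          ≤ |inner ℝ F x| + |inner ℝ U₀ (j (χ.1 0))| := abs_add_le _ _
        _ ≤ ‖F‖ * (Λ / c * k) + ‖U₀‖ * (Λ * √(2 / c) * k) :=
            add_le_add (h2.trans (by gcongr)) (h3.trans (by gcongr))
        _ = _ := by ring)
  refine ⟨U, fun φ hφ w => ?_⟩
  have hφ1 : ContDiff ℝ 1 φ := hφ.1.of_le (by simp)
  have hφT : φ T = 0 := image_eq_zero_of_notMem_tsupport fun h => lt_irrefl T (hφ.2.2 h)
  set χ : evolutionTest T W := ⟨fun t => φ t • w, hφ1.smul contDiff_const, by simp [hφT]⟩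
  have hχ' : ∀ t, deriv χ.1 t = deriv φ t • w := fun t =>
    ((hφ1.differentiable (by simp) t).hasDerivAt.smul_const w).deriv
  have h := hU χ
  rw [inner_adjointEvolution, hL, L2.inner_def] at h
  have e1 : ∫ t, inner ℝ (j (U t)) (j (deriv χ.1 t)) ∂timeMeasure T
      = ∫ t, inner ℝ (j (U t)) (j w) * deriv φ t ∂timeMeasure T := by
    simp only [hχ', map_smul, real_inner_smul_right, mul_comm]
  have e2 : inner ℝ U₀ (j (χ.1 0)) = inner ℝ U₀ (j w) * φ 0 := by
    change inner ℝ U₀ (j (φ 0 • w)) = _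
    rw [map_smul, real_inner_smul_right, mul_comm]
  have e3 : ∫ t, inner ℝ ((F - 𝒜 U) t) w * φ t ∂timeMeasure T
      = ∫ t, inner ℝ (F t) (contToL2 T W (evolutionTest.toCont T W χ) t) ∂timeMeasure T
        - ∫ t, inner ℝ (𝒜 U t) (χ.1 t) ∂timeMeasure T := by
    rw [← integral_sub (L2.integrable_inner F _)
      (integrable_inner_of_memLp (Lp.memLp (𝒜 U))
        (memLp_timeMeasure_of_continuous χ.2.1.continuous))]
    refine integral_congr_ae ?_
    filter_upwards [Lp.coeFn_sub F (𝒜 U), coeFn_contToL2 T (evolutionTest.toCont T W χ)]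
      with t h1 h2
    rw [h1, h2, Pi.sub_apply]
    change inner ℝ (F t - 𝒜 U t) w * φ t = inner ℝ (F t) (φ t • w) - inner ℝ (𝒜 U t) (φ t • w)
    rw [inner_sub_left, real_inner_smul_right, real_inner_smul_right]
    ring
  rw [e1, e2] at h
  rw [e3]
  linarith

end Existence

/-! ### Measurability of operator-valued functions of time -/

section Measurability

variable {Ω : Type*} [MeasurableSpace Ω] {μ : Measure Ω}

/-- Distinct orthonormal vectors are at distance `√2`, so their set is discrete, hence countable in
a second countable space. -/
theorem countable_of_orthonormal {ι Y : Type*} [NormedAddCommGroup Y] [InnerProductSpace ℝ Y]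
    [SecondCountableTopology Y] {b : ι → Y} (hb : Orthonormal ℝ b) : Countable ι := by
  have hinj : Function.Injective b := hb.linearIndependent.injective
  have hd : ∀ i k, i ≠ k → 1 ≤ dist (b i) (b k) := by
    intro i k hik
    have h : ‖b i - b k‖ ^ 2 = 2 := by
      rw [norm_sub_sq_real, hb.1, hb.1, hb.2 hik]
      norm_num
    rw [dist_eq_norm]
    nlinarith [norm_nonneg (b i - b k)]
  have : DiscreteTopology (range b) := by
    refine DiscreteTopology.of_forall_le_dist one_pos ?_
    rintro ⟨_, i, rfl⟩ ⟨_, k, rfl⟩ hik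
    exact hd i k fun h => hik (by simp [h])
  have hc : Countable (range b) :=
    TopologicalSpace.separableSpace_iff_countable.1 inferInstance
  exact (Equiv.ofInjective b hinj).countable_iff.2 hc

/-- Pettis' theorem in a separable Hilbert space. -/
theorem aestronglyMeasurable_of_inner {Y : Type*} [NormedAddCommGroup Y] [InnerProductSpace ℝ Y]
    [CompleteSpace Y] [SecondCountableTopology Y] {g : Ω → Y}
    (h : ∀ y, AEStronglyMeasurable (fun t => inner ℝ y (g t)) μ) : AEStronglyMeasurable g μ := by
  obtain ⟨w, b, -⟩ := exists_hilbertBasis ℝ Y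
  have : Countable w := countable_of_orthonormal b.orthonormal
  refine aestronglyMeasurable_of_tendsto_ae (u := (atTop : Filter (Finset w)))
    (f := fun s t => ∑ i ∈ s, inner ℝ (b i) (g t) • b i) (fun s => ?_)
    (Eventually.of_forall fun t => ?_)
  · exact Finset.aestronglyMeasurable_fun_sum s fun i _ => (h (b i)).smul_const (b i)
  · have := b.hasSum_repr (g t)
    simp only [b.repr_apply_apply] at this
    exact this

/-- Measurability of `B` is assumed only vector by vector, not in operator norm. For simple `P` the
composition is a finite sum over the values of `P`; the general case is a pointwise limit, by
continuity of each `B t`. -/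
theorem aestronglyMeasurable_clm_apply {X Y : Type*} [NormedAddCommGroup X] [NormedSpace ℝ X]
    [NormedAddCommGroup Y] [NormedSpace ℝ Y] {B : Ω → X →L[ℝ] Y} {P : Ω → X}
    (hB : ∀ x, AEStronglyMeasurable (fun t => B t x) μ) (hP : AEStronglyMeasurable P μ) :
    AEStronglyMeasurable (fun t => B t (P t)) μ := by
  obtain ⟨Q, hQ, hPQ⟩ := hP
  refine AEStronglyMeasurable.congr (f := fun t => B t (Q t)) ?_
    (hPQ.mono fun t ht => by simp only [ht])
  refine aestronglyMeasurable_of_tendsto_ae (u := atTop) (f := fun n t => B t (hQ.approx n t))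
    (fun n => ?_)
    (Eventually.of_forall fun t => ((B t).continuous.tendsto _).comp (hQ.tendsto_approx t))
  set s := hQ.approx n
  have : (fun t => B t (s t)) = fun t => ∑ y ∈ s.range, (s ⁻¹' {y}).indicator (fun t => B t y) t := by
    funext t
    rw [Finset.sum_eq_single (s t)]
    · simp
    · intro y _ hy
      exact indicator_of_notMem (fun h => hy h.symm) _
    · intro h
      exact absurd (s.mem_range_self t) h
  rw [this]
  exact Finset.aestronglyMeasurable_fun_sum _ fun y _ =>
    (hB y).indicator (s.measurableSet_fiber y)

theorem memLp_clm_apply {X Y : Type*} [NormedAddCommGroup X] [NormedSpace ℝ X]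
    [NormedAddCommGroup Y] [NormedSpace ℝ Y] {B : Ω → X →L[ℝ] Y} {C : ℝ}
    (hB : ∀ x, AEStronglyMeasurable (fun t => B t x) μ) (hC : ∀ᵐ t ∂μ, ‖B t‖ ≤ C)
    (P : Lp X 2 μ) : MemLp (fun t => B t (P t)) 2 μ := by
  refine MemLp.of_le_mul (c := C) (Lp.memLp P)
    (aestronglyMeasurable_clm_apply hB (Lp.aestronglyMeasurable P)) ?_
  filter_upwards [hC] with t ht
  exact (B t).le_of_opNorm_le ht _

/-- The operator `P ↦ (t ↦ B(t) P(t))` on `L²`. -/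
def pointwiseOp {X Y : Type*} [NormedAddCommGroup X] [NormedSpace ℝ X]
    [NormedAddCommGroup Y] [NormedSpace ℝ Y] (B : Ω → X →L[ℝ] Y) (C : ℝ)
    (hB : ∀ x, AEStronglyMeasurable (fun t => B t x) μ) (hC : ∀ᵐ t ∂μ, ‖B t‖ ≤ C) :
    Lp X 2 μ →L[ℝ] Lp Y 2 μ :=
  LinearMap.mkContinuous
    { toFun := fun P => (memLp_clm_apply hB hC P).toLp
      map_add' := by
        intro P Q
        rw [← MemLp.toLp_add]
        refine MemLp.toLp_congr _ _ ?_
        filter_upwards [Lp.coeFn_add P Q] with t ht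
        rw [ht]
        exact map_add (B t) _ _
      map_smul' := by
        intro c P
        rw [RingHom.id_apply, ← MemLp.toLp_const_smul]
        refine MemLp.toLp_congr _ _ ?_
        filter_upwards [Lp.coeFn_smul c P] with t ht
        rw [ht]
        exact map_smul (B t) c _ } C (by
      intro P
      refine Lp.norm_le_mul_norm_of_ae_le_mul ?_
      filter_upwards [hC, (memLp_clm_apply hB hC P).coeFn_toLp] with t h1 h2
      exact (congrArg norm h2).trans_le ((B t).le_of_opNorm_le h1 _))

theorem coeFn_pointwiseOp {X Y : Type*} [NormedAddCommGroup X] [NormedSpace ℝ X]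
    [NormedAddCommGroup Y] [NormedSpace ℝ Y] (B : Ω → X →L[ℝ] Y) (C : ℝ)
    (hB : ∀ x, AEStronglyMeasurable (fun t => B t x) μ) (hC : ∀ᵐ t ∂μ, ‖B t‖ ≤ C) (P : Lp X 2 μ) :
    pointwiseOp B C hB hC P =ᵐ[μ] fun t => B t (P t) :=
  (memLp_clm_apply hB hC P).coeFn_toLp

end Measurability

/-! ### Multiplication by the bounded force field -/

theorem ae_norm_le_of_Lp_top {Ω X : Type*} [MeasurableSpace Ω] {μ : Measure Ω}
    [NormedAddCommGroup X] (f : Lp X (⊤ : ℝ≥0∞) μ) : ∀ᵐ q ∂μ, ‖f q‖ ≤ ‖f‖ := by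
  filter_upwards [ae_le_eLpNormEssSup (f := f) (μ := μ)] with q hq
  rw [Lp.norm_def, eLpNorm_exponent_top, ← toReal_enorm]
  refine ENNReal.toReal_mono ?_ hq
  rw [← eLpNorm_exponent_top]
  exact Lp.eLpNorm_ne_top f

section Force

variable {d : ℕ} {D : BoundedDomain d} {T : ℝ}

open Classical in
/-- Multiplication of scalar functions by the vector field `g`, as an operator on `L²`. -/
def mulOp (D : BoundedDomain d) (g : Space d → Space d) : L2 D ℝ →L[ℝ] L2 D (Space d) :=
  if h : MemLp g (⊤ : ℝ≥0∞) D.measure then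
    ((ContinuousLinearMap.lsmul ℝ ℝ : ℝ →L[ℝ] Space d →L[ℝ] Space d).flip).holderL
      D.measure (⊤ : ℝ≥0∞) 2 2 h.toLp
  else 0

theorem coeFn_mulOp {g : Space d → Space d} (h : MemLp g (⊤ : ℝ≥0∞) D.measure) (p : L2 D ℝ) :
    mulOp D g p =ᵐ[D.measure] fun x => p x • g x := by
  rw [mulOp, dif_pos h]
  refine (ContinuousLinearMap.coeFn_holder _ _ _).trans ?_
  filter_upwards [h.coeFn_toLp] with x hx
  rw [hx]
  rfl

theorem norm_mulOp_le {g : Space d → Space d} (h : MemLp g (⊤ : ℝ≥0∞) D.measure) {C : ℝ}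
    (hC0 : 0 ≤ C) (hC : ∀ᵐ x ∂D.measure, ‖g x‖ ≤ C) : ‖mulOp D g‖ ≤ C := by
  refine ContinuousLinearMap.opNorm_le_bound _ hC0 fun p => ?_
  refine Lp.norm_le_mul_norm_of_ae_le_mul ?_
  filter_upwards [coeFn_mulOp h p, hC] with x h1 h2
  rw [h1, norm_smul, mul_comm]
  gcongr

theorem restrict_QT (D : BoundedDomain d) (T : ℝ) :
    (volume : Measure (Space d × ℝ)).restrict (D.carrier ×ˢ Ioo 0 T)
      = D.measure.prod (timeMeasure T) := by
  rw [Measure.volume_eq_prod, Measure.prod_restrict]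

theorem aestronglyMeasurable_force (f : LInfQT D T) :
    AEStronglyMeasurable (fun q : ℝ × Space d => f (q.2, q.1))
      ((timeMeasure T).prod D.measure) := by
  exact (restrict_QT D T ▸ (Lp.stronglyMeasurable f).aestronglyMeasurable :
    AEStronglyMeasurable (f : Space d × ℝ → Space d) (D.measure.prod (timeMeasure T))).prod_swap

theorem ae_norm_force_le (f : LInfQT D T) :
    ∀ᵐ t ∂timeMeasure T, ∀ᵐ x ∂D.measure, ‖f (x, t)‖ ≤ ‖f‖ := by
  have h : ∀ᵐ q ∂D.measure.prod (timeMeasure T), ‖f q‖ ≤ ‖f‖ :=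
    (Measure.absolutelyContinuous_of_eq (restrict_QT D T).symm).ae_le (ae_norm_le_of_Lp_top f)
  exact Measure.ae_ae_of_ae_prod
    (Measure.measurePreserving_swap (μ := timeMeasure T) (ν := D.measure)
      |>.quasiMeasurePreserving.ae h)

theorem ae_memLp_force (f : LInfQT D T) :
    ∀ᵐ t ∂timeMeasure T, MemLp (fun x => f (x, t)) (⊤ : ℝ≥0∞) D.measure := by
  filter_upwards [ae_norm_force_le f, (aestronglyMeasurable_force f).prodMk_left] with t h1 h2
  exact memLp_top_of_bound h2 _ h1

theorem inner_mulOp {g : Space d → Space d} (h : MemLp g (⊤ : ℝ≥0∞) D.measure) (p : L2 D ℝ)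
    (v : L2 D (Space d)) :
    inner ℝ (mulOp D g p) v = ∫ x, inner ℝ (p x • g x) (v x) ∂D.measure := by
  rw [L2.inner_def]
  refine integral_congr_ae ?_
  filter_upwards [coeFn_mulOp h p] with x hx
  rw [hx]

/-- By Pettis it suffices to pair with a fixed field `v`. The pairing is the `x`-integral of a
jointly measurable function, so it is measurable in `t`. -/
theorem aestronglyMeasurable_mulOp_force (f : LInfQT D T) (p : L2 D ℝ) :
    AEStronglyMeasurable (fun t => mulOp D (fun x => f (x, t)) p) (timeMeasure T) := by
  -- Instance input for the separability of `L²`.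
  have : Fact ((2 : ℝ≥0∞) ≠ ⊤) := ⟨by simp⟩
  refine aestronglyMeasurable_of_inner fun v => ?_
  have h1 : AEStronglyMeasurable (fun q : ℝ × Space d => inner ℝ (p q.2 • f (q.2, q.1)) (v q.2))
      ((timeMeasure T).prod D.measure) :=
    ((Lp.aestronglyMeasurable p).comp_snd.smul (aestronglyMeasurable_force f)).inner
      (Lp.aestronglyMeasurable v).comp_snd
  refine h1.integral_prod_right'.congr ?_
  filter_upwards [ae_memLp_force f] with t ht
  rw [real_inner_comm, inner_mulOp ht]

theorem ae_norm_mulOp_force_le (f : LInfQT D T) :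
    ∀ᵐ t ∂timeMeasure T, ‖mulOp D fun x => f (x, t)‖ ≤ ‖f‖ := by
  filter_upwards [ae_memLp_force f, ae_norm_force_le f] with t h1 h2
  exact norm_mulOp_le h1 (norm_nonneg f) h2

/-- The operator `p ↦ p f` from `L²(0, T; L²(D))` to `L²(0, T; L²(D)ᵈ)`. -/
def forceOp (f : LInfQT D T) : L2Time T (L2 D ℝ) →L[ℝ] L2Time T (L2 D (Space d)) :=
  pointwiseOp (fun t => mulOp D fun x => f (x, t)) ‖f‖ (aestronglyMeasurable_mulOp_force f)
    (ae_norm_mulOp_force_le f)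

theorem coeFn_forceOp (f : LInfQT D T) (p : L2Time T (L2 D ℝ)) :
    forceOp f p =ᵐ[timeMeasure T] fun t => mulOp D (fun x => f (x, t)) (p t) :=
  coeFn_pointwiseOp _ _ _ _ p

theorem ae_norm_forceOp_le (f : LInfQT D T) (p : L2Time T (L2 D ℝ)) :
    ∀ᵐ t ∂timeMeasure T, ‖forceOp f p t‖ ≤ ‖f‖ * ‖p t‖ := by
  filter_upwards [coeFn_forceOp f p, ae_norm_mulOp_force_le f] with t h1 h2
  rw [h1]
  exact ContinuousLinearMap.le_of_opNorm_le _ h2 _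

theorem ae_inner_forceOp (f : LInfQT D T) (p : L2Time T (L2 D ℝ)) (α : ℝ) :
    ∀ᵐ t ∂timeMeasure T, ∀ v : L2 D (Space d),
      ∫ x, inner ℝ ((α * p t x) • f (x, t)) (v x) ∂D.measure = α * inner ℝ (forceOp f p t) v := by
  filter_upwards [coeFn_forceOp f p, ae_memLp_force f] with t h1 h2 v
  rw [h1, inner_mulOp h2, ← integral_const_mul]
  simp only [mul_smul, real_inner_smul_left]

end Force

/-! ### From weak equations to the energy inequality on `(0, T)` -/

section EnergyEstimate

theorem integrable_apply_mul {T : ℝ} {X : Type*} [NormedAddCommGroup X] [NormedSpace ℝ X]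
    (ℓ : X →L[ℝ] ℝ) (U : Lp X 2 (timeMeasure T)) {φ : ℝ → ℝ} (hφ : Continuous φ) :
    Integrable (fun t => ℓ (U t) * φ t) (timeMeasure T) :=
  MemLp.integrable_mul (ℓ.comp_memLp' (Lp.memLp U)) (memLp_timeMeasure_of_continuous hφ)

theorem integrable_smul_of_memLp {T : ℝ} {X : Type*} [NormedAddCommGroup X] [NormedSpace ℝ X]
    {U : ℝ → X} (hU : MemLp U 2 (timeMeasure T)) {φ : ℝ → ℝ} (hφ : Continuous φ) :
    Integrable (fun t => φ t • U t) (timeMeasure T) :=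
  memLp_one_iff_integrable.1 (hU.smul (memLp_timeMeasure_of_continuous hφ))

variable {W H : Type} [NormedAddCommGroup W] [InnerProductSpace ℝ W]
  [NormedAddCommGroup H] [InnerProductSpace ℝ H] [CompleteSpace W] [CompleteSpace H]

/-- The scalar equations are gathered into one `W`-valued equation: `j* j U` has weak derivative `G`
and initial value `j* U₀`. The exceptional null set then serves all `w` at once, so `w` may later
depend on `t`. -/
theorem ae_inner_eq_of_weak {T : ℝ} (hT : 0 < T) {j : W →L[ℝ] H} {U₀ : H} {U G : L2Time T W}
    (h : ∀ φ : ℝ → ℝ, IsTimeTest T φ → ∀ w : W,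
      -(∫ t, inner ℝ (j (U t)) (j w) * deriv φ t ∂timeMeasure T) - inner ℝ U₀ (j w) * φ 0
        = ∫ t, inner ℝ (G t) w * φ t ∂timeMeasure T) :
    ∀ᵐ t ∂timeMeasure T, ∀ w, inner ℝ (j (U t)) (j w)
      = inner ℝ U₀ (j w) + inner ℝ (∫ r in (0 : ℝ)..t, G r) w := by
  have hU : MemLp (fun t => (j.adjoint ∘L j) (U t)) 2 (timeMeasure T) :=
    (j.adjoint ∘L j).comp_memLp' (Lp.memLp U)
  have hG := Lp.memLp G
  have key := ae_eq_add_integral_of_weak hT (a := fun t => (j.adjoint ∘L j) (U t)) (g := G)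
    (x₀ := j.adjoint U₀) (hU.integrable (by norm_num)) (hG.integrable (by norm_num)) (by
      intro φ hφ
      refine ext_inner_left ℝ fun w => ?_
      have hφ' : Continuous (deriv φ) := hφ.1.continuous_deriv (by simp)
      rw [inner_sub_right, inner_neg_right, real_inner_smul_right,
        ← integral_inner (integrable_smul_of_memLp hU hφ'),
        ← integral_inner (integrable_smul_of_memLp hG hφ.1.continuous),
        ContinuousLinearMap.adjoint_inner_right]
      refine Eq.trans ?_ ((h φ hφ w).trans ?_)
      · rw [mul_comm (φ 0), real_inner_comm U₀]
        congr 2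
        refine integral_congr_ae (Eventually.of_forall fun t => ?_)
        simp only [ContinuousLinearMap.comp_apply]
        rw [real_inner_smul_right, ContinuousLinearMap.adjoint_inner_right, real_inner_comm,
          mul_comm]
      · refine integral_congr_ae (Eventually.of_forall fun t => ?_)
        simp only
        rw [real_inner_smul_right, real_inner_comm, mul_comm])
  filter_upwards [key] with t ht w
  have := congrArg (fun x => inner ℝ x w) ht
  simp only [ContinuousLinearMap.comp_apply, inner_add_left,
    ContinuousLinearMap.adjoint_inner_left] at this
  exact this

/-- `U` and `G` are extended by zero to `ℝ`, where translations act; nothing changes on `(0, τ]` for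
`τ < T`. -/
theorem ae_energy_le_of_weak {T : ℝ} (hT : 0 < T) {j : W →L[ℝ] H} {U₀ : H} {U G : L2Time T W}
    (h : ∀ φ : ℝ → ℝ, IsTimeTest T φ → ∀ w : W,
      -(∫ t, inner ℝ (j (U t)) (j w) * deriv φ t ∂timeMeasure T) - inner ℝ U₀ (j w) * φ 0
        = ∫ t, inner ℝ (G t) w * φ t ∂timeMeasure T) :
    ∀ᵐ τ ∂timeMeasure T, ‖j (U τ)‖ ^ 2
      ≤ ‖U₀‖ ^ 2 + 2 * ∫ t in Ioc 0 τ, inner ℝ (G t) (U t) := by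
  have hm : ∀ X : L2Time T W, StronglyMeasurable ((Ioo 0 T).indicator X) := fun X =>
    (Lp.stronglyMeasurable X).indicator measurableSet_Ioo
  have hL : ∀ X : L2Time T W, MemLp ((Ioo 0 T).indicator X) 2 volume := fun X =>
    (memLp_indicator_iff_restrict measurableSet_Ioo).2 (Lp.memLp X)
  have hs : ∀ τ ∈ Ioo 0 T, ∀ t ∈ Ioc 0 τ, t ∈ Ioo 0 T := fun τ hτ t ht =>
    ⟨ht.1, ht.2.trans_lt hτ.2⟩
  have key := ae_energy_le (T := T) (j := j) (U₀ := U₀) (hm U) (hm G) (hL U) (hL G) (by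
    filter_upwards [ae_inner_eq_of_weak hT h, ae_restrict_mem measurableSet_Ioo] with t h1 ht w
    rw [indicator_of_mem ht, h1 w]
    congr 2
    refine intervalIntegral.integral_congr_ae (Eventually.of_forall fun r hr => ?_)
    rw [uIoc_of_le ht.1.le] at hr
    rw [indicator_of_mem (hs t ht r hr)])
  filter_upwards [key, ae_restrict_mem measurableSet_Ioo] with τ h1 hτ
  rw [indicator_of_mem hτ] at h1
  refine h1.trans (le_of_eq ?_)
  congr 2
  refine setIntegral_congr_fun measurableSet_Ioc fun t ht => ?_
  simp only [indicator_of_mem (hs τ hτ t ht)]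

end EnergyEstimate

/-! ### Gronwall's lemma -/

section Gronwall

/-- With `m` the primitive on the right of the hypothesis, `(K + l m) e^{-lt}` is nonincreasing
because `m' = K + l h ≤ K + l m`. -/
theorem gronwall_primitive {T K l : ℝ} {h : ℝ → ℝ} (hc : Continuous h) (hl : 0 ≤ l)
    (hle : ∀ t ∈ Icc 0 T, h t ≤ ∫ r in (0 : ℝ)..t, (K + l * h r)) {t : ℝ} (ht : t ∈ Icc 0 T) :
    K + l * h t ≤ K * Real.exp (l * t) := by
  set m : ℝ → ℝ := fun t => ∫ r in (0 : ℝ)..t, (K + l * h r)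
  have hc' : Continuous fun r => K + l * h r := by fun_prop
  have hm : ∀ t, HasDerivAt m (K + l * h t) t := fun t =>
    intervalIntegral.integral_hasDerivAt_right (hc'.intervalIntegrable _ _)
      hc'.stronglyMeasurable.stronglyMeasurableAtFilter hc'.continuousAt
  have hd : ∀ t, HasDerivAt (fun t => (K + l * m t) * Real.exp (-(l * t)))
      (l * (K + l * h t) * Real.exp (-(l * t))
        + (K + l * m t) * (Real.exp (-(l * t)) * -l)) t := by
    intro t
    refine (((hm t).const_mul l).const_add K).mul ?_
    simpa using ((hasDerivAt_id t).const_mul l).neg.exp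
  have hanti : AntitoneOn (fun t => (K + l * m t) * Real.exp (-(l * t))) (Icc 0 T) := by
    refine antitoneOn_of_deriv_nonpos (convex_Icc 0 T)
      (fun t _ => (hd t).continuousAt.continuousWithinAt)
      (fun t _ => (hd t).differentiableAt.differentiableWithinAt) fun t ht => ?_
    rw [interior_Icc] at ht
    rw [(hd t).deriv]
    have h1 := hle t (Ioo_subset_Icc_self ht)
    have h2 : l * (l * (h t - m t)) ≤ 0 := by
      have : h t - m t ≤ 0 := sub_nonpos.2 h1
      exact mul_nonpos_of_nonneg_of_nonpos hl (mul_nonpos_of_nonneg_of_nonpos hl this)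
    have h3 : l * (l * (h t - m t)) * Real.exp (-(l * t)) ≤ 0 :=
      mul_nonpos_of_nonpos_of_nonneg h2 (Real.exp_pos _).le
    linarith
  have h0 := hanti (left_mem_Icc.2 (ht.1.trans ht.2)) ht ht.1
  simp only [m, intervalIntegral.integral_same, mul_zero, add_zero, neg_zero, Real.exp_zero,
    mul_one] at h0
  have h1 : K + l * h t ≤ K + l * m t := by
    have := hle t ht
    gcongr
  refine h1.trans ?_
  rw [Real.exp_neg, ← div_eq_mul_inv, div_le_iff₀ (Real.exp_pos _)] at h0
  exact h0

/-- Gronwall's lemma for an energy `E` with dissipation `v`. -/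
theorem energy_gronwall {T e₀ l : ℝ} (hT : 0 < T) (he₀ : 0 ≤ e₀) (hl : 0 ≤ l) {E v b : ℝ → ℝ}
    (hE : Integrable E (timeMeasure T)) (hv : Integrable v (timeMeasure T))
    (hb : Integrable b (timeMeasure T)) (hv0 : ∀ t, 0 ≤ v t) (hE0 : ∀ t, 0 ≤ E t)
    (hb0 : ∀ t, 0 ≤ b t)
    (h : ∀ᵐ τ ∂timeMeasure T, E τ + ∫ t in Ioc 0 τ, v t
      ≤ e₀ + ∫ t in Ioc 0 τ, (b t + l * E t)) :
    (∀ᵐ τ ∂timeMeasure T, E τ ≤ (e₀ + ∫ t, b t ∂timeMeasure T) * Real.exp (l * T)) ∧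
      ∫ t, v t ∂timeMeasure T ≤ (e₀ + ∫ t, b t ∂timeMeasure T) * Real.exp (l * T) := by
  set K := e₀ + ∫ t, b t ∂timeMeasure T
  have hK : 0 ≤ K := add_nonneg he₀ (integral_nonneg hb0)
  have hind : ∀ {f : ℝ → ℝ}, Integrable f (timeMeasure T) → Integrable ((Ioo 0 T).indicator f) :=
    fun hf => (integrable_indicator_iff measurableSet_Ioo).2 hf
  have hprim : ∀ {f : ℝ → ℝ}, Integrable f (timeMeasure T) →
      Continuous fun t => ∫ r in (0 : ℝ)..t, (Ioo 0 T).indicator f r := fun hf =>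
    intervalIntegral.continuous_primitive (fun a b => (hind hf).intervalIntegrable) 0
  have hsub : ∀ {τ}, τ ∈ Ioo 0 T → Ioc 0 τ ⊆ Ioo 0 T := fun hτ t ht => ⟨ht.1, ht.2.trans_lt hτ.2⟩
  have hprim_eq : ∀ (f : ℝ → ℝ) {τ}, τ ∈ Ioo 0 T →
      ∫ r in (0 : ℝ)..τ, (Ioo 0 T).indicator f r = ∫ r in Ioc 0 τ, f r := by
    intro f τ hτ
    rw [intervalIntegral.integral_of_le hτ.1.le]
    exact setIntegral_congr_fun measurableSet_Ioc fun r hr => indicator_of_mem (hsub hτ hr) f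
  -- `E` is only integrable and its inequality holds only almost everywhere, so Gronwall is applied
  -- to its continuous primitive `g`.
  set g : ℝ → ℝ := fun t => ∫ r in (0 : ℝ)..t, (Ioo 0 T).indicator E r with hg
  have h1 : ∀ᵐ τ ∂timeMeasure T, E τ + ∫ t in Ioc 0 τ, v t ≤ K + l * g τ := by
    filter_upwards [h, ae_restrict_mem measurableSet_Ioo] with τ hτ hm
    have b1 : IntegrableOn b (Ioc 0 τ) := IntegrableOn.mono_set hb (hsub hm)
    have b2 : IntegrableOn (fun t => l * E t) (Ioc 0 τ) :=
      (IntegrableOn.mono_set hE (hsub hm)).const_mul l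
    rw [integral_add b1 b2, integral_const_mul] at hτ
    have : ∫ t in Ioc 0 τ, b t ≤ ∫ t, b t ∂timeMeasure T :=
      setIntegral_mono_set hb (Eventually.of_forall hb0) (Eventually.of_forall (hsub hm))
    rw [hg]
    simp only [hprim_eq E hm]
    simp only [K]
    linarith
  have h1' : ∀ᵐ τ : ℝ, τ ∈ Ioo 0 T → E τ + ∫ t in Ioc 0 τ, v t ≤ K + l * g τ :=
    (ae_restrict_iff' measurableSet_Ioo).1 h1
  have hgK : ∀ t ∈ Icc 0 T, K + l * g t ≤ K * Real.exp (l * t) := fun t ht => by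
    refine gronwall_primitive (T := T) (hprim hE) hl (fun t ht => ?_) ht
    have hi : IntervalIntegrable (fun r => K + l * g r) volume 0 t :=
      (by have := hprim hE; fun_prop : Continuous fun r => K + l * g r).intervalIntegrable _ _
    refine intervalIntegral.integral_mono_ae_restrict ht.1 (hind hE).intervalIntegrable hi ?_
    filter_upwards [ae_restrict_of_ae h1', ae_restrict_mem measurableSet_Icc] with r hr hr0
    by_cases hm : r ∈ Ioo 0 T
    · rw [indicator_of_mem hm]
      have : 0 ≤ ∫ t in Ioc 0 r, v t := integral_nonneg hv0
      linarith [hr hm]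
    · rw [indicator_of_notMem hm]
      have : 0 ≤ g r := intervalIntegral.integral_nonneg hr0.1 fun s _ =>
        indicator_nonneg (fun t _ => hE0 t) s
      positivity
  have hexp : ∀ t ∈ Icc 0 T, K + l * g t ≤ K * Real.exp (l * T) := fun t ht =>
    (hgK t ht).trans (by have := ht.2; gcongr)
  refine ⟨?_, ?_⟩
  · filter_upwards [h1, ae_restrict_mem measurableSet_Ioo] with τ hτ hm
    have : 0 ≤ ∫ t in Ioc 0 τ, v t := integral_nonneg hv0
    exact (by linarith : E τ ≤ K + l * g τ).trans (hexp τ (Ioo_subset_Icc_self hm))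
  -- The endpoint `T` is reached through the dense set of good times, since the primitive of `v` is
  -- continuous.
  · have hd : Dense {τ : ℝ | τ ∈ Ioo 0 T → E τ + ∫ t in Ioc 0 τ, v t ≤ K + l * g τ} :=
      Measure.dense_of_ae h1'
    have hcl : T ∈ closure (Ioo 0 T ∩ {τ : ℝ | τ ∈ Ioo 0 T →
        E τ + ∫ t in Ioc 0 τ, v t ≤ K + l * g τ}) := by
      refine closure_minimal (hd.open_subset_closure_inter isOpen_Ioo) isClosed_closure ?_
      rw [closure_Ioo hT.ne]
      exact right_mem_Icc.2 hT.le
    have hset : closure (Ioo 0 T ∩ {τ : ℝ | τ ∈ Ioo 0 T →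
        E τ + ∫ t in Ioc 0 τ, v t ≤ K + l * g τ})
          ⊆ {τ | ∫ r in (0 : ℝ)..τ, (Ioo 0 T).indicator v r ≤ K * Real.exp (l * T)} := by
      refine closure_minimal (fun τ hτ => ?_) (isClosed_le (hprim hv) continuous_const)
      have := hτ.2 hτ.1
      rw [mem_ofPred_eq, hprim_eq v hτ.1]
      have h0 := hE0 τ
      exact (by linarith : _ ≤ K + l * g τ).trans (hexp τ (Ioo_subset_Icc_self hτ.1))
    have := hset hcl
    rw [mem_ofPred_eq, intervalIntegral.integral_of_le hT.le,
      setIntegral_indicator measurableSet_Ioo,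
      inter_eq_right.2 Ioo_subset_Ioc_self] at this
    exact this

end Gronwall

/-! ### The system for pairs in a Hilbert space setting -/

/-- The action of a bounded operator on functions of time. -/
abbrev timeLift (T : ℝ) {X Y : Type} [NormedAddCommGroup X] [NormedSpace ℝ X]
    [NormedAddCommGroup Y] [NormedSpace ℝ Y] (L : X →L[ℝ] Y) : L2Time T X →L[ℝ] L2Time T Y :=
  L.compLpL 2 (timeMeasure T)

theorem ae_timeLift {T : ℝ} {X Y : Type} [NormedAddCommGroup X] [NormedSpace ℝ X]
    [NormedAddCommGroup Y] [NormedSpace ℝ Y] (L : X →L[ℝ] Y) (U : L2Time T X) :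
    ∀ᵐ t ∂timeMeasure T, timeLift T L U t = L (U t) :=
  L.coeFn_compLpL U

section System

variable {V P H : Type} [NormedAddCommGroup V] [InnerProductSpace ℝ V]
  [NormedAddCommGroup P] [InnerProductSpace ℝ P] [NormedAddCommGroup H] [InnerProductSpace ℝ H]

/-- The inclusion of the first factor of a Hilbert sum. -/
def inlL (V P : Type) [NormedAddCommGroup V] [InnerProductSpace ℝ V]
    [NormedAddCommGroup P] [InnerProductSpace ℝ P] : V →L[ℝ] WithLp 2 (V × P) :=
  (WithLp.prodContinuousLinearEquiv 2 ℝ V P).symm.toContinuousLinearMap ∘L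
    ContinuousLinearMap.inl ℝ V P

/-- The inclusion of the second factor of a Hilbert sum. -/
def inrL (V P : Type) [NormedAddCommGroup V] [InnerProductSpace ℝ V]
    [NormedAddCommGroup P] [InnerProductSpace ℝ P] : P →L[ℝ] WithLp 2 (V × P) :=
  (WithLp.prodContinuousLinearEquiv 2 ℝ V P).symm.toContinuousLinearMap ∘L
    ContinuousLinearMap.inr ℝ V P

theorem inner_inlL (v : V) (w : WithLp 2 (V × P)) : inner ℝ (inlL V P v) w = inner ℝ v w.fst := by
  rw [WithLp.prod_inner_apply]
  simp [inlL]

theorem inner_inrL (r : P) (w : WithLp 2 (V × P)) : inner ℝ (inrL V P r) w = inner ℝ r w.snd := by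
  rw [WithLp.prod_inner_apply]
  simp [inrL]

theorem inlL_fst (v : V) : (inlL V P v).fst = v := rfl
theorem inlL_snd (v : V) : (inlL V P v).snd = 0 := rfl
theorem inrL_fst (r : P) : (inrL V P r).fst = 0 := rfl
theorem inrL_snd (r : P) : (inrL V P r).snd = r := rfl

/-- The weighted embedding `(u, p) ↦ (√ρ₀ u, √(α/ρ₀) p)` into the energy space. -/
def pivot (val : V →L[ℝ] H) (P : Type) [NormedAddCommGroup P] [InnerProductSpace ℝ P]
    (ρ₀ α : ℝ) : WithLp 2 (V × P) →L[ℝ] WithLp 2 (H × P) :=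
  √ρ₀ • (inlL H P ∘L val ∘L WithLp.fstL 2 ℝ V P) + √(α / ρ₀) • (inrL H P ∘L WithLp.sndL 2 ℝ V P)

/-- The initial datum in the energy space. -/
def initialDatum (ρ₀ α : ℝ) (u₀ : H) (p₀ : P) : WithLp 2 (H × P) :=
  √ρ₀ • inlL H P u₀ + √(α / ρ₀) • inrL H P p₀

theorem pivot_apply (val : V →L[ℝ] H) (ρ₀ α : ℝ) (w : WithLp 2 (V × P)) :
    pivot val P ρ₀ α w = initialDatum ρ₀ α (val w.fst) w.snd := rfl

theorem inner_initialDatum {ρ₀ α : ℝ} (hρ₀ : 0 < ρ₀) (hα : 0 < α) (u v : H) (p r : P) :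
    inner ℝ (initialDatum ρ₀ α u p) (initialDatum ρ₀ α v r)
      = ρ₀ * inner ℝ u v + α / ρ₀ * inner ℝ p r := by
  have h1 : √ρ₀ * √ρ₀ = ρ₀ := Real.mul_self_sqrt hρ₀.le
  have h2 : √(α / ρ₀) * √(α / ρ₀) = α / ρ₀ := Real.mul_self_sqrt (by positivity)
  unfold initialDatum
  simp only [inner_add_left, inner_add_right, real_inner_smul_left, real_inner_smul_right,
    inner_inlL, inner_inrL, inlL_fst, inlL_snd, inrL_fst, inrL_snd, inner_zero_right]
  linear_combination inner ℝ u v * h1 + inner ℝ p r * h2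

theorem norm_sq_initialDatum {ρ₀ α : ℝ} (hρ₀ : 0 < ρ₀) (hα : 0 < α) (u : H) (p : P) :
    ‖initialDatum ρ₀ α u p‖ ^ 2 = ρ₀ * ‖u‖ ^ 2 + α / ρ₀ * ‖p‖ ^ 2 := by
  rw [← real_inner_self_eq_norm_sq, inner_initialDatum hρ₀ hα, real_inner_self_eq_norm_sq,
    real_inner_self_eq_norm_sq]

/-- With `α = a²`, the difference of the two sides is `a M (ρ₀ x - a y)² / ρ₀`. Splitting `α = √α ·
√α` leaves a factor `√α` outside the energy, so the growth rate does not blow up as `α → 0⁺`. -/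
theorem force_young {ρ₀ α M x y : ℝ} (hρ₀ : 0 < ρ₀) (hα : 0 < α) (hM : 0 ≤ M) :
    2 * (α * (M * y * x)) ≤ √α * M * (ρ₀ * x ^ 2 + α / ρ₀ * y ^ 2) := by
  obtain ⟨a, ha, rfl⟩ : ∃ a, 0 < a ∧ α = a ^ 2 :=
    ⟨√α, Real.sqrt_pos.2 hα, (Real.sq_sqrt hα.le).symm⟩
  rw [Real.sqrt_sq ha.le]
  have h : ρ₀ * x ^ 2 + a ^ 2 / ρ₀ * y ^ 2 - 2 * (a * y * x) = (ρ₀ * x - a * y) ^ 2 / ρ₀ := by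
    field_simp
    ring
  have h1 : 0 ≤ (ρ₀ * x - a * y) ^ 2 / ρ₀ := by positivity
  have h2 : 0 ≤ a * M * (ρ₀ * x ^ 2 + a ^ 2 / ρ₀ * y ^ 2 - 2 * (a * y * x)) := by
    rw [h]
    positivity
  nlinarith

theorem abs_force_le {Q : H} {v : H} {M y : ℝ} (h : ‖Q‖ ≤ M * y) :
    |inner ℝ Q v| ≤ M * y * ‖v‖ :=
  (abs_real_inner_le_norm Q v).trans (by gcongr)

/-- The right-hand side of the linearized fluid system. -/
def systemSource {T : ℝ} (ρ₀ : ℝ) (σ : L2Time T P) (S : L2Time T V) : L2Time T (WithLp 2 (V × P)) :=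
  timeLift T (inlL V P) S + ρ₀⁻¹ • timeLift T (inrL V P) σ

theorem ae_inner_systemSource {T : ℝ} (ρ₀ : ℝ) (σ : L2Time T P) (S : L2Time T V) :
    ∀ᵐ t ∂timeMeasure T, ∀ w : WithLp 2 (V × P), inner ℝ (systemSource ρ₀ σ S t) w
      = inner ℝ (S t) w.fst + ρ₀⁻¹ * inner ℝ (σ t) w.snd := by
  unfold systemSource
  filter_upwards [Lp.coeFn_add (timeLift T (inlL V P) S) (ρ₀⁻¹ • timeLift T (inrL V P) σ),
    Lp.coeFn_smul ρ₀⁻¹ (timeLift T (inrL V P) σ), ae_timeLift (inlL V P) S,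
    ae_timeLift (inrL V P) σ] with t h1 h2 h3 h4 w
  rw [h1, Pi.add_apply, h2, Pi.smul_apply, h3, h4, inner_add_left, real_inner_smul_left,
    inner_inlL, inner_inrL]

variable [CompleteSpace V] [CompleteSpace P] [CompleteSpace H] {T : ℝ}

/-- The operator of the momentum equation. -/
def momentumOp (val : V →L[ℝ] H) (div : V →L[ℝ] P) (Φ : L2Time T P →L[ℝ] L2Time T H)
    (μ η α : ℝ) : L2Time T (WithLp 2 (V × P)) →L[ℝ] L2Time T V :=
  timeLift T ((μ • ContinuousLinearMap.id ℝ V + η • (div.adjoint ∘L div)) ∘L WithLp.fstL 2 ℝ V P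
      - div.adjoint ∘L WithLp.sndL 2 ℝ V P)
    - α • (timeLift T val.adjoint ∘L Φ ∘L timeLift T (WithLp.sndL 2 ℝ V P))

/-- The operator of the linearized fluid system, on pairs `(u, p)`. -/
def systemOp (val : V →L[ℝ] H) (div : V →L[ℝ] P) (Φ : L2Time T P →L[ℝ] L2Time T H) (μ η α : ℝ) :
    L2Time T (WithLp 2 (V × P)) →L[ℝ] L2Time T (WithLp 2 (V × P)) :=
  timeLift T (inlL V P) ∘L momentumOp val div Φ μ η α
    + timeLift T (inrL V P ∘L div ∘L WithLp.fstL 2 ℝ V P)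

theorem ae_inner_momentumOp (val : V →L[ℝ] H) (div : V →L[ℝ] P)
    (Φ : L2Time T P →L[ℝ] L2Time T H) (μ η α : ℝ) (U : L2Time T (WithLp 2 (V × P))) :
    ∀ᵐ t ∂timeMeasure T, ∀ v, inner ℝ (momentumOp val div Φ μ η α U t) v
      = μ * inner ℝ (U t).fst v + η * inner ℝ (div (U t).fst) (div v)
        - inner ℝ (U t).snd (div v)
        - α * inner ℝ (Φ (timeLift T (WithLp.sndL 2 ℝ V P) U) t) (val v) := by
  set L := (μ • ContinuousLinearMap.id ℝ V + η • (div.adjoint ∘L div)) ∘L WithLp.fstL 2 ℝ V P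
      - div.adjoint ∘L WithLp.sndL 2 ℝ V P with hL
  set Q := Φ (timeLift T (WithLp.sndL 2 ℝ V P) U) with hQ
  have e : momentumOp val div Φ μ η α U = timeLift T L U - α • timeLift T val.adjoint Q := rfl
  rw [e]
  filter_upwards [Lp.coeFn_sub (timeLift T L U) (α • timeLift T val.adjoint Q),
    Lp.coeFn_smul α (timeLift T val.adjoint Q), ae_timeLift L U, ae_timeLift val.adjoint Q]
    with t h1 h2 h3 h4 v
  rw [h1, Pi.sub_apply, h2, Pi.smul_apply, h3, h4, inner_sub_left, real_inner_smul_left,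
    ContinuousLinearMap.adjoint_inner_left, hL]
  simp only [sub_apply, ContinuousLinearMap.comp_apply,
    add_apply, smul_apply, ContinuousLinearMap.id_apply,
    inner_sub_left, inner_add_left, real_inner_smul_left, ContinuousLinearMap.adjoint_inner_left,
    WithLp.fstL_apply, WithLp.sndL_apply]

theorem ae_inner_systemOp (val : V →L[ℝ] H) (div : V →L[ℝ] P)
    (Φ : L2Time T P →L[ℝ] L2Time T H) (μ η α : ℝ) (U : L2Time T (WithLp 2 (V × P))) :
    ∀ᵐ t ∂timeMeasure T, ∀ w, inner ℝ (systemOp val div Φ μ η α U t) w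
      = inner ℝ (momentumOp val div Φ μ η α U t) w.fst + inner ℝ (div (U t).fst) w.snd := by
  set m := momentumOp val div Φ μ η α U
  have e : systemOp val div Φ μ η α U = timeLift T (inlL V P) m
    + timeLift T (inrL V P ∘L div ∘L WithLp.fstL 2 ℝ V P) U := rfl
  rw [e]
  filter_upwards [Lp.coeFn_add (timeLift T (inlL V P) m)
    (timeLift T (inrL V P ∘L div ∘L WithLp.fstL 2 ℝ V P) U), ae_timeLift (inlL V P) m,
    ae_timeLift (inrL V P ∘L div ∘L WithLp.fstL 2 ℝ V P) U] with t h1 h2 h3 w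
  rw [h1, Pi.add_apply, h2, h3, inner_add_left, inner_inlL]
  simp only [ContinuousLinearMap.comp_apply, inner_inrL, WithLp.fstL_apply]

variable {val : V →L[ℝ] H} {div : V →L[ℝ] P} {Φ : L2Time T P →L[ℝ] L2Time T H}
  {ρ₀ μ η α M : ℝ}

/-- The dissipation of the system is bounded below up to the energy. -/
theorem ae_systemOp_coercive (hρ₀ : 0 < ρ₀) (hη : 0 ≤ η) (hα : 0 < α)
    (hM : 0 ≤ M) (hΦ : ∀ p, ∀ᵐ t ∂timeMeasure T, ‖Φ p t‖ ≤ M * ‖p t‖)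
    (U : L2Time T (WithLp 2 (V × P))) :
    ∀ᵐ t ∂timeMeasure T, 2 * (μ * ‖(U t).fst‖ ^ 2)
      ≤ 2 * inner ℝ (systemOp val div Φ μ η α U t) (U t)
        + √α * M * ‖pivot val P ρ₀ α (U t)‖ ^ 2 := by
  set q := timeLift T (WithLp.sndL 2 ℝ V P) U
  filter_upwards [ae_inner_systemOp val div Φ μ η α U, ae_inner_momentumOp val div Φ μ η α U,
    hΦ q, ae_timeLift (WithLp.sndL 2 ℝ V P) U] with t h1 h2 h3 h4
  rw [h4] at h3
  -- Symmetry of the inner product makes the two coupling terms identical, so they cancel in the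
  -- final `linarith`.
  rw [h1, h2, pivot_apply, norm_sq_initialDatum hρ₀ hα, real_inner_self_eq_norm_sq,
    real_inner_self_eq_norm_sq, real_inner_comm (div (U t).fst)]
  have h5 := (le_abs_self _).trans (abs_force_le (v := val (U t).fst) h3)
  have h6 := force_young (x := ‖val (U t).fst‖) (y := ‖(U t).snd‖) hρ₀ hα hM
  have h7 : 0 ≤ η * ‖div (U t).fst‖ ^ 2 := by positivity
  have h8 := mul_le_mul_of_nonneg_left h5 hα.le
  simp only [WithLp.sndL_apply] at h8
  linarith

/-- Weak solutions of the system, in terms of pairs `U = (u, p)`. -/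
def IsSystemSolution (val : V →L[ℝ] H) (div : V →L[ℝ] P) (Φ : L2Time T P →L[ℝ] L2Time T H)
    (ρ₀ μ η α : ℝ) (σ : L2Time T P) (S : L2Time T V) (u₀ : H) (p₀ : P)
    (U : L2Time T (WithLp 2 (V × P))) : Prop :=
  ∀ φ : ℝ → ℝ, IsTimeTest T φ → ∀ w : WithLp 2 (V × P),
    -(∫ t, inner ℝ (pivot val P ρ₀ α (U t)) (pivot val P ρ₀ α w) * deriv φ t ∂timeMeasure T)
      - inner ℝ (initialDatum ρ₀ α u₀ p₀) (pivot val P ρ₀ α w) * φ 0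
    = ∫ t, inner ℝ ((systemSource ρ₀ σ S - systemOp val div Φ μ η α U) t) w * φ t ∂timeMeasure T

/-- The dissipation does not control `p`, but the energy contains `α/ρ₀ ‖p‖²`. Adding one copy of
the energy gives full coercivity with constant `min μ (α/ρ₀)`. This constant degenerates as `α →
0⁺`, but it serves only existence and enters no estimate. -/
theorem exists_isSystemSolution (hT : 0 < T) (hρ₀ : 0 < ρ₀) (hμ : 0 < μ) (hη : 0 ≤ η) (hα : 0 < α)
    (hM : 0 ≤ M) (hΦ : ∀ p, ∀ᵐ t ∂timeMeasure T, ‖Φ p t‖ ≤ M * ‖p t‖)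
    (σ : L2Time T P) (S : L2Time T V) (u₀ : H) (p₀ : P) :
    ∃ U, IsSystemSolution val div Φ ρ₀ μ η α σ S u₀ p₀ U := by
  have hc : 0 < min μ (α / ρ₀) := lt_min hμ (by positivity)
  refine exists_evolution_solution hT (pivot val P ρ₀ α) (systemOp val div Φ μ η α)
    (l := 1 + √α * M) (by positivity) hc (fun U => ?_) _ _
  filter_upwards [ae_systemOp_coercive (val := val) (div := div) (μ := μ) hρ₀ hη hα hM hΦ U]
    with t ht
  have h1 : ‖pivot val P ρ₀ α (U t)‖ ^ 2 = ρ₀ * ‖val (U t).fst‖ ^ 2 + α / ρ₀ * ‖(U t).snd‖ ^ 2 := by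
    rw [pivot_apply, norm_sq_initialDatum hρ₀ hα]
  rw [WithLp.prod_norm_sq_eq_of_L2]
  have h2 : min μ (α / ρ₀) * ‖(U t).fst‖ ^ 2 ≤ μ * ‖(U t).fst‖ ^ 2 := by
    gcongr
    exact min_le_left _ _
  have h3 : min μ (α / ρ₀) * ‖(U t).snd‖ ^ 2 ≤ α / ρ₀ * ‖(U t).snd‖ ^ 2 := by
    gcongr
    exact min_le_right _ _
  have h4 : 0 ≤ ρ₀ * ‖val (U t).fst‖ ^ 2 := by positivity
  have h5 : 0 ≤ √α * M * ‖pivot val P ρ₀ α (U t)‖ ^ 2 := by positivity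
  nlinarith

theorem integrable_norm_sq {X : Type} [NormedAddCommGroup X] (U : L2Time T X) :
    Integrable (fun t => ‖U t‖ ^ 2) (timeMeasure T) :=
  (memLp_two_iff_integrable_sq_norm (Lp.aestronglyMeasurable U)).1 (Lp.memLp U)

theorem integral_norm_sq {X : Type} [NormedAddCommGroup X] [InnerProductSpace ℝ X]
    (U : L2Time T X) : ∫ t, ‖U t‖ ^ 2 ∂timeMeasure T = ‖U‖ ^ 2 := by
  rw [← real_inner_self_eq_norm_sq, L2.inner_def]
  simp only [real_inner_self_eq_norm_sq]

/-- The energy estimate for weak solutions of the system. -/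
theorem IsSystemSolution.energy (hT : 0 < T) (hρ₀ : 0 < ρ₀) (hμ : 0 < μ) (hη : 0 ≤ η) (hα : 0 < α)
    (hM : 0 ≤ M) (hΦ : ∀ p, ∀ᵐ t ∂timeMeasure T, ‖Φ p t‖ ≤ M * ‖p t‖)
    {σ : L2Time T P} {S : L2Time T V} {u₀ : H} {p₀ : P} {U : L2Time T (WithLp 2 (V × P))}
    (hU : IsSystemSolution val div Φ ρ₀ μ η α σ S u₀ p₀ U) :
    (∀ᵐ t ∂timeMeasure T, ρ₀ * ‖val (U t).fst‖ ^ 2 + α / ρ₀ * ‖(U t).snd‖ ^ 2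
      ≤ (ρ₀ * ‖u₀‖ ^ 2 + α / ρ₀ * ‖p₀‖ ^ 2 + (μ⁻¹ * ‖S‖ ^ 2 + (α * ρ₀)⁻¹ * ‖σ‖ ^ 2))
        * Real.exp ((1 + √α * M) * T)) ∧
    μ * ‖timeLift T (WithLp.fstL 2 ℝ V P) U‖ ^ 2
      ≤ (ρ₀ * ‖u₀‖ ^ 2 + α / ρ₀ * ‖p₀‖ ^ 2 + (μ⁻¹ * ‖S‖ ^ 2 + (α * ρ₀)⁻¹ * ‖σ‖ ^ 2))
        * Real.exp ((1 + √α * M) * T) := by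
  set u := timeLift T (WithLp.fstL 2 ℝ V P) U with hu
  set F := systemSource ρ₀ σ S with hF
  set A := systemOp val div Φ μ η α U with hA
  have hJ : ∀ t, ‖pivot val P ρ₀ α (U t)‖ ^ 2
      = ρ₀ * ‖val (U t).fst‖ ^ 2 + α / ρ₀ * ‖(U t).snd‖ ^ 2 := fun t => by
    rw [pivot_apply, norm_sq_initialDatum hρ₀ hα]
  have hut : ∀ᵐ t ∂timeMeasure T, u t = (U t).fst := ae_timeLift (WithLp.fstL 2 ℝ V P) U
  have hpw : ∀ᵐ t ∂timeMeasure T, 2 * inner ℝ ((F - A) t) (U t) + μ * ‖u t‖ ^ 2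
      ≤ (μ⁻¹ * ‖S t‖ ^ 2 + (α * ρ₀)⁻¹ * ‖σ t‖ ^ 2)
        + (1 + √α * M) * ‖pivot val P ρ₀ α (U t)‖ ^ 2 := by
    filter_upwards [ae_systemOp_coercive (val := val) (div := div) (μ := μ) hρ₀ hη hα hM hΦ U,
      ae_inner_systemSource ρ₀ σ S, Lp.coeFn_sub F A, hut] with t h1 h2 h3 h4
    rw [h3, Pi.sub_apply, inner_sub_left, h2, h4]
    have k1 := real_inner_le_norm (S t) (U t).fst
    have k2 := real_inner_le_norm (σ t) (U t).snd
    -- The source `S` consumes half of the available dissipation `2 μ ‖u‖²`. The `σ` term below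
    -- costs one copy of the pressure energy, which is the `1` in `1 + √α * M`.
    have k3 : 2 * (‖S t‖ * ‖(U t).fst‖) ≤ μ⁻¹ * ‖S t‖ ^ 2 + μ * ‖(U t).fst‖ ^ 2 := by
      have : μ⁻¹ * ‖S t‖ ^ 2 + μ * ‖(U t).fst‖ ^ 2 - 2 * (‖S t‖ * ‖(U t).fst‖)
          = (‖S t‖ - μ * ‖(U t).fst‖) ^ 2 / μ := by
        field_simp
        ring
      have h0 : 0 ≤ (‖S t‖ - μ * ‖(U t).fst‖) ^ 2 / μ := by positivity
      linarith
    have k4 : 2 * (ρ₀⁻¹ * (‖σ t‖ * ‖(U t).snd‖))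
        ≤ (α * ρ₀)⁻¹ * ‖σ t‖ ^ 2 + α / ρ₀ * ‖(U t).snd‖ ^ 2 := by
      have : (α * ρ₀)⁻¹ * ‖σ t‖ ^ 2 + α / ρ₀ * ‖(U t).snd‖ ^ 2
          - 2 * (ρ₀⁻¹ * (‖σ t‖ * ‖(U t).snd‖)) = (‖σ t‖ - α * ‖(U t).snd‖) ^ 2 / (α * ρ₀) := by
        field_simp
        ring
      have h0 : 0 ≤ (‖σ t‖ - α * ‖(U t).snd‖) ^ 2 / (α * ρ₀) := by positivity
      linarith
    have k5 := mul_le_mul_of_nonneg_left k2 (inv_pos.2 hρ₀).le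
    have k6 := hJ t
    have k7 : 0 ≤ ρ₀ * ‖val (U t).fst‖ ^ 2 := by positivity
    linarith
  have hE : Integrable (fun t => ‖pivot val P ρ₀ α (U t)‖ ^ 2) (timeMeasure T) :=
    (memLp_two_iff_integrable_sq_norm
      ((pivot val P ρ₀ α).continuous.comp_aestronglyMeasurable (Lp.aestronglyMeasurable U))).1
      ((pivot val P ρ₀ α).comp_memLp' (Lp.memLp U))
  have hv : Integrable (fun t => μ * ‖u t‖ ^ 2) (timeMeasure T) := (integrable_norm_sq u).const_mul μ
  have hb1 := (integrable_norm_sq S).const_mul μ⁻¹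
  have hb2 := (integrable_norm_sq σ).const_mul (α * ρ₀)⁻¹
  have hG : Integrable (fun t => inner ℝ ((F - A) t) (U t)) (timeMeasure T) :=
    L2.integrable_inner (F - A) U
  have key := energy_gronwall hT (e₀ := ‖initialDatum ρ₀ α u₀ p₀‖ ^ 2) (l := 1 + √α * M)
    (by positivity) (by positivity) hE hv (hb1.add hb2) (fun t => by positivity)
    (fun t => by positivity) (fun t => by simp only [Pi.add_apply]; positivity) (by
      filter_upwards [ae_energy_le_of_weak hT hU, ae_restrict_mem measurableSet_Ioo] with τ h1 hτ
      have hsub : Ioc 0 τ ⊆ Ioo 0 T := fun t ht => ⟨ht.1, ht.2.trans_lt hτ.2⟩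
      have hle : volume.restrict (Ioc 0 τ) ≤ timeMeasure T := Measure.restrict_mono hsub le_rfl
      have h2 : ∫ t in Ioc 0 τ, (2 * inner ℝ ((F - A) t) (U t) + μ * ‖u t‖ ^ 2)
          ≤ ∫ t in Ioc 0 τ, ((μ⁻¹ * ‖S t‖ ^ 2 + (α * ρ₀)⁻¹ * ‖σ t‖ ^ 2)
            + (1 + √α * M) * ‖pivot val P ρ₀ α (U t)‖ ^ 2) :=
        integral_mono_ae (((hG.const_mul 2).add hv).mono_measure hle)
          (((hb1.add hb2).add (hE.const_mul _)).mono_measure hle) (ae_mono hle hpw)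
      rw [integral_add ((hG.const_mul 2).mono_measure hle) (hv.mono_measure hle),
        integral_const_mul] at h2
      simp only [Pi.add_apply]
      linarith)
  have hbint : ∫ t, ((fun t => μ⁻¹ * ‖S t‖ ^ 2) + fun t => (α * ρ₀)⁻¹ * ‖σ t‖ ^ 2) t ∂timeMeasure T
      = μ⁻¹ * ‖S‖ ^ 2 + (α * ρ₀)⁻¹ * ‖σ‖ ^ 2 := by
    rw [← integral_norm_sq S, ← integral_norm_sq σ, ← integral_const_mul, ← integral_const_mul]
    exact integral_add hb1 hb2
  rw [hbint, norm_sq_initialDatum hρ₀ hα, integral_const_mul, integral_norm_sq] at key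
  simp only [hJ] at key
  exact key

theorem IsSystemSolution.sub {σ : L2Time T P} {S : L2Time T V} {u₀ : H} {p₀ : P}
    {U U' : L2Time T (WithLp 2 (V × P))}
    (hU : IsSystemSolution val div Φ ρ₀ μ η α σ S u₀ p₀ U)
    (hU' : IsSystemSolution val div Φ ρ₀ μ η α σ S u₀ p₀ U') :
    IsSystemSolution val div Φ ρ₀ μ η α 0 0 0 0 (U - U') := by
  intro φ hφ w
  set j := pivot val P ρ₀ α
  have hφ' : Continuous (deriv φ) := hφ.1.continuous_deriv (by simp)
  have e0 : initialDatum ρ₀ α (0 : H) (0 : P) = 0 := by simp [initialDatum]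
  have e1 : systemSource ρ₀ 0 0 - systemOp val div Φ μ η α (U - U')
      = (systemSource ρ₀ σ S - systemOp val div Φ μ η α U)
        - (systemSource ρ₀ σ S - systemOp val div Φ μ η α U') := by
    rw [map_sub]
    simp [systemSource]
  have i1 : ∀ X : L2Time T (WithLp 2 (V × P)),
      Integrable (fun t => inner ℝ (j (X t)) (j w) * deriv φ t) (timeMeasure T) := fun X => by
    have := integrable_apply_mul ((innerSL ℝ (j w)).comp j) X hφ'
    simpa only [ContinuousLinearMap.comp_apply, innerSL_apply_apply, real_inner_comm] using this
  have i2 : ∀ X : L2Time T (WithLp 2 (V × P)),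
      Integrable (fun t => inner ℝ (X t) w * φ t) (timeMeasure T) := fun X => by
    have := integrable_apply_mul (innerSL ℝ w) X hφ.1.continuous
    simpa only [innerSL_apply_apply, real_inner_comm] using this
  have e2 : ∫ t, inner ℝ (j ((U - U') t)) (j w) * deriv φ t ∂timeMeasure T
      = ∫ t, inner ℝ (j (U t)) (j w) * deriv φ t ∂timeMeasure T
        - ∫ t, inner ℝ (j (U' t)) (j w) * deriv φ t ∂timeMeasure T := by
    rw [← integral_sub (i1 U) (i1 U')]
    refine integral_congr_ae ?_
    filter_upwards [Lp.coeFn_sub U U'] with t ht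
    rw [ht, Pi.sub_apply, map_sub, inner_sub_left, sub_mul]
  have e3 : ∀ X Y : L2Time T (WithLp 2 (V × P)),
      ∫ t, inner ℝ ((X - Y) t) w * φ t ∂timeMeasure T
      = ∫ t, inner ℝ (X t) w * φ t ∂timeMeasure T
        - ∫ t, inner ℝ (Y t) w * φ t ∂timeMeasure T := by
    intro X Y
    rw [← integral_sub (i2 X) (i2 Y)]
    refine integral_congr_ae ?_
    filter_upwards [Lp.coeFn_sub X Y] with t ht
    rw [ht, Pi.sub_apply, inner_sub_left, sub_mul]
  have h1 := hU φ hφ w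
  have h2 := hU' φ hφ w
  rw [e0, e1, e2, e3, inner_zero_left]
  linarith

/-- The difference of two solutions has zero data, hence zero dissipation and zero energy: the
former kills `u`, the latter `p`. -/
theorem IsSystemSolution.unique (hT : 0 < T) (hρ₀ : 0 < ρ₀) (hμ : 0 < μ) (hη : 0 ≤ η) (hα : 0 < α)
    (hM : 0 ≤ M) (hΦ : ∀ p, ∀ᵐ t ∂timeMeasure T, ‖Φ p t‖ ≤ M * ‖p t‖)
    {σ : L2Time T P} {S : L2Time T V} {u₀ : H} {p₀ : P} {U U' : L2Time T (WithLp 2 (V × P))}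
    (hU : IsSystemSolution val div Φ ρ₀ μ η α σ S u₀ p₀ U)
    (hU' : IsSystemSolution val div Φ ρ₀ μ η α σ S u₀ p₀ U') : U = U' := by
  obtain ⟨h1, h2⟩ := (hU.sub hU').energy hT hρ₀ hμ hη hα hM hΦ
  simp only [norm_zero, ne_eq, OfNat.ofNat_ne_zero, not_false_eq_true, zero_pow, mul_zero,
    add_zero, zero_mul] at h1 h2
  have h3 : timeLift T (WithLp.fstL 2 ℝ V P) (U - U') = 0 := by
    have : ‖timeLift T (WithLp.fstL 2 ℝ V P) (U - U')‖ ^ 2 ≤ 0 := by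
      by_contra h
      exact absurd h2 (not_le.2 (mul_pos hμ (not_le.1 h)))
    exact norm_eq_zero.1 (pow_eq_zero_iff two_ne_zero |>.1 (le_antisymm this (sq_nonneg _)))
  have h4 : timeLift T (WithLp.fstL 2 ℝ V P) (U - U') =ᵐ[timeMeasure T] 0 := by
    rw [h3]
    exact Lp.coeFn_zero _ _ _
  rw [← sub_eq_zero]
  refine (Lp.eq_zero_iff_ae_eq_zero).2 ?_
  filter_upwards [h1, h4, ae_timeLift (WithLp.fstL 2 ℝ V P) (U - U')] with t k1 k2 k3
  rw [k2] at k3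
  have k4 : ((U - U') t).fst = 0 := k3.symm
  have k5 : ((U - U') t).snd = 0 := by
    rw [k4, map_zero, norm_zero] at k1
    by_contra h
    have : 0 < α / ρ₀ * ‖((U - U') t).snd‖ ^ 2 :=
      mul_pos (by positivity) (pow_pos (norm_pos_iff.2 h) 2)
    linarith
  have : ‖(U - U') t‖ ^ 2 = 0 := by
    rw [WithLp.prod_norm_sq_eq_of_L2, k4, k5]
    simp
  exact norm_eq_zero.1 (pow_eq_zero_iff two_ne_zero |>.1 this)

end System

/-! ### Completeness of the spaces and the mean of a divergence -/

section Spaces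

variable {d : ℕ} {D : BoundedDomain d}

/-- The norm sees only gradients, but Poincaré's inequality makes the functions Cauchy as well, and
the closed graph contains the limit pair. -/
instance (D : BoundedDomain d) : CompleteSpace (H01 D) := by
  refine Metric.complete_of_cauchySeq_tendsto fun w hw => ?_
  have h1 : CauchySeq fun n => H01.val D (w n) := (H01.val D).uniformContinuous.comp_cauchySeq hw
  have h2 : CauchySeq fun n => H01.grad D (w n) := (H01.grad D).uniformContinuous.comp_cauchySeq hw
  obtain ⟨a, ha⟩ := cauchySeq_tendsto_of_complete h1
  obtain ⟨b, hb⟩ := cauchySeq_tendsto_of_complete h2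
  have hmem : (a, b) ∈ (testGraph D).topologicalClosure :=
    (testGraph D).isClosed_topologicalClosure.mem_of_tendsto (ha.prodMk_nhds hb)
      (Eventually.of_forall fun n => (w n).2)
  obtain ⟨u, hu⟩ : ∃ u : H01 D, H01.grad D u = b :=
    ⟨(⟨(a, b), hmem⟩ : (testGraph D).topologicalClosure), rfl⟩
  refine ⟨u, tendsto_iff_norm_sub_tendsto_zero.2 ?_⟩
  rw [← hu] at hb
  refine (tendsto_iff_norm_sub_tendsto_zero.1 hb).congr fun n => ?_
  rw [← map_sub]
  rfl

/-- Each `∂ᵢ φᵢ` is integrated by parts against the constant `1`. -/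
theorem integral_trace_jacobian_eq_zero {φ : Space d → Space d} (hφ : ContDiff ℝ ∞ φ)
    (hc : HasCompactSupport φ) : ∫ x, traceCLM d (jacobian φ x) = 0 := by
  have hd : Differentiable ℝ φ := hφ.differentiable (by simp)
  have hcont : Continuous (jacobian φ) := continuous_jacobian hφ
  have hcs : ∀ h : Space d → ℝ, (∀ x, x ∉ tsupport φ → h x = 0) → Continuous h →
      Integrable h := fun h h0 hcont =>
    hcont.integrable_of_hasCompactSupport (HasCompactSupport.intro hc h0)
  have hcomp : ∀ (i : Fin d) x, HasFDerivAt (fun x => φ x i)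
      ((EuclideanSpace.proj (𝕜 := ℝ) i : Space d →L[ℝ] ℝ).comp (fderiv ℝ φ x)) x := fun i x => by
    have h : HasFDerivAt (fun x : Space d => x i) (EuclideanSpace.proj (𝕜 := ℝ) i) (φ x) :=
      (EuclideanSpace.proj (𝕜 := ℝ) i : Space d →L[ℝ] ℝ).hasFDerivAt
    exact h.comp x (hd x).hasFDerivAt
  have hpart : ∀ (i : Fin d) x, fderiv ℝ (fun x => φ x i) x (EuclideanSpace.single i 1)
      = jacobian φ x (i, i) := by
    intro i x
    rw [(hcomp i x).fderiv]
    rfl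
  have hint : ∀ i : Fin d, Integrable fun x => jacobian φ x (i, i) := fun i =>
    hcs _ (fun x hx => by simp [jacobian_eq_zero hx])
      ((EuclideanSpace.proj (𝕜 := ℝ) (i, i) : Mat d →L[ℝ] ℝ).continuous.comp hcont)
  have hzero : ∀ i : Fin d, ∫ x, jacobian φ x (i, i) = 0 := by
    intro i
    have key := integral_mul_fderiv_eq_neg_fderiv_mul_of_integrable
      (μ := (volume : Measure (Space d))) (f := fun _ => (1 : ℝ)) (g := fun x => φ x i)
      (v := EuclideanSpace.single i 1) (by simp) (by simpa only [hpart, one_mul] using hint i)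
      (by
        simp only [one_mul]
        exact hcs _ (fun x hx => by simp [image_eq_zero_of_notMem_tsupport hx])
          ((EuclideanSpace.proj (𝕜 := ℝ) i : Space d →L[ℝ] ℝ).continuous.comp hφ.continuous))
      (fun x _ => differentiableAt_const _) (fun x _ => (hcomp i x).differentiableAt)
    simpa [hpart] using key
  have ht : ∀ x, traceCLM d (jacobian φ x) = ∑ i, jacobian φ x (i, i) := fun x => by
    simp [traceCLM]
  simp only [ht]
  rw [integral_finsetSum _ fun i _ => hint i]
  simp [hzero]

/-- The integral over `D`, as a functional on `L²(D)`. -/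
def meanL (D : BoundedDomain d) : L2 D ℝ →L[ℝ] ℝ := innerSL ℝ (Lp.const 2 D.measure (1 : ℝ))

theorem meanL_apply (r : L2 D ℝ) : meanL D r = ∫ x, r x ∂D.measure := by
  change inner ℝ (Lp.const 2 D.measure (1 : ℝ)) r = _
  rw [L2.inner_def]
  refine integral_congr_ae ?_
  filter_upwards [Lp.coeFn_const 2 D.measure (1 : ℝ)] with x hx
  rw [hx]
  simp

theorem mem_L2Hat_iff {r : L2 D ℝ} : r ∈ L2Hat D ↔ meanL D r = 0 := by
  rw [meanL_apply]
  rfl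

theorem isClosed_L2Hat (D : BoundedDomain d) : IsClosed (L2Hat D : Set (L2 D ℝ)) := by
  have : (L2Hat D : Set (L2 D ℝ)) = {r | meanL D r = 0} := Set.ext fun r => mem_L2Hat_iff
  rw [this]
  exact isClosed_eq (meanL D).continuous continuous_const

instance (D : BoundedDomain d) : CompleteSpace (L2Hat D) :=
  (isClosed_L2Hat D).completeSpace_coe

/-- Divergences of fields vanishing on the boundary have zero mean. -/
theorem meanL_div (u : H01 D) : meanL D (H01.div D u) = 0 := by
  set ℓ : L2 D (Space d) × L2 D (Mat d) →L[ℝ] ℝ :=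
    (meanL D ∘L (traceCLM d).compLpL 2 D.measure) ∘L
      ContinuousLinearMap.snd ℝ (L2 D (Space d)) (L2 D (Mat d))
  have hcl : IsClosed {w : L2 D (Space d) × L2 D (Mat d) | ℓ w = 0} :=
    isClosed_eq ℓ.continuous continuous_const
  refine closure_minimal (s := (testGraph D : Set (L2 D (Space d) × L2 D (Mat d)))) ?_ hcl u.2
  rintro w ⟨φ, ⟨h1, h2, h3⟩, -, h5⟩
  change meanL D ((traceCLM d).compLpL 2 D.measure w.2) = 0
  rw [meanL_apply, ← integral_trace_jacobian_eq_zero h1 h2,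
    ← setIntegral_eq_integral_of_forall_compl_eq_zero (s := D.carrier)
      (f := fun x => traceCLM d (jacobian φ x))
      (fun x hx => by rw [jacobian_eq_zero fun h => hx (h3 h), map_zero])]
  refine integral_congr_ae ?_
  filter_upwards [(traceCLM d).coeFn_compLpL (p := 2) (μ := D.measure) w.2, h5] with x k1 k2
  rw [k1, k2]

end Spaces

/-! ### Weak time derivatives tested by functionals -/

section WeakTimeDeriv

variable {X : Type} [NormedAddCommGroup X] [NormedSpace ℝ X] [CompleteSpace X] {T : ℝ}

/-- A separating family of bounded functionals commutes with the Bochner integrals, so the vector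
identity reduces to scalar ones. Test functions supported in `(0, T)` vanish at `0`, which removes
the initial terms of the weak equations. -/
theorem hasWeakTimeDeriv_of_separating {ι : Type*} (ℓ : ι → X →L[ℝ] ℝ)
    (hℓ : ∀ x y, (∀ i, ℓ i x = ℓ i y) → x = y) {f g : ℝ → X} (hf : MemLp f 2 (timeMeasure T))
    (hg : MemLp g 2 (timeMeasure T))
    (h : ∀ φ : ℝ → ℝ, IsTimeTest T φ → φ 0 = 0 → ∀ i,
      ∫ t, ℓ i (f t) * deriv φ t ∂timeMeasure T = -∫ t, ℓ i (g t) * φ t ∂timeMeasure T) :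
    HasWeakTimeDeriv T f g := by
  intro φ h1 h2 h3
  have hφ : IsTimeTest T φ := ⟨h1, h2, h3.trans Ioo_subset_Iio_self⟩
  have h0 : φ 0 = 0 := image_eq_zero_of_notMem_tsupport fun h => lt_irrefl (0 : ℝ) (h3 h).1
  refine hℓ _ _ fun i => ?_
  rw [map_neg, ← (ℓ i).integral_comp_comm (integrable_smul_of_memLp hf
      (h1.continuous_deriv (by simp))),
    ← (ℓ i).integral_comp_comm (integrable_smul_of_memLp hg h1.continuous)]
  simpa only [map_smul, smul_eq_mul, mul_comm] using h φ hφ h0 i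

end WeakTimeDeriv

/-! ### Equivalence of the two equations and the system -/

section WeakForm

theorem integrable_inner_apply_mul {T : ℝ} {X Y : Type} [NormedAddCommGroup X] [NormedSpace ℝ X]
    [NormedAddCommGroup Y] [InnerProductSpace ℝ Y] (L : X →L[ℝ] Y) (U : L2Time T X) (y : Y)
    {φ : ℝ → ℝ} (hφ : Continuous φ) :
    Integrable (fun t => inner ℝ (L (U t)) y * φ t) (timeMeasure T) :=
  (integrable_apply_mul ((innerSL ℝ y).comp L) U hφ).congr
    (Eventually.of_forall fun t => congrArg (· * φ t) (real_inner_comm (L (U t)) y))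

theorem integrable_inner_mul {T : ℝ} {X : Type} [NormedAddCommGroup X] [InnerProductSpace ℝ X]
    (U : L2Time T X) (y : X) {φ : ℝ → ℝ} (hφ : Continuous φ) :
    Integrable (fun t => inner ℝ (U t) y * φ t) (timeMeasure T) :=
  integrable_inner_apply_mul (ContinuousLinearMap.id ℝ X) U y hφ

variable {V P H : Type} [NormedAddCommGroup V] [InnerProductSpace ℝ V]
  [NormedAddCommGroup P] [InnerProductSpace ℝ P] [NormedAddCommGroup H] [InnerProductSpace ℝ H]
  {T ρ₀ μ η α : ℝ} {val : V →L[ℝ] H} {div : V →L[ℝ] P} {Φ : L2Time T P →L[ℝ] L2Time T H}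

/-- The residual of the weak form of the continuity equation. -/
def continuityResidual (T : ℝ) (div : V →L[ℝ] P) (ρ₀ α : ℝ) (σ : L2Time T P) (p₀ : P)
    (u : L2Time T V) (p : L2Time T P) (φ : ℝ → ℝ) (r : P) : ℝ :=
  -(∫ t, inner ℝ (α • p t) r * deriv φ t ∂timeMeasure T) - inner ℝ (α • p₀) r * φ 0
      + ∫ t, inner ℝ (ρ₀ • div (u t)) r * φ t ∂timeMeasure T
    - ∫ t, inner ℝ (σ t) r * φ t ∂timeMeasure T

/-- The residual of the weak form of the momentum equation. -/
def momentumResidual (T : ℝ) (val : V →L[ℝ] H) (div : V →L[ℝ] P) (ρ₀ μ η : ℝ)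
    (g s : ℝ → V → ℝ) (u₀ : H) (u : L2Time T V) (p : L2Time T P) (φ : ℝ → ℝ) (v : V) : ℝ :=
  -(∫ t, ρ₀ * inner ℝ (val (u t)) (val v) * deriv φ t ∂timeMeasure T)
      - ρ₀ * inner ℝ u₀ (val v) * φ 0
      - ∫ t, inner ℝ (p t) (div v) * φ t ∂timeMeasure T
    - (-(μ * ∫ t, inner ℝ (u t) v * φ t ∂timeMeasure T)
      - η * ∫ t, inner ℝ (div (u t)) (div v) * φ t ∂timeMeasure T
      + ∫ t, g t v * φ t ∂timeMeasure T + ∫ t, s t v * φ t ∂timeMeasure T)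

variable {u₀ : H} {p₀ : P} {σ : L2Time T P} {S : L2Time T V} {g s : ℝ → V → ℝ}
  {U : L2Time T (WithLp 2 (V × P))} {u : L2Time T V} {p : L2Time T P}

theorem ae_fst_eq (hu : timeLift T (WithLp.fstL 2 ℝ V P) U = u) :
    ∀ᵐ t ∂timeMeasure T, u t = (U t).fst := by
  rw [← hu]
  exact ae_timeLift (WithLp.fstL 2 ℝ V P) U

theorem ae_snd_eq (hp : timeLift T (WithLp.sndL 2 ℝ V P) U = p) :
    ∀ᵐ t ∂timeMeasure T, p t = (U t).snd := by
  rw [← hp]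
  exact ae_timeLift (WithLp.sndL 2 ℝ V P) U

theorem integral_pivot (hρ₀ : 0 < ρ₀) (hα : 0 < α)
    (hu : timeLift T (WithLp.fstL 2 ℝ V P) U = u) (hp : timeLift T (WithLp.sndL 2 ℝ V P) U = p)
    {φ : ℝ → ℝ} (hφ : Continuous φ) (w : WithLp 2 (V × P)) :
    ∫ t, inner ℝ (pivot val P ρ₀ α (U t)) (pivot val P ρ₀ α w) * φ t ∂timeMeasure T
      = ∫ t, ρ₀ * inner ℝ (val (u t)) (val w.fst) * φ t ∂timeMeasure T
        + ρ₀⁻¹ * ∫ t, inner ℝ (α • p t) w.snd * φ t ∂timeMeasure T := by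
  have i1 := (integrable_inner_apply_mul val u (val w.fst) hφ).const_mul ρ₀
  have i2 := (integrable_inner_apply_mul (α • ContinuousLinearMap.id ℝ P) p w.snd hφ).const_mul ρ₀⁻¹
  simp only [smul_apply, ContinuousLinearMap.id_apply] at i2
  simp only [mul_assoc ρ₀]
  rw [← integral_const_mul ρ₀⁻¹, ← integral_add i1 i2]
  refine integral_congr_ae ?_
  filter_upwards [ae_fst_eq hu, ae_snd_eq hp] with t h1 h2
  rw [pivot_apply, pivot_apply, inner_initialDatum hρ₀ hα, h1, h2, real_inner_smul_left]
  ring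

variable [CompleteSpace V] [CompleteSpace P] [CompleteSpace H]

theorem integral_source_sub_systemOp (hρ₀ : 0 < ρ₀)
    (hu : timeLift T (WithLp.fstL 2 ℝ V P) U = u) (hp : timeLift T (WithLp.sndL 2 ℝ V P) U = p)
    (hg : ∀ᵐ t ∂timeMeasure T, ∀ v, g t v = α * inner ℝ (Φ p t) (val v))
    (hs : ∀ᵐ t ∂timeMeasure T, ∀ v, inner ℝ (S t) v = s t v) {φ : ℝ → ℝ} (hφ : Continuous φ)
    (w : WithLp 2 (V × P)) :
    ∫ t, inner ℝ ((systemSource ρ₀ σ S - systemOp val div Φ μ η α U) t) w * φ t ∂timeMeasure T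
      = ∫ t, s t w.fst * φ t ∂timeMeasure T
        + ∫ t, inner ℝ (p t) (div w.fst) * φ t ∂timeMeasure T
        + ∫ t, g t w.fst * φ t ∂timeMeasure T
        - μ * ∫ t, inner ℝ (u t) w.fst * φ t ∂timeMeasure T
        - η * ∫ t, inner ℝ (div (u t)) (div w.fst) * φ t ∂timeMeasure T
        + ρ₀⁻¹ * ∫ t, inner ℝ (σ t) w.snd * φ t ∂timeMeasure T
        - ρ₀⁻¹ * ∫ t, inner ℝ (ρ₀ • div (u t)) w.snd * φ t ∂timeMeasure T := by
  have i1 : Integrable (fun t => s t w.fst * φ t) (timeMeasure T) :=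
    (integrable_inner_mul S w.fst hφ).congr (hs.mono fun t ht => by simp only [ht])
  have i2 := integrable_inner_mul p (div w.fst) hφ
  have i3 : Integrable (fun t => g t w.fst * φ t) (timeMeasure T) :=
    ((integrable_inner_mul (Φ p) (val w.fst) hφ).const_mul α).congr
      (hg.mono fun t ht => by simp only [ht, mul_assoc])
  have i4 := (integrable_inner_mul u w.fst hφ).const_mul μ
  have i5 := (integrable_inner_apply_mul div u (div w.fst) hφ).const_mul η
  have i6 := (integrable_inner_mul σ w.snd hφ).const_mul ρ₀⁻¹
  have i7 := (integrable_inner_apply_mul (ρ₀ • div) u w.snd hφ).const_mul ρ₀⁻¹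
  simp only [smul_apply] at i7
  simp only [← integral_const_mul]
  rw [← integral_add' i1 i2, ← integral_add' (i1.add i2) i3, ← integral_sub' ((i1.add i2).add i3) i4,
    ← integral_sub' (((i1.add i2).add i3).sub i4) i5,
    ← integral_add' ((((i1.add i2).add i3).sub i4).sub i5) i6,
    ← integral_sub' (((((i1.add i2).add i3).sub i4).sub i5).add i6) i7]
  refine integral_congr_ae ?_
  filter_upwards [ae_fst_eq hu, ae_snd_eq hp, hg, hs, ae_inner_systemSource ρ₀ σ S,
    ae_inner_systemOp val div Φ μ η α U, ae_inner_momentumOp val div Φ μ η α U,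
    Lp.coeFn_sub (systemSource ρ₀ σ S) (systemOp val div Φ μ η α U)] with t h1 h2 h3 h4 h5 h6 h7 h8
  simp only [Pi.add_apply, Pi.sub_apply]
  rw [h8, Pi.sub_apply, inner_sub_left, h5, h6, h7, h4, h3, h1, h2, hp, real_inner_smul_left]
  field_simp
  ring

/-- The residual of the system at `w` is the momentum residual at `w.fst` plus `ρ₀⁻¹` times the
continuity residual at `w.snd`. The test vectors `(v, 0)` and `(0, r)` separate the two. -/
theorem isSystemSolution_iff (hρ₀ : 0 < ρ₀) (hα : 0 < α)
    (hu : timeLift T (WithLp.fstL 2 ℝ V P) U = u) (hp : timeLift T (WithLp.sndL 2 ℝ V P) U = p)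
    (hg : ∀ᵐ t ∂timeMeasure T, ∀ v, g t v = α * inner ℝ (Φ p t) (val v))
    (hs : ∀ᵐ t ∂timeMeasure T, ∀ v, inner ℝ (S t) v = s t v) :
    IsSystemSolution val div Φ ρ₀ μ η α σ S u₀ p₀ U ↔
      (∀ φ, IsTimeTest T φ → ∀ r, continuityResidual T div ρ₀ α σ p₀ u p φ r = 0) ∧
      (∀ φ, IsTimeTest T φ → ∀ v, momentumResidual T val div ρ₀ μ η g s u₀ u p φ v = 0) := by
  have key : ∀ φ, IsTimeTest T φ → ∀ w : WithLp 2 (V × P),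
      (-(∫ t, inner ℝ (pivot val P ρ₀ α (U t)) (pivot val P ρ₀ α w) * deriv φ t ∂timeMeasure T)
        - inner ℝ (initialDatum ρ₀ α u₀ p₀) (pivot val P ρ₀ α w) * φ 0)
      - ∫ t, inner ℝ ((systemSource ρ₀ σ S - systemOp val div Φ μ η α U) t) w * φ t
        ∂timeMeasure T
      = momentumResidual T val div ρ₀ μ η g s u₀ u p φ w.fst
        + ρ₀⁻¹ * continuityResidual T div ρ₀ α σ p₀ u p φ w.snd := by
    intro φ hφ w
    have e2 : inner ℝ (initialDatum ρ₀ α u₀ p₀) (pivot val P ρ₀ α w)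
        = ρ₀ * inner ℝ u₀ (val w.fst) + ρ₀⁻¹ * inner ℝ (α • p₀) w.snd := by
      rw [pivot_apply, inner_initialDatum hρ₀ hα, real_inner_smul_left]
      ring
    rw [integral_pivot hρ₀ hα hu hp (hφ.1.continuous_deriv (by simp)) w, e2,
      integral_source_sub_systemOp hρ₀ hu hp hg hs hφ.1.continuous w]
    unfold momentumResidual continuityResidual
    ring
  -- `g` and `s` are arbitrary functions here; that they vanish at `0` follows from their
  -- representation by inner products.
  have hs0 : ∀ᵐ t ∂timeMeasure T, s t 0 = 0 := by
    filter_upwards [hs] with t ht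
    rw [← ht, inner_zero_right]
  have hg0 : ∀ᵐ t ∂timeMeasure T, g t 0 = 0 := by
    filter_upwards [hg] with t ht
    rw [ht, map_zero, inner_zero_right, mul_zero]
  have hm0 : ∀ φ, momentumResidual T val div ρ₀ μ η g s u₀ u p φ 0 = 0 := by
    intro φ
    have e1 : ∫ t, g t 0 * φ t ∂timeMeasure T = 0 :=
      integral_eq_zero_of_ae (hg0.mono fun t ht => by simp [ht])
    have e2 : ∫ t, s t 0 * φ t ∂timeMeasure T = 0 :=
      integral_eq_zero_of_ae (hs0.mono fun t ht => by simp [ht])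
    simp [momentumResidual, e1, e2]
  have hc0 : ∀ φ, continuityResidual T div ρ₀ α σ p₀ u p φ 0 = 0 := by
    intro φ
    simp [continuityResidual]
  constructor
  · intro h
    refine ⟨fun φ hφ r => ?_, fun φ hφ v => ?_⟩
    · have := key φ hφ (inrL V P r)
      rw [h φ hφ, sub_self, inrL_fst, inrL_snd, hm0, zero_add, eq_comm, mul_eq_zero] at this
      exact this.resolve_left (inv_ne_zero hρ₀.ne')
    · have := key φ hφ (inlL V P v)
      rwa [h φ hφ, sub_self, inlL_fst, inlL_snd, hc0, mul_zero, add_zero, eq_comm] at this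
  · rintro ⟨h1, h2⟩ φ hφ w
    rw [← sub_eq_zero, key φ hφ w, h1 φ hφ, h2 φ hφ]
    simp

end WeakForm

/-! ### The time derivative of the velocity in the system -/

section SystemDerivative

variable {V P H : Type} [NormedAddCommGroup V] [InnerProductSpace ℝ V]
  [NormedAddCommGroup P] [InnerProductSpace ℝ P] [NormedAddCommGroup H] [InnerProductSpace ℝ H]
  {T ρ₀ μ η α M : ℝ} {val : V →L[ℝ] H} {div : V →L[ℝ] P} {Φ : L2Time T P →L[ℝ] L2Time T H}
  {u₀ : H} {p₀ : P} {σ : L2Time T P} {S : L2Time T V}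
  {U : L2Time T (WithLp 2 (V × P))} {u : L2Time T V} {p : L2Time T P}

/-- The pair `(u, p)` as a function of time with values in the Hilbert sum. -/
def timePair (u : L2Time T V) (p : L2Time T P) : L2Time T (WithLp 2 (V × P)) :=
  timeLift T (inlL V P) u + timeLift T (inrL V P) p

theorem timeLift_comp {X Y Z : Type} [NormedAddCommGroup X] [NormedSpace ℝ X]
    [NormedAddCommGroup Y] [NormedSpace ℝ Y] [NormedAddCommGroup Z] [NormedSpace ℝ Z]
    (L : Y →L[ℝ] Z) (K : X →L[ℝ] Y) (x : L2Time T X) :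
    timeLift T L (timeLift T K x) = timeLift T (L ∘L K) x := by
  refine Lp.ext ?_
  filter_upwards [ae_timeLift L (timeLift T K x), ae_timeLift K x, ae_timeLift (L ∘L K) x]
    with t h1 h2 h3
  rw [h1, h2, h3, ContinuousLinearMap.comp_apply]

theorem timeLift_id {X : Type} [NormedAddCommGroup X] [NormedSpace ℝ X] (x : L2Time T X) :
    timeLift T (ContinuousLinearMap.id ℝ X) x = x := by
  refine Lp.ext ?_
  filter_upwards [ae_timeLift (ContinuousLinearMap.id ℝ X) x] with t h
  rw [h, ContinuousLinearMap.id_apply]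

theorem timeLift_zero {X Y : Type} [NormedAddCommGroup X] [NormedSpace ℝ X]
    [NormedAddCommGroup Y] [NormedSpace ℝ Y] (x : L2Time T X) :
    timeLift T (0 : X →L[ℝ] Y) x = 0 := by
  refine Lp.ext ?_
  filter_upwards [ae_timeLift (0 : X →L[ℝ] Y) x, Lp.coeFn_zero Y 2 (timeMeasure T)] with t h1 h2
  rw [h1, h2]
  rfl

theorem fst_timePair (u : L2Time T V) (p : L2Time T P) :
    timeLift T (WithLp.fstL 2 ℝ V P) (timePair u p) = u := by
  have h1 : WithLp.fstL 2 ℝ V P ∘L inlL V P = ContinuousLinearMap.id ℝ V := rfl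
  have h2 : WithLp.fstL 2 ℝ V P ∘L inrL V P = 0 := rfl
  rw [timePair, map_add, timeLift_comp, timeLift_comp, h1, h2, timeLift_id, timeLift_zero, add_zero]

theorem snd_timePair (u : L2Time T V) (p : L2Time T P) :
    timeLift T (WithLp.sndL 2 ℝ V P) (timePair u p) = p := by
  have h1 : WithLp.sndL 2 ℝ V P ∘L inlL V P = 0 := rfl
  have h2 : WithLp.sndL 2 ℝ V P ∘L inrL V P = ContinuousLinearMap.id ℝ P := rfl
  rw [timePair, map_add, timeLift_comp, timeLift_comp, h1, h2, timeLift_id, timeLift_zero, zero_add]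

variable [CompleteSpace V] [CompleteSpace P] [CompleteSpace H]

/-- Test vectors `(v, 0)` leave only the momentum equation, which then reads `ρ₀ u_t = S -
momentumOp U` in the dual of `V`. -/
theorem IsSystemSolution.integral_deriv (hρ₀ : 0 < ρ₀) (hα : 0 < α)
    (hU : IsSystemSolution val div Φ ρ₀ μ η α σ S u₀ p₀ U)
    (hu : timeLift T (WithLp.fstL 2 ℝ V P) U = u) (φ : ℝ → ℝ) (hφ : IsTimeTest T φ)
    (h0 : φ 0 = 0) (v : V) :
    ∫ t, inner ℝ (val (u t)) (val v) * deriv φ t ∂timeMeasure T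
      = -∫ t, inner ℝ ((ρ₀⁻¹ • (S - momentumOp val div Φ μ η α U)) t) v * φ t ∂timeMeasure T := by
  have h := hU φ hφ (inlL V P v)
  rw [h0, mul_zero, sub_zero] at h
  have e1 : ∫ t, inner ℝ (pivot val P ρ₀ α (U t)) (pivot val P ρ₀ α (inlL V P v)) * deriv φ t
        ∂timeMeasure T
      = ρ₀ * ∫ t, inner ℝ (val (u t)) (val v) * deriv φ t ∂timeMeasure T := by
    rw [← integral_const_mul]
    refine integral_congr_ae ?_
    filter_upwards [ae_fst_eq hu] with t ht
    rw [pivot_apply, pivot_apply, inner_initialDatum hρ₀ hα, inlL_fst, inlL_snd, ht,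
      inner_zero_right]
    ring
  have e2 : ∫ t, inner ℝ ((systemSource ρ₀ σ S - systemOp val div Φ μ η α U) t) (inlL V P v) * φ t
        ∂timeMeasure T
      = ρ₀ * ∫ t, inner ℝ ((ρ₀⁻¹ • (S - momentumOp val div Φ μ η α U)) t) v * φ t
        ∂timeMeasure T := by
    rw [← integral_const_mul]
    refine integral_congr_ae ?_
    filter_upwards [ae_inner_systemSource (P := P) ρ₀ σ S, ae_inner_systemOp val div Φ μ η α U,
      Lp.coeFn_sub (systemSource ρ₀ σ S) (systemOp val div Φ μ η α U),
      Lp.coeFn_sub S (momentumOp val div Φ μ η α U),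
      Lp.coeFn_smul ρ₀⁻¹ (S - momentumOp val div Φ μ η α U)] with t h1 h2 h3 h4 h5
    rw [h3, h5, Pi.sub_apply, Pi.smul_apply, h4, Pi.sub_apply, inner_sub_left, h1, h2, inlL_fst,
      inlL_snd, real_inner_smul_left, inner_sub_left, inner_zero_right, inner_zero_right]
    field_simp
    ring
  rw [e1, e2] at h
  have h' : ρ₀ * (∫ t, inner ℝ (val (u t)) (val v) * deriv φ t ∂timeMeasure T
      + ∫ t, inner ℝ ((ρ₀⁻¹ • (S - momentumOp val div Φ μ η α U)) t) v * φ t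
        ∂timeMeasure T) = 0 := by linarith
  have := (mul_eq_zero.1 h').resolve_left hρ₀.ne'
  linarith

theorem momentumOp_eq (hu : timeLift T (WithLp.fstL 2 ℝ V P) U = u)
    (hp : timeLift T (WithLp.sndL 2 ℝ V P) U = p) :
    momentumOp val div Φ μ η α U
      = timeLift T (μ • ContinuousLinearMap.id ℝ V + η • (div.adjoint ∘L div)) u
        - timeLift T div.adjoint p - α • timeLift T val.adjoint (Φ p) := by
  set A := μ • ContinuousLinearMap.id ℝ V + η • (div.adjoint ∘L div)
  have h : timeLift T (A ∘L WithLp.fstL 2 ℝ V P - div.adjoint ∘L WithLp.sndL 2 ℝ V P) U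
      = timeLift T A u - timeLift T div.adjoint p := by
    refine Lp.ext ?_
    filter_upwards [ae_timeLift (A ∘L WithLp.fstL 2 ℝ V P - div.adjoint ∘L WithLp.sndL 2 ℝ V P) U,
      Lp.coeFn_sub (timeLift T A u) (timeLift T div.adjoint p), ae_timeLift A u,
      ae_timeLift div.adjoint p, ae_fst_eq hu, ae_snd_eq hp] with t h1 h2 h3 h4 h5 h6
    rw [h1, h2, Pi.sub_apply, h3, h4, h5, h6]
    rfl
  rw [← h, ← hp]
  rfl

/-- The term `‖div‖ * ‖p‖` carries no power of `α`; it is the source of the factor `1/√α` in the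
bound for `u_t`. -/
theorem norm_momentumOp_le (hμ : 0 ≤ μ) (hη : 0 ≤ η) (hα : 0 ≤ α)
    (hΦ : ∀ p, ∀ᵐ t ∂timeMeasure T, ‖Φ p t‖ ≤ M * ‖p t‖)
    (hu : timeLift T (WithLp.fstL 2 ℝ V P) U = u) (hp : timeLift T (WithLp.sndL 2 ℝ V P) U = p) :
    ‖momentumOp val div Φ μ η α U‖
      ≤ (μ + η * ‖div‖ ^ 2) * ‖u‖ + ‖div‖ * ‖p‖ + α * ‖val‖ * M * ‖p‖ := by
  have hL : ∀ {X Y : Type} [NormedAddCommGroup X] [NormedSpace ℝ X] [NormedAddCommGroup Y]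
      [NormedSpace ℝ Y] (L : X →L[ℝ] Y) (x : L2Time T X), ‖timeLift T L x‖ ≤ ‖L‖ * ‖x‖ :=
    fun L x => L.norm_compLp_le x
  have hA : ‖μ • ContinuousLinearMap.id ℝ V + η • (div.adjoint ∘L div)‖ ≤ μ + η * ‖div‖ ^ 2 := by
    refine (norm_add_le _ _).trans (add_le_add ?_ ?_)
    · rw [norm_smul, Real.norm_of_nonneg hμ]
      exact mul_le_of_le_one_right hμ ContinuousLinearMap.norm_id_le
    · rw [norm_smul, Real.norm_of_nonneg hη]
      refine mul_le_mul_of_nonneg_left ((ContinuousLinearMap.opNorm_comp_le _ _).trans ?_) hη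
      rw [LinearIsometryEquiv.norm_map, sq]
  have hv : ‖timeLift T val.adjoint (Φ p)‖ ≤ ‖val‖ * (M * ‖p‖) := by
    refine (hL _ _).trans ?_
    rw [LinearIsometryEquiv.norm_map]
    exact mul_le_mul_of_nonneg_left (Lp.norm_le_mul_norm_of_ae_le_mul (hΦ p)) (norm_nonneg _)
  have hd : ‖timeLift T div.adjoint p‖ ≤ ‖div‖ * ‖p‖ := by
    refine (hL _ _).trans ?_
    rw [LinearIsometryEquiv.norm_map]
  rw [momentumOp_eq hu hp]
  refine (norm_sub_le _ _).trans (add_le_add ((norm_sub_le _ _).trans (add_le_add ?_ hd)) ?_)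
  · exact (hL _ _).trans (mul_le_mul_of_nonneg_right hA (norm_nonneg _))
  · rw [norm_smul, Real.norm_of_nonneg hα, mul_assoc, mul_assoc]
    exact mul_le_mul_of_nonneg_left hv hα

end SystemDerivative

/-! ### The fluid problem as an instance of the system -/

section Bridge

variable {d : ℕ} {D : BoundedDomain d} {T ρ₀ μ η α : ℝ}

/-- The Riesz isomorphism `H₀¹(D)ᵈ → H⁻¹(D)ᵈ`. -/
def rieszL (D : BoundedDomain d) : H01 D ≃ₗᵢ⋆[ℝ] HNeg1 D := InnerProductSpace.toDual ℝ (H01 D)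

theorem rieszL_apply (u v : H01 D) : rieszL D u v = inner ℝ u v := rfl

/-- The Riesz representative of a time-dependent functional. -/
def riesz (s : L2Time T (HNeg1 D)) : L2Time T (H01 D) :=
  (rieszL D).symm.lipschitz.compLp (LinearIsometryEquiv.map_zero _) s

theorem ae_riesz (s : L2Time T (HNeg1 D)) :
    ∀ᵐ t ∂timeMeasure T, riesz s t = (rieszL D).symm (s t) :=
  LipschitzWith.coeFn_compLp (rieszL D).symm.lipschitz (LinearIsometryEquiv.map_zero _) s

theorem ae_inner_riesz (s : L2Time T (HNeg1 D)) :
    ∀ᵐ t ∂timeMeasure T, ∀ v, inner ℝ (riesz s t) v = s t v := by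
  filter_upwards [ae_riesz s] with t ht v
  rw [ht, ← rieszL_apply, LinearIsometryEquiv.apply_symm_apply]

theorem norm_riesz (s : L2Time T (HNeg1 D)) : ‖riesz s‖ = ‖s‖ := by
  refine le_antisymm (Lp.norm_le_norm_of_ae_le ?_) (Lp.norm_le_norm_of_ae_le ?_) <;>
  · filter_upwards [ae_riesz s] with t ht
    rw [ht, LinearIsometryEquiv.norm_map]

/-- The functional represented by a time-dependent element of `H₀¹(D)ᵈ`. -/
def toDualTime (x : L2Time T (H01 D)) : L2Time T (HNeg1 D) :=
  (rieszL D).lipschitz.compLp (LinearIsometryEquiv.map_zero _) x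

theorem ae_toDualTime (x : L2Time T (H01 D)) :
    ∀ᵐ t ∂timeMeasure T, toDualTime x t = rieszL D (x t) :=
  LipschitzWith.coeFn_compLp (rieszL D).lipschitz (LinearIsometryEquiv.map_zero _) x

theorem norm_toDualTime (x : L2Time T (H01 D)) : ‖toDualTime x‖ = ‖x‖ := by
  refine le_antisymm (Lp.norm_le_norm_of_ae_le ?_) (Lp.norm_le_norm_of_ae_le ?_) <;>
  · filter_upwards [ae_toDualTime x] with t ht
    rw [ht, LinearIsometryEquiv.norm_map]

/-- Weak solutions of the fluid problem are the weak solutions of the system for pairs. -/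
theorem isWeakSolution_iff (hρ₀ : 0 < ρ₀) (hα : 0 < α) (f : LInfQT D T) (σ : L2Time T (L2 D ℝ))
    (s : L2Time T (HNeg1 D)) (u₀ : L2 D (Space d)) (p₀ : L2 D ℝ)
    {U : L2Time T (WithLp 2 (H01 D × L2 D ℝ))} {u : L2Time T (H01 D)} {p : L2Time T (L2 D ℝ)}
    (hu : timeLift T (WithLp.fstL 2 ℝ (H01 D) (L2 D ℝ)) U = u)
    (hp : timeLift T (WithLp.sndL 2 ℝ (H01 D) (L2 D ℝ)) U = p) :
    IsWeakSolution D T ρ₀ μ η α f σ s u₀ p₀ u p ↔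
      IsSystemSolution (H01.val D) (H01.div D) (forceOp f) ρ₀ μ η α σ (riesz s) u₀ p₀ U := by
  rw [isSystemSolution_iff hρ₀ hα hu hp (ae_inner_forceOp f p α |>.mono fun t ht v =>
    ht (H01.val D v)) (ae_inner_riesz s)]
  constructor
  · intro h
    exact ⟨fun φ hφ r => sub_eq_zero.2 (h.continuity φ hφ r),
      fun φ hφ v => sub_eq_zero.2 (h.momentum φ hφ v)⟩
  · rintro ⟨h1, h2⟩
    exact ⟨fun φ hφ r => sub_eq_zero.1 (h1 φ hφ r), fun φ hφ v => sub_eq_zero.1 (h2 φ hφ v)⟩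

theorem existsUnique_isWeakSolution (hT : 0 < T) (hρ₀ : 0 < ρ₀) (hμ : 0 < μ) (hη : 0 ≤ η)
    (hα : 0 < α) (f : LInfQT D T) (σ : L2Time T (L2 D ℝ)) (s : L2Time T (HNeg1 D))
    (u₀ : L2 D (Space d)) (p₀ : L2 D ℝ) :
    ∃! w : L2Time T (H01 D) × L2Time T (L2 D ℝ),
      IsWeakSolution D T ρ₀ μ η α f σ s u₀ p₀ w.1 w.2 := by
  obtain ⟨U, hU⟩ := exists_isSystemSolution (val := H01.val D) (div := H01.div D) hT hρ₀ hμ hη hα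
    (norm_nonneg f) (ae_norm_forceOp_le f) σ (riesz s) u₀ p₀
  refine ⟨(timeLift T (WithLp.fstL 2 ℝ (H01 D) (L2 D ℝ)) U,
    timeLift T (WithLp.sndL 2 ℝ (H01 D) (L2 D ℝ)) U),
    (isWeakSolution_iff hρ₀ hα f σ s u₀ p₀ rfl rfl).2 hU, ?_⟩
  rintro ⟨u, p⟩ h
  have h' := (isWeakSolution_iff hρ₀ hα f σ s u₀ p₀ (fst_timePair u p) (snd_timePair u p)).1 h
  rw [hU.unique hT hρ₀ hμ hη hα (norm_nonneg f) (ae_norm_forceOp_le f) h', fst_timePair,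
    snd_timePair]

/-- The weak time derivative of the velocity. -/
theorem hasWeakTimeDeriv_velocity (hρ₀ : 0 < ρ₀) (hα : 0 < α) {f : LInfQT D T}
    {σ : L2Time T (L2 D ℝ)} {S : L2Time T (H01 D)} {u₀ : L2 D (Space d)} {p₀ : L2 D ℝ}
    {U : L2Time T (WithLp 2 (H01 D × L2 D ℝ))} {u : L2Time T (H01 D)}
    (hu : timeLift T (WithLp.fstL 2 ℝ (H01 D) (L2 D ℝ)) U = u)
    (hU : IsSystemSolution (H01.val D) (H01.div D) (forceOp f) ρ₀ μ η α σ S u₀ p₀ U) :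
    HasWeakTimeDeriv T (fun t => H01.toHNeg1 D (u t)) (toDualTime
      (ρ₀⁻¹ • (S - momentumOp (H01.val D) (H01.div D) (forceOp f) μ η α U))) := by
  set x := ρ₀⁻¹ • (S - momentumOp (H01.val D) (H01.div D) (forceOp f) μ η α U) with hx
  have hf : MemLp (fun t => H01.toHNeg1 D (u t)) 2 (timeMeasure T) := by
    -- The functional `(u, ·)` has Riesz representative `val* val u`, which puts it in `L²(0, T;
    -- H⁻¹)`.
    set y := timeLift T ((H01.val D).adjoint ∘L H01.val D) u
    refine (Lp.memLp (toDualTime y)).ae_eq ?_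
    filter_upwards [ae_toDualTime y, ae_timeLift ((H01.val D).adjoint ∘L H01.val D) u]
      with t h1 h2
    rw [h1, h2]
    ext v
    rw [rieszL_apply, ContinuousLinearMap.comp_apply, ContinuousLinearMap.adjoint_inner_left]
    rfl
  refine hasWeakTimeDeriv_of_separating (fun v : H01 D => ContinuousLinearMap.apply ℝ ℝ v)
    (fun a b h => ContinuousLinearMap.ext h) hf (Lp.memLp (toDualTime x)) fun φ hφ h0 v => ?_
  have h1 := hU.integral_deriv hρ₀ hα hu φ hφ h0 v
  refine h1.trans (congrArg Neg.neg (integral_congr_ae ?_))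
  filter_upwards [ae_toDualTime x] with t ht
  rw [ContinuousLinearMap.apply_apply, ht, rieszL_apply]

/-- With data of zero mean the pressure has zero mean and a weak time derivative. -/
theorem IsWeakSolution.exists_pressure_memW12 (hT : 0 < T) (hα : 0 < α) {f : LInfQT D T}
    {σ : L2Time T (L2 D ℝ)} {s : L2Time T (HNeg1 D)} {u₀ : L2 D (Space d)} {p₀ : L2 D ℝ}
    {u : L2Time T (H01 D)} {p : L2Time T (L2 D ℝ)}
    (h : IsWeakSolution D T ρ₀ μ η α f σ s u₀ p₀ u p) (hp₀ : p₀ ∈ L2Hat D)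
    (hσ : ∀ᵐ t ∂timeMeasure T, σ t ∈ L2Hat D) :
    ∃ q : L2Time T (L2Hat D), (∀ᵐ t ∂timeMeasure T, (q t : L2 D ℝ) = p t) ∧ MemW12 T q := by
  set c : L2 D ℝ := Lp.const 2 D.measure (1 : ℝ)
  have hc : ∀ r : L2 D ℝ, inner ℝ r c = meanL D r := fun r => real_inner_comm _ _
  have hmean : ∀ᵐ t ∂timeMeasure T, meanL D (p t) = 0 := by
    have hi : Integrable (fun t => α * meanL D (p t)) (timeMeasure T) :=
      (((meanL D).comp_memLp' (Lp.memLp p)).integrable (by norm_num)).const_mul α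
    -- The continuity equation is tested with the constant function `1`: the divergence and `σ` drop
    -- out, so `α` times the mean of `p` has weak derivative zero and initial value zero.
    have key := ae_eq_add_integral_of_weak hT (x₀ := (0 : ℝ)) (g := fun _ => 0) hi
      (integrable_zero _ _ _) (by
        intro φ hφ
        have h1 := h.continuity φ hφ c
        have e1 : ∫ t, inner ℝ (σ t) c * φ t ∂timeMeasure T = 0 := by
          refine integral_eq_zero_of_ae ?_
          filter_upwards [hσ] with t ht
          rw [hc, mem_L2Hat_iff.1 ht, zero_mul]
          rfl
        simp only [hc, map_smul, smul_eq_mul, meanL_div, mem_L2Hat_iff.1 hp₀, mul_zero, zero_mul,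
          integral_zero, add_zero, sub_zero] at h1
        simp only [hc] at e1
        rw [e1] at h1
        simp only [smul_eq_mul, mul_zero, integral_zero, sub_zero]
        rw [← h1]
        simp only [mul_comm])
    filter_upwards [key] with t ht
    simp only [intervalIntegral.integral_zero, add_zero] at ht
    exact (mul_eq_zero.1 ht).resolve_left hα.ne'
  -- The projection only changes the codomain: it fixes `p t` for almost every `t`, and test
  -- elements of `L2Hat D` do not distinguish `r` from `π r`.
  set π := (L2Hat D).orthogonalProjectionOnto
  have hπ : ∀ (r : L2 D ℝ) (w : L2Hat D), inner ℝ (π r) w = inner ℝ r (w : L2 D ℝ) := fun r w =>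
    (L2Hat D).inner_orthogonalProjectionOnto_eq_of_mem_right w r
  set q := timeLift T π p
  set g : L2Time T (L2 D ℝ) := α⁻¹ • (σ - ρ₀ • timeLift T (H01.div D) u)
  refine ⟨q, ?_, timeLift T π g, ?_⟩
  · filter_upwards [ae_timeLift π p, hmean] with t h1 h2
    rw [h1]
    exact congrArg Subtype.val
      (Submodule.orthogonalProjectionOnto_mem_subspace_eq_self ⟨p t, mem_L2Hat_iff.2 h2⟩)
  refine hasWeakTimeDeriv_of_separating (fun w : L2Hat D => innerSL ℝ w)
    (fun a b hab => ext_inner_left ℝ hab) (Lp.memLp q) (Lp.memLp (timeLift T π g))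
    fun φ hφ h0 w => ?_
  have h1 := h.continuity φ hφ w
  rw [h0, mul_zero, sub_zero] at h1
  have e1 : ∫ t, innerSL ℝ w (q t) * deriv φ t ∂timeMeasure T
      = α⁻¹ * ∫ t, inner ℝ (α • p t) (w : L2 D ℝ) * deriv φ t ∂timeMeasure T := by
    rw [← integral_const_mul]
    refine integral_congr_ae ?_
    filter_upwards [ae_timeLift π p] with t ht
    rw [ht, innerSL_apply_apply, real_inner_comm, hπ, real_inner_smul_left]
    field_simp
  have i1 := integrable_inner_mul σ (w : L2 D ℝ) hφ.1.continuous
  have i2 := integrable_inner_apply_mul (ρ₀ • H01.div D) u (w : L2 D ℝ) hφ.1.continuous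
  simp only [smul_apply] at i2
  have e2 : ∫ t, innerSL ℝ w (timeLift T π g t) * φ t ∂timeMeasure T
      = α⁻¹ * (∫ t, inner ℝ (σ t) (w : L2 D ℝ) * φ t ∂timeMeasure T
        - ∫ t, inner ℝ (ρ₀ • H01.div D (u t)) (w : L2 D ℝ) * φ t ∂timeMeasure T) := by
    rw [← integral_sub i1 i2, ← integral_const_mul]
    refine integral_congr_ae ?_
    filter_upwards [ae_timeLift π g, ae_timeLift (H01.div D) u,
      Lp.coeFn_smul α⁻¹ (σ - ρ₀ • timeLift T (H01.div D) u),
      Lp.coeFn_sub σ (ρ₀ • timeLift T (H01.div D) u),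
      Lp.coeFn_smul ρ₀ (timeLift T (H01.div D) u)] with t k1 k2 k3 k4 k5
    rw [k1, innerSL_apply_apply, real_inner_comm, hπ, k3, Pi.smul_apply, k4, Pi.sub_apply, k5,
      Pi.smul_apply, k2, real_inner_smul_left, inner_sub_left]
    ring
  rw [e1, e2, ← h1]
  ring

end Bridge

/-! ### Explicit constants -/

section Estimates

/-- Since `B ≥ 1`, `√B` may be replaced by `B`; this avoids a square root of the growth factor. -/
theorem le_sqrt_mul_of_mul_sq_le {c κ B N x : ℝ} (hc : 0 < c) (hκ : 0 ≤ κ) (hB : 1 ≤ B)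
    (hN : 0 ≤ N) (h : c * x ^ 2 ≤ κ * N ^ 2 * B) : x ≤ √(κ / c) * (B * N) := by
  refine le_of_sq_le_sq ?_ (by positivity)
  rw [mul_pow, Real.sq_sqrt (by positivity), div_mul_eq_mul_div, le_div_iff₀ hc]
  have h1 : B ≤ B ^ 2 := by nlinarith
  have h2 : κ * N ^ 2 * B ≤ κ * N ^ 2 * B ^ 2 := by gcongr
  linarith [mul_pow B N 2]

/-- The constant in the energy estimate. -/
def energyConst (ρ₀ μ : ℝ) : ℝ := ρ₀ + 2 / ρ₀ + 1 / μ

/-- The exponential growth factor of the energy. -/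
def growth (T M α : ℝ) : ℝ := Real.exp ((1 + √α * M) * T)

theorem one_le_growth {T M : ℝ} (α : ℝ) (hT : 0 ≤ T) (hM : 0 ≤ M) : 1 ≤ growth T M α :=
  Real.one_le_exp (by positivity)

theorem continuous_growth (T M : ℝ) : Continuous (growth T M) := by
  unfold growth
  fun_prop

variable {d : ℕ} {D : BoundedDomain d} {T ρ₀ μ η α : ℝ} {f : LInfQT D T}
  {σ : L2Time T (L2 D ℝ)} {s : L2Time T (HNeg1 D)} {u₀ : L2 D (Space d)} {p₀ : L2 D ℝ}
  {u : L2Time T (H01 D)} {p : L2Time T (L2 D ℝ)}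

theorem dataSize_nonneg : 0 ≤ dataSize D T α σ s u₀ p₀ := by
  unfold dataSize
  positivity

/-- Each term on the left is a constant times the square of one summand of `dataSize`; the weights
`√α` and `1/√α` there are exactly those that make these constants independent of `α`. The `2 / ρ₀`
in `energyConst` collects the shares of `p₀` and `σ`. -/
theorem energy_data_le (hρ₀ : 0 < ρ₀) (hμ : 0 < μ) (hα : 0 < α) (σ : L2Time T (L2 D ℝ))
    (s : L2Time T (HNeg1 D)) (u₀ : L2 D (Space d)) (p₀ : L2 D ℝ) :
    ρ₀ * ‖u₀‖ ^ 2 + α / ρ₀ * ‖p₀‖ ^ 2 + (μ⁻¹ * ‖s‖ ^ 2 + (α * ρ₀)⁻¹ * ‖σ‖ ^ 2)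
      ≤ energyConst ρ₀ μ * dataSize D T α σ s u₀ p₀ ^ 2 := by
  have ha : 0 < √α := Real.sqrt_pos.2 hα
  have haα : √α ^ 2 = α := Real.sq_sqrt hα.le
  have b1 : 0 ≤ √α * ‖p₀‖ := by positivity
  have b2 : 0 ≤ 1 / √α * ‖σ‖ := by positivity
  have hN : dataSize D T α σ s u₀ p₀ = ‖u₀‖ + √α * ‖p₀‖ + 1 / √α * ‖σ‖ + ‖s‖ := rfl
  set N := dataSize D T α σ s u₀ p₀
  have n0 := norm_nonneg u₀
  have n3 := norm_nonneg s
  have e1 : ‖u₀‖ ^ 2 ≤ N ^ 2 := pow_le_pow_left₀ n0 (by linarith) 2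
  have e2 : (√α * ‖p₀‖) ^ 2 ≤ N ^ 2 := pow_le_pow_left₀ b1 (by linarith) 2
  have e3 : (1 / √α * ‖σ‖) ^ 2 ≤ N ^ 2 := pow_le_pow_left₀ b2 (by linarith) 2
  have e4 : ‖s‖ ^ 2 ≤ N ^ 2 := pow_le_pow_left₀ n3 (by linarith) 2
  have k2 : α / ρ₀ * ‖p₀‖ ^ 2 = 1 / ρ₀ * (√α * ‖p₀‖) ^ 2 := by
    rw [mul_pow, haα]
    ring
  have k3 : (α * ρ₀)⁻¹ * ‖σ‖ ^ 2 = 1 / ρ₀ * (1 / √α * ‖σ‖) ^ 2 := by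
    rw [mul_pow, div_pow, haα]
    field_simp
  rw [k2, k3, ← one_div]
  have m1 := mul_le_mul_of_nonneg_left e1 hρ₀.le
  have m2 := mul_le_mul_of_nonneg_left e2 (one_div_pos.2 hρ₀).le
  have m3 := mul_le_mul_of_nonneg_left e3 (one_div_pos.2 hρ₀).le
  have m4 := mul_le_mul_of_nonneg_left e4 (one_div_pos.2 hμ).le
  have : energyConst ρ₀ μ * N ^ 2
      = ρ₀ * N ^ 2 + 1 / ρ₀ * N ^ 2 + 1 / ρ₀ * N ^ 2 + 1 / μ * N ^ 2 := by
    rw [energyConst]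
    ring
  linarith

theorem energyConst_pos (hρ₀ : 0 < ρ₀) (hμ : 0 < μ) : 0 < energyConst ρ₀ μ := by
  unfold energyConst
  positivity

/-- The energy estimate for weak solutions. -/
theorem IsWeakSolution.energy (hT : 0 < T) (hρ₀ : 0 < ρ₀) (hμ : 0 < μ) (hη : 0 ≤ η) (hα : 0 < α)
    (h : IsWeakSolution D T ρ₀ μ η α f σ s u₀ p₀ u p) :
    ‖u‖ ≤ √(energyConst ρ₀ μ / μ) * (growth T ‖f‖ α * dataSize D T α σ s u₀ p₀) ∧
    (∀ᵐ t ∂timeMeasure T, ‖H01.val D (u t)‖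
      ≤ √(energyConst ρ₀ μ / ρ₀) * (growth T ‖f‖ α * dataSize D T α σ s u₀ p₀)) ∧
    ∀ᵐ t ∂timeMeasure T, √α * ‖p t‖
      ≤ √(energyConst ρ₀ μ / (1 / ρ₀)) * (growth T ‖f‖ α * dataSize D T α σ s u₀ p₀) := by
  have hU := (isWeakSolution_iff hρ₀ hα f σ s u₀ p₀ (fst_timePair u p) (snd_timePair u p)).1 h
  obtain ⟨h1, h2⟩ := hU.energy hT hρ₀ hμ hη hα (norm_nonneg f) (ae_norm_forceOp_le f)
  rw [fst_timePair, norm_riesz] at h2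
  rw [norm_riesz] at h1
  have hκ := (energyConst_pos hρ₀ hμ).le
  have hB := one_le_growth α hT.le (norm_nonneg f)
  have hN := dataSize_nonneg (α := α) (σ := σ) (s := s) (u₀ := u₀) (p₀ := p₀)
  have hK := mul_le_mul_of_nonneg_right (energy_data_le hρ₀ hμ hα σ s u₀ p₀)
    (zero_le_one.trans hB)
  refine ⟨le_sqrt_mul_of_mul_sq_le hμ hκ hB hN (h2.trans hK), ?_, ?_⟩
  · filter_upwards [h1, ae_fst_eq (fst_timePair u p)] with t ht e1
    rw [← e1] at ht
    refine le_sqrt_mul_of_mul_sq_le hρ₀ hκ hB hN ((le_add_of_nonneg_right ?_).trans (ht.trans hK))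
    positivity
  · filter_upwards [h1, ae_snd_eq (snd_timePair u p)] with t ht e1
    rw [← e1] at ht
    refine le_sqrt_mul_of_mul_sq_le (one_div_pos.2 hρ₀) hκ hB hN
      (le_trans ?_ (ht.trans hK))
    rw [mul_pow, Real.sq_sqrt hα.le]
    refine le_trans (le_of_eq ?_) (le_add_of_nonneg_left (by positivity))
    ring

/-- The constant of the energy estimate. -/
def energyBound (T ρ₀ μ M α : ℝ) : ℝ :=
  (√(energyConst ρ₀ μ / μ) + √(energyConst ρ₀ μ / ρ₀) + √(energyConst ρ₀ μ / (1 / ρ₀)))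
    * growth T M α

theorem continuous_energyBound (T ρ₀ μ M : ℝ) : Continuous (energyBound T ρ₀ μ M) :=
  continuous_const.mul (continuous_growth T M)

/-- Working in `ℝ≥0∞` makes finiteness of the `L^∞` norms part of the conclusion. -/
theorem IsWeakSolution.eLpNorm_le (hT : 0 < T) (hρ₀ : 0 < ρ₀) (hμ : 0 < μ) (hη : 0 ≤ η)
    (hα : 0 < α) (h : IsWeakSolution D T ρ₀ μ η α f σ s u₀ p₀ u p) :
    eLpNorm u 2 (timeMeasure T) + eLpNorm (fun t => H01.val D (u t)) (⊤ : ℝ≥0∞) (timeMeasure T)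
        + ENNReal.ofReal √α * eLpNorm p (⊤ : ℝ≥0∞) (timeMeasure T)
      ≤ ENNReal.ofReal (energyBound T ρ₀ μ ‖f‖ α * dataSize D T α σ s u₀ p₀) := by
  obtain ⟨h1, h2, h3⟩ := h.energy hT hρ₀ hμ hη hα
  have hB := one_le_growth α hT.le (norm_nonneg f)
  have hN := dataSize_nonneg (α := α) (σ := σ) (s := s) (u₀ := u₀) (p₀ := p₀)
  have hBN : 0 ≤ growth T ‖f‖ α * dataSize D T α σ s u₀ p₀ :=
    mul_nonneg (zero_le_one.trans hB) hN
  have ha : 0 < √α := Real.sqrt_pos.2 hα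
  rw [energyBound, mul_assoc, add_mul, add_mul, ENNReal.ofReal_add (by positivity) (by positivity),
    ENNReal.ofReal_add (by positivity) (by positivity)]
  refine add_le_add (add_le_add ?_ ?_) ?_
  · rw [← ENNReal.ofReal_toReal (Lp.eLpNorm_ne_top u), ← Lp.norm_def]
    exact ENNReal.ofReal_le_ofReal h1
  · rw [eLpNorm_exponent_top]
    exact eLpNormEssSup_le_of_ae_bound h2
  · rw [eLpNorm_exponent_top]
    have h4 : ∀ᵐ t ∂timeMeasure T, ‖p t‖ ≤ √(energyConst ρ₀ μ / (1 / ρ₀))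
        * (growth T ‖f‖ α * dataSize D T α σ s u₀ p₀) / √α := by
      filter_upwards [h3] with t ht
      rw [le_div_iff₀ ha, mul_comm]
      exact ht
    refine (mul_le_mul_right (eLpNormEssSup_le_of_ae_bound h4) _).trans ?_
    rw [← ENNReal.ofReal_mul ha.le, mul_div_cancel₀ _ ha.ne']

/-- The constant in the estimate of the time derivative of the velocity. -/
def derivBound (D : BoundedDomain d) (T ρ₀ μ η M α : ℝ) : ℝ :=
  √α * (√(energyConst ρ₀ μ / μ) * growth T M α)
    + ρ₀⁻¹ * (√α + ((μ + η * ‖H01.div D‖ ^ 2) * (√α * (√(energyConst ρ₀ μ / μ) * growth T M α))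
      + (‖H01.div D‖ + α * ‖H01.val D‖ * M)
        * ((measureUnivNNReal (timeMeasure T) : ℝ) ^ (2 : ℝ≥0∞).toReal⁻¹
          * (√(energyConst ρ₀ μ / (1 / ρ₀)) * growth T M α))))

theorem continuous_derivBound (D : BoundedDomain d) (T ρ₀ μ η M : ℝ) :
    Continuous (derivBound D T ρ₀ μ η M) := by
  have h := continuous_growth T M
  unfold derivBound
  fun_prop

/-- After multiplication by `√α` every term is bounded by the energy estimate, since `p` then
appears only as `√α ‖p‖`. -/
theorem IsWeakSolution.exists_hasWeakTimeDeriv (hT : 0 < T) (hρ₀ : 0 < ρ₀) (hμ : 0 < μ)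
    (hη : 0 ≤ η) (hα : 0 < α) (h : IsWeakSolution D T ρ₀ μ η α f σ s u₀ p₀ u p) :
    ∃ u' : L2Time T (HNeg1 D), HasWeakTimeDeriv T (fun t => H01.toHNeg1 D (u t)) u' ∧
      ‖u‖ + ‖u'‖ ≤ 1 / √α * derivBound D T ρ₀ μ η ‖f‖ α * dataSize D T α σ s u₀ p₀ := by
  have hU := (isWeakSolution_iff hρ₀ hα f σ s u₀ p₀ (fst_timePair u p) (snd_timePair u p)).1 h
  refine ⟨_, hasWeakTimeDeriv_velocity hρ₀ hα (fst_timePair u p) hU, ?_⟩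
  rw [norm_toDualTime, norm_smul, Real.norm_of_nonneg (inv_nonneg.2 hρ₀.le)]
  obtain ⟨h1, -, h3⟩ := h.energy hT hρ₀ hμ hη hα
  have hm := norm_momentumOp_le (val := H01.val D) (div := H01.div D) hμ.le hη hα.le
    (ae_norm_forceOp_le f) (fst_timePair u p) (snd_timePair u p)
  have hsub := norm_sub_le (riesz s)
    (momentumOp (H01.val D) (H01.div D) (forceOp f) μ η α (timePair u p))
  rw [norm_riesz] at hsub
  have ha : 0 < √α := Real.sqrt_pos.2 hα
  have hs : ‖s‖ ≤ dataSize D T α σ s u₀ p₀ := by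
    unfold dataSize
    exact le_add_of_nonneg_left (by positivity)
  -- Passing from the `L^∞` to the `L²` norm in time costs the square root of the length of the
  -- interval.
  have hp : √α * ‖p‖ ≤ (measureUnivNNReal (timeMeasure T) : ℝ) ^ (2 : ℝ≥0∞).toReal⁻¹
      * (√(energyConst ρ₀ μ / (1 / ρ₀)) * (growth T ‖f‖ α * dataSize D T α σ s u₀ p₀)) := by
    have hC : 0 ≤ √(energyConst ρ₀ μ / (1 / ρ₀))
        * (growth T ‖f‖ α * dataSize D T α σ s u₀ p₀) :=
      mul_nonneg (Real.sqrt_nonneg _) (mul_nonneg (Real.exp_pos _).le dataSize_nonneg)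
    have := Lp.norm_le_of_ae_bound (f := √α • p) hC (by
      filter_upwards [h3, Lp.coeFn_smul √α p] with t ht e
      rwa [e, Pi.smul_apply, norm_smul, Real.norm_of_nonneg ha.le])
    rwa [norm_smul, Real.norm_of_nonneg ha.le] at this
  set N := dataSize D T α σ s u₀ p₀
  set m := ‖momentumOp (H01.val D) (H01.div D) (forceOp f) μ η α (timePair u p)‖
  have h1' := mul_le_mul_of_nonneg_left h1 ha.le
  rw [mul_assoc, one_div_mul_eq_div, le_div_iff₀ ha, derivBound]
  have hA : 0 ≤ μ + η * ‖H01.div D‖ ^ 2 := by positivity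
  have hE : 0 ≤ ‖H01.div D‖ + α * ‖H01.val D‖ * ‖f‖ := by positivity
  have hm' : √α * m ≤ (μ + η * ‖H01.div D‖ ^ 2) * (√α * ‖u‖)
      + (‖H01.div D‖ + α * ‖H01.val D‖ * ‖f‖) * (√α * ‖p‖) := by
    refine (mul_le_mul_of_nonneg_left hm ha.le).trans (le_of_eq ?_)
    ring
  have k1 := mul_le_mul_of_nonneg_left h1' hA
  have k2 := mul_le_mul_of_nonneg_left hp hE
  have k3 := mul_le_mul_of_nonneg_left hs ha.le
  have k4 := mul_le_mul_of_nonneg_left hsub ha.le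
  have k5 := mul_le_mul_of_nonneg_left ((k4.trans_eq (mul_add _ _ _)).trans
    (add_le_add k3 (hm'.trans (add_le_add k1 k2)))) (inv_nonneg.2 hρ₀.le)
  refine le_trans (le_of_eq ?_) ((add_le_add h1' k5).trans (le_of_eq ?_)) <;> ring

end Estimates

end LinearizedFluid

end

/-! ### The main theorem -/

theorem mainTheorem1 (d : ℕ) (hd : 2 ≤ d) (D : BoundedDomain d) (T ρ₀ μ η : ℝ)
    (hT : 0 < T) (hρ₀ : 0 < ρ₀) (hμ : 0 < μ) (hη : 0 ≤ η) :
    ∃ C C' : ℝ → ℝ → ℝ,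
      (∀ M : ℝ, 0 ≤ M →
        C M =O[𝓝[>] 0] (fun _ => (1 : ℝ)) ∧ C' M =O[𝓝[>] 0] (fun _ => (1 : ℝ))) ∧
      ∀ α : ℝ, 0 < α → ∀ (f : LInfQT D T) (σ : L2Time T (L2 D ℝ)) (s : L2Time T (HNeg1 D))
        (u₀ : L2 D (Space d)) (p₀ : L2 D ℝ),
        (∃! w : L2Time T (H01 D) × L2Time T (L2 D ℝ),
          IsWeakSolution D T ρ₀ μ η α f σ s u₀ p₀ w.1 w.2) ∧
        ∀ (u : L2Time T (H01 D)) (p : L2Time T (L2 D ℝ)),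
          IsWeakSolution D T ρ₀ μ η α f σ s u₀ p₀ u p →
          (eLpNorm u 2 (timeMeasure T)
              + eLpNorm (fun t => H01.val D (u t)) ∞ (timeMeasure T)
              + ENNReal.ofReal √α * eLpNorm p ∞ (timeMeasure T)
            ≤ ENNReal.ofReal (C ‖f‖ α * dataSize D T α σ s u₀ p₀)) ∧
          (∃ u' : L2Time T (HNeg1 D),
            HasWeakTimeDeriv T (fun t => H01.toHNeg1 D (u t)) u' ∧
            ‖u‖ + ‖u'‖ ≤ 1 / √α * C' ‖f‖ α * dataSize D T α σ s u₀ p₀) ∧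
          (p₀ ∈ L2Hat D → (∀ᵐ t ∂timeMeasure T, σ t ∈ L2Hat D) →
            ∃ q : L2Time T (L2Hat D),
              (∀ᵐ t ∂timeMeasure T, (q t : L2 D ℝ) = p t) ∧ MemW12 T q) := by
  refine ⟨energyBound T ρ₀ μ, derivBound D T ρ₀ μ η, fun M _ => ⟨?_, ?_⟩, ?_⟩
  -- Both constants are continuous in `α` on all of `ℝ`, in particular at `0`, hence bounded as `α →
  -- 0⁺`.
  · exact (((continuous_energyBound T ρ₀ μ M).tendsto 0).mono_left nhdsWithin_le_nhds).isBigO_one ℝ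
  · exact (((continuous_derivBound D T ρ₀ μ η M).tendsto 0).mono_left
      nhdsWithin_le_nhds).isBigO_one ℝ
  · intro α hα f σ s u₀ p₀
    refine ⟨existsUnique_isWeakSolution hT hρ₀ hμ hη hα f σ s u₀ p₀, fun u p h => ⟨?_, ?_, ?_⟩⟩
    · exact h.eLpNorm_le hT hρ₀ hμ hη hα
    · exact h.exists_hasWeakTimeDeriv hT hρ₀ hμ hη hα
    · exact fun hp₀ hσ => h.exists_pressure_memW12 hT hα hp₀ hσ
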